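/- Notation. Let $\varphi_j=\sqrt2\sin(j\pi\,\cdot)$ and $\lambda_j=(j\pi)^2$, $j\ge 1$, be the eigenfunctions and eigenvalues of $A=-\frac{d^2}{dx^2}$ on $L^2((0,1),\mathbb C)$ with domain $H^2\cap H^1_0(0,1)$, and let $e^{-iAt}\varphi=\sum_{j\ge1}e^{-i\lambda_jt}\langle\varphi,\varphi_j\rangle\varphi_j$. For $s>0$ let $H^s_{(0)}=D(A^{s/2})$ be the space of the $\varphi\in L^2(0,1)$ with $\|\varphi\|_{H^s_{(0)}}:=\big(\sum_{j\ge1}|j^s\langle\varphi,\varphi_j\rangle|^2\big)^{1/2}<\infty$. The space $H^{2p+3}\cap H^{2p+1}_{(0)}$ of complex-valued functions on $(0,1)$ carries the intersection norm $\max(\|\cdot\|_{H^{2p+3}},\|\cdot\|_{H^{2p+1}_{(0)}})$. For a Banach space $X$, $H^k_0((0,T),X)$ is the closure of $C^\infty_c((0,T),X)$ in $H^k((0,T),X)$, and for $u\in H^k_0((0,T),\mathbb R)$ we put $\|u\|_{H^k_0}=\|u^{(k)}\|_{L^2(0,T)}$. Theorem 2.1. Let $T>0$, $p,k\in\mathbb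 N=\{0,1,2,\dots\}$, and let $\mu\in H^{2(p+k)+3}((0,1),\mathbb R)$ satisfy $\mu^{(2n+1)}(0)=\mu^{(2n+1)}(1)=0$ for all $n=0,\dots,p-1$ (no condition if $p=0$). Let $u\in H^k_0((0,T),\mathbb R)$, $\psi_0\in H^{2(p+k)+3}_{(0)}$ and $f\in H^k_0\big((0,T),H^{2p+3}\cap H^{2p+1}_{(0)}\big)$. Then the Schrödinger equation $$i\partial_t\psi=-\partial_x^2\psi-u(t)\mu(x)\psi-f(t,x)\ \text{ on }(0,T)\times(0,1),\qquad \psi(t,0)=\psi(t,1)=0,\qquad \psi(0,\cdot)=\psi_0,$$ has a unique mild solution, that is, there is a unique function $\psi\in C^k([0,T],H^{2p+3}_{(0)})$ such that, in $H^{2p+3}_{(0)}$ and for every $t\in[0,T]$, $$\psi(t)=e^{-iAt}\psi_0+i\int_0^te^{-iA(t-\tau)}\big(u(\tau)\mu\psi(\tau)+f(\tau)\big)\,d\tau .$$ Moreover, for every $R>0$ there is a constant $C>0$, depending only on $p$, $k$, $T$, $\mu$ and $R$, such that for all $u$, $\psi_0$, $f$ as above with $\|u\|_{H^k_0}<R$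 this solution satisfies $$\|\psi\|_{C^k([0,T],H^{2p+3}_{(0)})}\le C\Big(\|\psi_0\|_{H^{2(p+k)+3}_{(0)}}+\|f\|_{H^k((0,T),H^{2p+3}\cap H^{2p+1}_{(0)})}\Big),$$ where $\|\psi\|_{C^k([0,T],Y)}=\max_{0\le n\le k}\sup_{t\in[0,T]}\|\psi^{(n)}(t)\|_Y$. -/

import Mathlib

open MeasureTheory Set Filter Topology
open scoped ContDiff ENNReal

noncomputable section

namespace BilinearSchrodinger

/-- `L²((a,b), E)`. -/
abbrev L2 (E : Type*) [NormedAddCommGroup E] (a b : ℝ) : Type _ :=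
  Lp E 2 (volume.restrict (Ioo a b))

/-- The function `x ↦ √2 sin(jπx)`. -/
def sineFun (j : ℕ+) (x : ℝ) : ℂ := ((Real.sqrt 2 * Real.sin (j * Real.pi * x) : ℝ) : ℂ)

theorem memLp_sineFun (j : ℕ+) : MemLp (sineFun j) 2 (volume.restrict (Ioo (0:ℝ) 1)) := by
  refine MemLp.of_bound (Continuous.aestronglyMeasurable ?_) (Real.sqrt 2)
    (Eventually.of_forall fun x => ?_)
  · unfold sineFun; fun_prop
  · rw [sineFun, Complex.norm_real, norm_mul, Real.norm_of_nonneg (Real.sqrt_nonneg 2)]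
    exact mul_le_of_le_one_right (Real.sqrt_nonneg 2) (Real.abs_sin_le_one _)

/-- The eigenvector `φ_j = √2 sin(jπ·)` of the Dirichlet Laplacian, in `L²((0,1), ℂ)`. -/
def eigVec (j : ℕ+) : L2 ℂ 0 1 := (memLp_sineFun j).toLp (sineFun j)

/-- The eigenvalue `λ_j = (jπ)²`. -/
def eigVal (j : ℕ+) : ℝ := (j * Real.pi) ^ 2

theorem inner_eigVec (j : ℕ+) (g : L2 ℂ 0 1) :
    inner ℂ (eigVec j) g = ∫ x in Ioo (0:ℝ) 1, sineFun j x * g x := by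
  rw [L2.inner_def]
  refine integral_congr_ae ?_
  filter_upwards [(memLp_sineFun j).coeFn_toLp] with x hx
  rw [eigVec, hx]
  simp only [RCLike.inner_apply, sineFun, Complex.conj_ofReal]
  ring

theorem integral_cos_int (n : ℤ) :
    ∫ x in (0:ℝ)..1, Real.cos (n * Real.pi * x) = if n = 0 then 1 else 0 := by
  split_ifs with h
  · simp [h]
  · have hn : (n : ℝ) * Real.pi ≠ 0 := mul_ne_zero (by exact_mod_cast h) Real.pi_ne_zero
    rw [intervalIntegral.integral_comp_mul_left (fun x => Real.cos x) hn]
    simp [Real.sin_int_mul_pi]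

theorem integral_sineFun_mul (i j : ℕ+) :
    ∫ x in Ioo (0:ℝ) 1, sineFun i x * sineFun j x = if i = j then 1 else 0 := by
  have h1 : ∀ x, sineFun i x * sineFun j x =
      ((Real.cos (((i : ℤ) - (j : ℤ) : ℤ) * Real.pi * x)
        - Real.cos (((i : ℤ) + (j : ℤ) : ℤ) * Real.pi * x) : ℝ) : ℂ) := by
    intro x
    rw [sineFun, sineFun, ← Complex.ofReal_mul]
    congr 1
    have e1 : (((i : ℤ) - (j : ℤ) : ℤ) : ℝ) * Real.pi * x = i * Real.pi * x - j * Real.pi * x := by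
      push_cast; ring
    have e2 : (((i : ℤ) + (j : ℤ) : ℤ) : ℝ) * Real.pi * x = i * Real.pi * x + j * Real.pi * x := by
      push_cast; ring
    rw [e1, e2, Real.cos_sub, Real.cos_add]
    have := Real.mul_self_sqrt (show (0:ℝ) ≤ 2 by norm_num)
    linear_combination (Real.sin (i * Real.pi * x) * Real.sin (j * Real.pi * x)) * this
  simp_rw [h1]
  rw [integral_complex_ofReal, ← integral_Ioc_eq_integral_Ioo,
    ← intervalIntegral.integral_of_le zero_le_one,
    intervalIntegral.integral_sub (Continuous.intervalIntegrable (by fun_prop) _ _)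
      (Continuous.intervalIntegrable (by fun_prop) _ _), integral_cos_int, integral_cos_int]
  have hi := i.pos
  have hj := j.pos
  have h2 : ((i : ℤ) + (j : ℤ)) ≠ 0 := by omega
  have h3 : ((i : ℤ) - (j : ℤ) = 0) ↔ i = j := by
    rw [sub_eq_zero]; exact_mod_cast Iff.rfl
  rw [if_neg h2]
  simp only [h3]
  split_ifs <;> simp

theorem orthonormal_eigVec : Orthonormal ℂ eigVec := by
  rw [orthonormal_iff_ite]
  intro i j
  rw [inner_eigVec, ← integral_sineFun_mul]
  refine integral_congr_ae ?_
  filter_upwards [(memLp_sineFun j).coeFn_toLp] with x hx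
  rw [eigVec, hx]

theorem integral_sin_mul_cos_pow (g : L2 ℂ 0 1) (hg : ∀ j, inner ℂ (eigVec j) g = 0) (n : ℕ) :
    ∀ j : ℕ, ∫ x in Ioo (0:ℝ) 1, ((Real.sin (j * Real.pi * x) *
      Real.cos (Real.pi * x) ^ n : ℝ) : ℂ) * g x = 0 := by
  have hgi : Integrable g (volume.restrict (Ioo (0:ℝ) 1)) := (Lp.memLp g).integrable (by norm_num)
  have hint : ∀ (j n : ℕ), Integrable (fun x => ((Real.sin (j * Real.pi * x) *
      Real.cos (Real.pi * x) ^ n : ℝ) : ℂ) * g x) (volume.restrict (Ioo (0:ℝ) 1)) := by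
    intro j n
    refine hgi.bdd_mul (c := 1) (Continuous.aestronglyMeasurable (by fun_prop))
      (Eventually.of_forall fun x => ?_)
    rw [Complex.norm_real, norm_mul, norm_pow]
    exact mul_le_one₀ (Real.abs_sin_le_one _) (by positivity)
      (pow_le_one₀ (abs_nonneg _) (Real.abs_cos_le_one _))
  induction n with
  | zero =>
    intro j
    rcases Nat.eq_zero_or_pos j with rfl | hj
    · simp
    · have h := (inner_eigVec ⟨j, hj⟩ g).symm.trans (hg _)
      have h2 : ∀ x, sineFun ⟨j, hj⟩ x * g x = (Real.sqrt 2 : ℂ) *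
          (((Real.sin (j * Real.pi * x) * Real.cos (Real.pi * x) ^ 0 : ℝ) : ℂ) * g x) := by
        intro x; simp [sineFun, mul_assoc]
      simp_rw [h2] at h
      rw [integral_const_mul] at h
      exact (mul_eq_zero.1 h).resolve_left (by norm_num)
  | succ n ih =>
    intro j
    rcases Nat.eq_zero_or_pos j with rfl | hj
    · simp
    obtain ⟨m, rfl⟩ : ∃ m, j = m + 1 := ⟨j - 1, by omega⟩
    have h2 : ∀ x, ((Real.sin ((m + 1 : ℕ) * Real.pi * x) *
          Real.cos (Real.pi * x) ^ (n + 1) : ℝ) : ℂ) * g x =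
        (1 / 2 : ℂ) * (((Real.sin ((m + 2 : ℕ) * Real.pi * x) *
          Real.cos (Real.pi * x) ^ n : ℝ) : ℂ) * g x) +
        (1 / 2 : ℂ) * (((Real.sin (m * Real.pi * x) *
          Real.cos (Real.pi * x) ^ n : ℝ) : ℂ) * g x) := by
      intro x
      have h3 : Real.sin ((m + 1 : ℕ) * Real.pi * x) * Real.cos (Real.pi * x) =
          1 / 2 * Real.sin ((m + 2 : ℕ) * Real.pi * x) + 1 / 2 * Real.sin (m * Real.pi * x) := by
        have e1 : ((m + 2 : ℕ) : ℝ) * Real.pi * x = (m + 1 : ℕ) * Real.pi * x + Real.pi * x := by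
          push_cast; ring
        have e2 : (m : ℝ) * Real.pi * x = (m + 1 : ℕ) * Real.pi * x - Real.pi * x := by
          push_cast; ring
        rw [e1, e2, Real.sin_add, Real.sin_sub]; ring
      rw [pow_succ', ← mul_assoc, h3]
      push_cast; ring
    simp_rw [h2]
    rw [integral_add ((hint _ _).const_mul _) ((hint _ _).const_mul _), integral_const_mul,
      integral_const_mul, ih, ih]
    simp

theorem eq_zero_of_inner_eigVec (g : L2 ℂ 0 1) (hg : ∀ j, inner ℂ (eigVec j) g = 0) : g = 0 := by
  have hgi : Integrable g (volume.restrict (Ioo (0:ℝ) 1)) := (Lp.memLp g).integrable (by norm_num)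
  set h : ℝ → ℂ := fun x => (Real.sin (Real.pi * x) : ℂ) * g x with hh
  have hhi : Integrable h (volume.restrict (Ioo (0:ℝ) 1)) := by
    refine hgi.bdd_mul (c := 1) (Continuous.aestronglyMeasurable (by fun_prop))
      (Eventually.of_forall fun x => ?_)
    rw [Complex.norm_real]; exact Real.abs_sin_le_one _
  have hbd : ∀ (q : ℝ → ℝ) (c : ℝ), Continuous q → (∀ x ∈ Ioo (0:ℝ) 1, |q x| ≤ c) →
      Integrable (fun x => q x • h x) (volume.restrict (Ioo (0:ℝ) 1)) := by
    intro q c hq hc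
    refine hhi.bdd_smul c hq.aestronglyMeasurable ?_
    filter_upwards [self_mem_ae_restrict measurableSet_Ioo] with x hx using hc x hx
  have hmon : ∀ n : ℕ, Integrable (fun x => (Real.cos (Real.pi * x) ^ n) • h x)
      (volume.restrict (Ioo (0:ℝ) 1)) := fun n =>
    hbd _ 1 (by fun_prop) fun x _ => by
      rw [abs_pow]; exact pow_le_one₀ (abs_nonneg _) (Real.abs_cos_le_one _)
  have hpoly : ∀ P : Polynomial ℝ, Integrable (fun x => (P.eval (Real.cos (Real.pi * x))) • h x)
      (volume.restrict (Ioo (0:ℝ) 1)) ∧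
      ∫ x in Ioo (0:ℝ) 1, (P.eval (Real.cos (Real.pi * x))) • h x = 0 := by
    intro P
    induction P using Polynomial.induction_on' with
    | add p q hp hq =>
      simp only [Polynomial.eval_add, add_smul]
      refine ⟨hp.1.add hq.1, ?_⟩
      rw [integral_add hp.1 hq.1, hp.2, hq.2, add_zero]
    | monomial n a =>
      simp only [Polynomial.eval_monomial, mul_smul]
      refine ⟨(hmon n).smul a, ?_⟩
      rw [integral_smul]
      have := integral_sin_mul_cos_pow g hg n 1
      have h4 : ∀ x, ((Real.sin ((1 : ℕ) * Real.pi * x) * Real.cos (Real.pi * x) ^ n : ℝ) : ℂ) * g x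
          = (Real.cos (Real.pi * x) ^ n) • h x := by
        intro x
        rw [hh, Complex.real_smul]; push_cast; ring_nf
      simp_rw [h4] at this
      rw [this, smul_zero]
  have hae := isOpen_Ioo.ae_eq_zero_of_integral_contDiff_smul_eq_zero (E := ℝ)
    (U := Ioo (0:ℝ) 1) (f := h) (μ := volume.restrict (Ioo (0:ℝ) 1))
    (hhi.locallyIntegrable.locallyIntegrableOn _) (by
      intro q hq hqc _
      obtain ⟨c, hc⟩ := hq.continuous.bounded_above_of_compact_support hqc
      have hqi := hbd q c hq.continuous fun x _ => hc x
      by_contra hne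
      set N := ∫ x in Ioo (0:ℝ) 1, ‖h x‖ with hN
      have hN0 : 0 ≤ N := integral_nonneg fun x => norm_nonneg _
      have hpos : 0 < ‖∫ x in Ioo (0:ℝ) 1, q x • h x‖ := norm_pos_iff.2 hne
      set ε := ‖∫ x in Ioo (0:ℝ) 1, q x • h x‖ / (N + 1) with hε
      have hε0 : 0 < ε := by positivity
      obtain ⟨P, hP⟩ := exists_polynomial_near_of_continuousOn (-1) 1
        (fun y => q (Real.arccos y / Real.pi))
        ((hq.continuous.comp (Real.continuous_arccos.div_const _)).continuousOn) ε hε0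
      have hle : ‖∫ x in Ioo (0:ℝ) 1, q x • h x‖ ≤ ε * N := by
        have e1 : ∫ x in Ioo (0:ℝ) 1, q x • h x =
            ∫ x in Ioo (0:ℝ) 1, (q x • h x - (P.eval (Real.cos (Real.pi * x))) • h x) := by
          rw [integral_sub hqi (hpoly P).1, (hpoly P).2, sub_zero]
        rw [e1, hN, ← integral_const_mul]
        refine norm_integral_le_of_norm_le (hhi.norm.const_mul _) ?_
        filter_upwards [self_mem_ae_restrict measurableSet_Ioo] with x hx
        rw [← sub_smul, norm_smul]
        refine mul_le_mul_of_nonneg_right ?_ (norm_nonneg _)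
        have h5 := hP (Real.cos (Real.pi * x)) ⟨Real.neg_one_le_cos _, Real.cos_le_one _⟩
        rw [Real.arccos_cos (by have := hx.1; positivity)
          (mul_le_of_le_one_right Real.pi_pos.le hx.2.le),
          mul_div_cancel_left₀ _ Real.pi_ne_zero, abs_sub_comm] at h5
        exact h5.le
      have : ε * (N + 1) = ‖∫ x in Ioo (0:ℝ) 1, q x • h x‖ := by
        rw [hε]; field_simp
      nlinarith)
  rw [Lp.eq_zero_iff_ae_eq_zero]
  filter_upwards [hae, self_mem_ae_restrict measurableSet_Ioo] with x hx hx1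
  have h6 := hx hx1
  rw [hh] at h6
  refine (mul_eq_zero.1 h6).resolve_left ?_
  exact_mod_cast (Real.sin_pos_of_pos_of_lt_pi (mul_pos Real.pi_pos hx1.1)
    (by nlinarith [Real.pi_pos, hx1.2])).ne'

/-- The orthonormal basis `(φ_j)` of `L²((0,1), ℂ)`. -/
def eigBasis : HilbertBasis ℕ+ ℂ (L2 ℂ 0 1) :=
  HilbertBasis.mkOfOrthogonalEqBot orthonormal_eigVec (by
    rw [Submodule.eq_bot_iff]
    intro g hg
    refine eq_zero_of_inner_eigVec g fun j => ?_
    exact (Submodule.mem_orthogonal _ _).1 hg _ (Submodule.subset_span ⟨j, rfl⟩))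

theorem eigBasis_apply (j : ℕ+) : eigBasis j = eigVec j := by
  simp [eigBasis]

/-! ### The group `e^{-iAt}` and the spaces `H^s_{(0)}(0,1) = D(A^{s/2})` -/

/-- `e^{-iAt} φ = ∑_j e^{-i λ_j t} ⟨φ, φ_j⟩ φ_j`; the series converges in `L²` by
`hasSum_schrodingerGroup`. (`inner ℂ` is conjugate-linear in its first argument, so that
`inner ℂ (eigVec j) φ` is the coefficient `⟨φ, φ_j⟩`.) -/
def schrodingerGroup (t : ℝ) (φ : L2 ℂ 0 1) : L2 ℂ 0 1 :=
  ∑' j : ℕ+, (Complex.exp (-Complex.I * eigVal j * t) * inner ℂ (eigVec j) φ) • eigVec j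

theorem hasSum_schrodingerGroup (t : ℝ) (φ : L2 ℂ 0 1) :
    HasSum (fun j : ℕ+ =>
      (Complex.exp (-Complex.I * eigVal j * t) * inner ℂ (eigVec j) φ) • eigVec j)
      (schrodingerGroup t φ) := by
  have hmem : Memℓp (fun j : ℕ+ =>
      Complex.exp (-Complex.I * eigVal j * t) * inner ℂ (eigVec j) φ) 2 := by
    have h := lp.memℓp (eigBasis.repr φ)
    rw [memℓp_gen_iff (by norm_num)] at h ⊢
    convert h using 3 with j
    rw [norm_mul, Complex.norm_exp, HilbertBasis.repr_apply_apply, eigBasis_apply]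
    simp
  have h := eigBasis.hasSum_repr_symm ⟨_, hmem⟩
  simp only [eigBasis_apply] at h
  exact h.summable.hasSum

/-- The functions `φ ∈ L²((0,1), ℂ)` with `(j^s ⟨φ, φ_j⟩)_j ∈ ℓ²`, that is `D(A^{s/2})`. -/
def hZeroSubmodule (s : ℕ) : Submodule ℂ (L2 ℂ 0 1) where
  carrier := {φ | Memℓp (fun j : ℕ+ => (j : ℂ) ^ s * inner ℂ (eigVec j) φ) 2}
  zero_mem' := by
    show Memℓp _ 2
    simp only [inner_zero_right, mul_zero]
    exact zero_memℓp
  add_mem' := by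
    intro f g hf hg
    have := Memℓp.add hf hg
    show Memℓp _ 2
    simp only [inner_add_right, mul_add]
    exact this
  smul_mem' := by
    intro c f hf
    have := Memℓp.const_mul hf c
    show Memℓp _ 2
    simp only [inner_smul_right, mul_left_comm _ c]
    exact this

/-- The space `H^s_{(0)}(0,1)`, with the norm `‖(j^s ⟨φ, φ_j⟩)_j‖_{ℓ²}`
(and not the norm of `L²`). -/
def HZero (s : ℕ) : Type := hZeroSubmodule s

instance (s : ℕ) : AddCommGroup (HZero s) := inferInstanceAs (AddCommGroup (hZeroSubmodule s))

instance (s : ℕ) : Module ℂ (HZero s) := inferInstanceAs (Module ℂ (hZeroSubmodule s))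

/-- The inclusion of `H^s_{(0)}(0,1)` in `L²((0,1), ℂ)`. -/
def HZero.toL2 {s : ℕ} : HZero s →ₗ[ℂ] L2 ℂ 0 1 := (hZeroSubmodule s).subtype

/-- `φ ↦ (j^s ⟨φ, φ_j⟩)_j`. -/
def HZero.coeffs (s : ℕ) : HZero s →ₗ[ℂ] lp (fun _ : ℕ+ => ℂ) 2 where
  toFun φ := ⟨fun j => (j : ℂ) ^ s * inner ℂ (eigVec j) φ.toL2, φ.2⟩
  map_add' f g := by
    ext j
    simp only [map_add, inner_add_right, mul_add]
    rfl
  map_smul' c f := by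
    ext j
    simp [inner_smul_right]
    ring

theorem HZero.toL2_injective {s : ℕ} : Function.Injective (HZero.toL2 (s := s)) :=
  Subtype.val_injective

theorem HZero.coeffs_injective (s : ℕ) : Function.Injective (HZero.coeffs s) := by
  rw [injective_iff_map_eq_zero]
  intro φ h
  apply HZero.toL2_injective
  rw [map_zero]
  refine eq_zero_of_inner_eigVec _ fun j => ?_
  have h1 : (j : ℂ) ^ s * inner ℂ (eigVec j) φ.toL2 = 0 :=
    congrArg (fun v : lp (fun _ : ℕ+ => ℂ) 2 => v j) h
  refine (mul_eq_zero.1 h1).resolve_left (pow_ne_zero _ ?_)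
  exact_mod_cast j.ne_zero

theorem HZero.coeffs_surjective (s : ℕ) : Function.Surjective (HZero.coeffs s) := by
  intro a
  have hmem : Memℓp (fun j : ℕ+ => ((j : ℂ) ^ s)⁻¹ * a j) 2 := by
    have h := lp.memℓp a
    rw [memℓp_gen_iff (by norm_num)] at h ⊢
    refine Summable.of_nonneg_of_le (fun j => by positivity) (fun j => ?_) h
    refine Real.rpow_le_rpow (norm_nonneg _) ?_ (by norm_num)
    rw [norm_mul, norm_inv, norm_pow]
    refine mul_le_of_le_one_left (norm_nonneg _) (inv_le_one_of_one_le₀ (one_le_pow₀ ?_))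
    rw [show ((j : ℂ)) = ((j : ℕ) : ℂ) from rfl, Complex.norm_natCast]
    exact_mod_cast (one_le (a := j))
  have hc : ∀ j, inner ℂ (eigVec j) (eigBasis.repr.symm ⟨_, hmem⟩) = ((j : ℂ) ^ s)⁻¹ * a j := by
    intro j
    rw [← eigBasis_apply, ← HilbertBasis.repr_apply_apply, LinearIsometryEquiv.apply_symm_apply]
  have hj : ∀ j : ℕ+, (j : ℂ) ^ s * inner ℂ (eigVec j) (eigBasis.repr.symm ⟨_, hmem⟩) = a j := by
    intro j
    rw [hc, mul_inv_cancel_left₀ (pow_ne_zero _ (by exact_mod_cast j.ne_zero))]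
  refine ⟨⟨eigBasis.repr.symm ⟨_, hmem⟩, ?_⟩, ?_⟩
  · show Memℓp _ 2
    simp_rw [hj]
    exact lp.memℓp a
  · ext j
    exact hj j

instance (s : ℕ) : NormedAddCommGroup (HZero s) :=
  NormedAddCommGroup.induced (HZero s) (lp (fun _ : ℕ+ => ℂ) 2) (HZero.coeffs s)
    (HZero.coeffs_injective s)

instance (s : ℕ) : NormedSpace ℂ (HZero s) :=
  NormedSpace.induced ℂ (HZero s) (lp (fun _ : ℕ+ => ℂ) 2) (HZero.coeffs s)

instance (s : ℕ) : CompleteSpace (HZero s) := by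
  let e : HZero s ≃ₗᵢ[ℂ] lp (fun _ : ℕ+ => ℂ) 2 :=
    ⟨LinearEquiv.ofBijective (HZero.coeffs s) ⟨HZero.coeffs_injective s, HZero.coeffs_surjective s⟩,
      fun _ => rfl⟩
  exact e.toIsometryEquiv.completeSpace

theorem HZero.norm_toL2_le {s : ℕ} (φ : HZero s) : ‖φ.toL2‖ ≤ ‖φ‖ := by
  rw [← eigBasis.repr.norm_map, show ‖φ‖ = ‖HZero.coeffs s φ‖ from rfl]
  rw [lp.norm_eq_tsum_rpow (by norm_num), lp.norm_eq_tsum_rpow (by norm_num)]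
  refine Real.rpow_le_rpow (tsum_nonneg fun j => by positivity) ?_ (by norm_num)
  refine Summable.tsum_le_tsum (fun j => ?_) ((memℓp_gen_iff (by norm_num)).1 (lp.memℓp _))
    ((memℓp_gen_iff (by norm_num)).1 (lp.memℓp _))
  refine Real.rpow_le_rpow (norm_nonneg _) ?_ (by norm_num)
  rw [HilbertBasis.repr_apply_apply, eigBasis_apply]
  show _ ≤ ‖(j : ℂ) ^ s * inner ℂ (eigVec j) φ.toL2‖
  rw [norm_mul, norm_pow]
  refine le_mul_of_one_le_left (norm_nonneg _) (one_le_pow₀ ?_)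
  rw [show ((j : ℂ)) = ((j : ℕ) : ℂ) from rfl, Complex.norm_natCast]
  exact_mod_cast (one_le (a := j))

/-! ### Sobolev spaces of functions on an interval with values in a Banach space -/

section Sobolev

variable {E : Type*} [NormedAddCommGroup E] [NormedSpace ℝ E] {a b : ℝ}

/-- `φ ∈ C_c^∞((a,b), E)`. -/
def IsTestFun (E : Type*) [NormedAddCommGroup E] [NormedSpace ℝ E] (a b : ℝ) (φ : ℝ → E) : Prop :=
  ContDiff ℝ ∞ φ ∧ HasCompactSupport φ ∧ tsupport φ ⊆ Ioo a b

/-- `g'` is the weak derivative of `g` on `(a,b)`. -/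
def IsWeakDeriv (g g' : L2 E a b) : Prop :=
  ∀ φ : ℝ → ℝ, IsTestFun ℝ a b φ →
    ∫ x in Ioo a b, deriv φ x • g x = -∫ x in Ioo a b, φ x • g' x

theorem integrable_smul_L2 {q : ℝ → ℝ} (hq : Continuous q) (hc : HasCompactSupport q)
    (g : L2 E a b) : Integrable (fun x => q x • g x) (volume.restrict (Ioo a b)) := by
  obtain ⟨c, hc⟩ := hq.bounded_above_of_compact_support hc
  exact ((Lp.memLp g).integrable (by norm_num)).bdd_smul c hq.aestronglyMeasurable
    (Eventually.of_forall hc)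

theorem continuous_integral_smul_L2 {q : ℝ → ℝ} (hq : Continuous q) (hc : HasCompactSupport q) :
    Continuous fun g : L2 E a b => ∫ x in Ioo a b, q x • g x := by
  obtain ⟨c, hcb⟩ := hq.bounded_above_of_compact_support hc
  have hq2 : MemLp q ∞ (volume.restrict (Ioo a b)) :=
    memLp_top_of_bound hq.aestronglyMeasurable c (Eventually.of_forall hcb)
  have hq3 : MemLp q 2 (volume.restrict (Ioo a b)) := hq2.mono_exponent le_top
  have hlip : LipschitzWith (eLpNorm q 2 (volume.restrict (Ioo a b))).toNNReal
      fun g : L2 E a b => ∫ x in Ioo a b, q x • g x := by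
    intro g h
    rw [edist_eq_enorm_sub, ← integral_sub (integrable_smul_L2 hq hc g) (integrable_smul_L2 hq hc h),
      ENNReal.coe_toNNReal hq3.eLpNorm_ne_top, Lp.edist_def]
    refine (enorm_integral_le_lintegral_enorm _).trans ?_
    rw [← eLpNorm_one_eq_lintegral_enorm]
    have := eLpNorm_smul_le_mul_eLpNorm (p := 2) (q := 2) (r := 1)
      ((Lp.aestronglyMeasurable g).sub (Lp.aestronglyMeasurable h)) hq3.aestronglyMeasurable
    refine le_trans (le_of_eq ?_) this
    congr 1
    ext x
    simp [smul_sub]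
  exact hlip.continuous

theorem IsTestFun.deriv_props {φ : ℝ → ℝ} (h : IsTestFun ℝ a b φ) :
    Continuous (deriv φ) ∧ HasCompactSupport (deriv φ) :=
  ⟨h.1.continuous_deriv (by simp), h.2.1.deriv⟩

/-- The tuples `(g, g', …, g^{(m)})` of an `L²` function and its weak derivatives in `L²`. -/
def sobolevSubmodule (E : Type*) [NormedAddCommGroup E] [NormedSpace ℝ E] (a b : ℝ) (m : ℕ) :
    Submodule ℝ (PiLp 2 fun _ : Fin (m + 1) => L2 E a b) where
  carrier := {w | ∀ i : Fin m, IsWeakDeriv (w i.castSucc) (w i.succ)}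
  zero_mem' := by
    intro i φ _
    have h1 : ∀ q : ℝ → ℝ, ∫ x in Ioo a b, q x • (0 : L2 E a b) x = 0 := fun q => by
      rw [integral_eq_zero_of_ae]
      filter_upwards [Lp.coeFn_zero E 2 (volume.restrict (Ioo a b))] with x hx
      rw [hx, Pi.zero_apply, smul_zero]
    rw [PiLp.zero_apply, PiLp.zero_apply, h1, h1, neg_zero]
  add_mem' := by
    intro v w hv hw i φ hφ
    have h1 : ∀ q : ℝ → ℝ, Continuous q → HasCompactSupport q → ∀ g h : L2 E a b,
        ∫ x in Ioo a b, q x • (g + h) x =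
          (∫ x in Ioo a b, q x • g x) + ∫ x in Ioo a b, q x • h x := by
      intro q hq hc g h
      rw [← integral_add (integrable_smul_L2 hq hc g) (integrable_smul_L2 hq hc h)]
      refine integral_congr_ae ?_
      filter_upwards [Lp.coeFn_add g h] with x hx
      rw [hx, Pi.add_apply, smul_add]
    rw [PiLp.add_apply, PiLp.add_apply, h1 _ hφ.deriv_props.1 hφ.deriv_props.2,
      h1 _ hφ.1.continuous hφ.2.1, hv i φ hφ, hw i φ hφ, neg_add]
  smul_mem' := by
    intro c w hw i φ hφ
    have h1 : ∀ q : ℝ → ℝ, ∀ g : L2 E a b,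
        ∫ x in Ioo a b, q x • (c • g) x = c • ∫ x in Ioo a b, q x • g x := by
      intro q g
      rw [← integral_smul]
      refine integral_congr_ae ?_
      filter_upwards [Lp.coeFn_smul c g] with x hx
      rw [hx, Pi.smul_apply, smul_comm]
    rw [PiLp.smul_apply, PiLp.smul_apply, h1, h1, hw i φ hφ, smul_neg]

/-- The Sobolev space `H^m((a,b), E)`. An element is stored together with its weak derivatives
(which it determines), and the norm is `(∑_{i ≤ m} ‖g^{(i)}‖²_{L²})^{1/2}`. -/
abbrev Sobolev (E : Type*) [NormedAddCommGroup E] [NormedSpace ℝ E] (a b : ℝ) (m : ℕ) : Type _ :=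
  sobolevSubmodule E a b m

instance [CompleteSpace E] (m : ℕ) : CompleteSpace (Sobolev E a b m) := by
  have hcl : IsClosed (sobolevSubmodule E a b m : Set (PiLp 2 fun _ : Fin (m + 1) => L2 E a b)) := by
    have : (sobolevSubmodule E a b m : Set (PiLp 2 fun _ : Fin (m + 1) => L2 E a b)) =
        ⋂ (i : Fin m) (φ : ℝ → ℝ) (_ : IsTestFun ℝ a b φ),
          {w | ∫ x in Ioo a b, deriv φ x • w i.castSucc x
            = -∫ x in Ioo a b, φ x • w i.succ x} := by
      ext w
      simp only [mem_iInter]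
      rfl
    rw [this]
    refine isClosed_iInter fun i => isClosed_iInter fun φ => isClosed_iInter fun hφ => ?_
    have h1 := (continuous_integral_smul_L2 (E := E) (a := a) (b := b)
      hφ.deriv_props.1 hφ.deriv_props.2).comp
        (PiLp.continuous_apply 2 (fun _ : Fin (m + 1) => L2 E a b) i.castSucc)
    have h2 := (continuous_integral_smul_L2 (E := E) (a := a) (b := b)
      hφ.1.continuous hφ.2.1).comp
        (PiLp.continuous_apply 2 (fun _ : Fin (m + 1) => L2 E a b) i.succ)
    exact isClosed_eq h1 h2.neg
  exact hcl.completeSpace_coe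

/-- The `i`-th weak derivative of an element of `H^m((a,b), E)`, for `i ≤ m`. -/
def Sobolev.der {m : ℕ} (w : Sobolev E a b m) (i : Fin (m + 1)) : L2 E a b := w.1 i

/-- The element of `L²((a,b), E)` underlying an element of `H^m((a,b), E)`. -/
def Sobolev.fn {m : ℕ} (w : Sobolev E a b m) : L2 E a b := w.der 0

/-- `H^m_0((a,b), E)`: the closure of `C_c^∞((a,b), E)` in `H^m((a,b), E)`. -/
def sobolevZero (E : Type*) [NormedAddCommGroup E] [NormedSpace ℝ E] (a b : ℝ) (m : ℕ) :
    Set (Sobolev E a b m) :=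
  closure {w | ∃ φ : ℝ → E, IsTestFun E a b φ ∧
    ∀ i : Fin (m + 1), w.der i =ᵐ[volume.restrict (Ioo a b)] iteratedDeriv i φ}

/-- The norm `‖u^{(m)}‖_{L²(a,b)}` used on `H^m_0((a,b), E)`. -/
def sobolevZeroNorm {m : ℕ} (w : Sobolev E a b m) : ℝ := ‖w.der (Fin.last m)‖

/-- The continuous representative on `[a,b]` of `g` vanishes at `a` and `b`. -/
def VanishesAtEnds (g : L2 E a b) : Prop :=
  ∃ h : ℝ → E, ContinuousOn h (Icc a b) ∧ g =ᵐ[volume.restrict (Ioo a b)] h ∧ h a = 0 ∧ h b = 0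

end Sobolev

/-! ### The space `H^m ∩ H^s_{(0)}(0,1)` -/

/-- Pairs consisting of an element of `H^m((0,1), ℂ)` and an element of `H^s_{(0)}(0,1)` with the
same underlying function. -/
def interSubmodule (m s : ℕ) : Submodule ℝ (Sobolev ℂ 0 1 m × HZero s) where
  carrier := {z | z.1.fn = z.2.toL2}
  zero_mem' := by
    show (0 : L2 ℂ 0 1) = HZero.toL2 0
    rw [map_zero]
  add_mem' := by
    intro y z hy hz
    show y.1.fn + z.1.fn = HZero.toL2 (y.2 + z.2)
    rw [map_add, ← hy, ← hz]
  smul_mem' := by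
    intro c z hz
    show c • z.1.fn = HZero.toL2 ((c : ℂ) • z.2)
    rw [map_smul, ← hz]
    rfl

/-- The space `H^m ∩ H^s_{(0)}(0,1)`, with the norm `max (‖g‖_{H^m}) (‖g‖_{H^s_{(0)}})`. -/
def InterSpace (m s : ℕ) : Type := interSubmodule m s

instance (m s : ℕ) : NormedAddCommGroup (InterSpace m s) :=
  inferInstanceAs (NormedAddCommGroup (interSubmodule m s))

instance (m s : ℕ) : NormedSpace ℝ (InterSpace m s) :=
  inferInstanceAs (NormedSpace ℝ (interSubmodule m s))

instance (m s : ℕ) : CompleteSpace (InterSpace m s) := by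
  have hcl : IsClosed (interSubmodule m s : Set (Sobolev ℂ 0 1 m × HZero s)) := by
    refine isClosed_eq (f := fun z : Sobolev ℂ 0 1 m × HZero s => z.1.fn)
      (g := fun z => z.2.toL2) ?_ ?_
    · exact (PiLp.continuous_apply 2 _ _).comp (continuous_subtype_val.comp continuous_fst)
    · have : Continuous (HZero.toL2 (s := s)) :=
        (HZero.toL2.mkContinuous 1 fun φ => by simpa using HZero.norm_toL2_le φ).continuous
      exact this.comp continuous_snd
  exact hcl.completeSpace_coe

/-- The element of `L²((0,1), ℂ)` underlying an element of `H^m ∩ H^s_{(0)}(0,1)`. -/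
def InterSpace.toL2 {m s : ℕ} (g : InterSpace m s) : L2 ℂ 0 1 := g.1.1.fn

/-! ### Mild solutions -/

/-- The norm `max_{n ≤ k} sup_{t ∈ [0,T]} ‖ψ^{(n)}(t)‖` of `C^k([0,T], Y)`, in `[0,∞]`. -/
def ckNorm {Y : Type*} [NormedAddCommGroup Y] [NormedSpace ℝ Y] (T : ℝ) (k : ℕ) (ψ : ℝ → Y) :
    ℝ≥0∞ :=
  ⨆ (n : ℕ) (_ : n ≤ k) (t : ℝ) (_ : t ∈ Icc 0 T), ‖iteratedDerivWithin n ψ (Icc 0 T) t‖ₑ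

/-- `ψ ∈ C^k([0,T], H^{2p+3}_{(0)})` and, for all `t ∈ [0,T]`,
`ψ(t) = e^{-iAt} ψ₀ + i ∫₀ᵗ e^{-iA(t-τ)} (u(τ) μ ψ(τ) + f(τ)) dτ`.
Here `F(τ) = u(τ) μ ψ(τ) + f(τ)`, as an integrable function of `τ` with values in `L²(0,1)`.
All terms are compared as elements of `L²(0,1)`; since `ψ(t)` and `e^{-iAt} ψ₀` lie in
`H^{2p+3}_{(0)}`, so does the integral, and the identity is one in `H^{2p+3}_{(0)}`.
The values of `ψ` outside `[0,T]` are irrelevant. -/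
structure IsMildSolution (T : ℝ) (p k : ℕ) {m s : ℕ} (μ : Sobolev ℝ 0 1 m) (u : Sobolev ℝ 0 T k)
    (f : Sobolev (InterSpace (2 * p + 3) (2 * p + 1)) 0 T k) (ψ₀ : HZero s)
    (ψ : ℝ → HZero (2 * p + 3)) : Prop where
  contDiffOn : ContDiffOn ℝ k ψ (Icc 0 T)
  duhamel : ∃ F : ℝ → L2 ℂ 0 1, IntervalIntegrable F volume 0 T ∧
    (∀ᵐ τ ∂(volume.restrict (Ioo 0 T)), F τ =ᵐ[volume.restrict (Ioo (0:ℝ) 1)] fun x =>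
      (u.fn τ : ℂ) * (μ.fn x : ℂ) * (ψ τ).toL2 x + (f.fn τ).toL2 x) ∧
    ∀ t ∈ Icc 0 T, (ψ t).toL2 = schrodingerGroup t ψ₀.toL2 +
      Complex.I • ∫ τ in (0:ℝ)..t, schrodingerGroup (t - τ) (F τ)

end BilinearSchrodinger
end

open BilinearSchrodinger

/-!
Let `x` lie in `H^{2n+1} ∩ H^{2n-1}_{(0)}`. Integrating by parts `2n + 1` times turns
`(jπ)^{2n+1} ⟨x, φ_j⟩`, up to sign, into the `j`-th cosine coefficient of `x^{(2n+1)}` plus the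
boundary values of `x^{(2n)}`, those of the lower even derivatives being zero. For a source
depending on `t`, Bessel's inequality in `x` controls the cosine coefficients; the boundary values
do not decay in `j`, but the Duhamel integral turns them into their Fourier coefficients in `t` at
the frequencies `λ_j`, distinct multiples of `π²`, to which Bessel's inequality in `t` applies.
Hence the Duhamel integral gains two derivatives: it is bounded in `H^{2n+1}_{(0)}` by the
`L²`-norm in time of the source. Because the odd derivatives of `μ` vanish at the end points,
multiplication by `μ` maps `H^{2p+3}_{(0)}` into `H^{2p+3} ∩ H^{2p+1}_{(0)}`. With `n = p + 1`, the
`k`-th time derivative of `ψ` is therefore a fixed point of an affine Volterra map in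
`H^{2p+3}_{(0)}`, which is a contraction for an exponentially weighted norm.

As `u` and `f` vanish to order `k` at `t = 0`, the initial values of the time derivatives of `ψ` are
`(-iA)^l ψ₀`. The solution `ψ` is the `k`-fold primitive, with these initial values, of the
fixed point, and it satisfies the original equation because each of its sine coefficients does.
-/

noncomputable section

namespace BilinearSchrodinger

/-! ### Indefinite integrals and jets of absolutely continuous functions -/

section Primitive

variable {E : Type*} [NormedAddCommGroup E] {a b : ℝ}

theorem intervalIntegrable_mono_Icc {g : ℝ → E} (h : IntervalIntegrable g volume a b)
    {c d : ℝ} (hc : c ∈ Icc a b) (hd : d ∈ Icc a b) : IntervalIntegrable g volume c d :=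
  h.mono_set (uIcc_subset_uIcc (by rwa [uIcc_of_le (hc.1.trans hc.2)])
    (by rwa [uIcc_of_le (hc.1.trans hc.2)]))

theorem memLp_Ioo_of_continuousOn {q : ℝ → E} (hq : ContinuousOn q (Icc a b)) (r : ℝ≥0∞) :
    MemLp q r (volume.restrict (Ioo a b)) := by
  obtain ⟨C, hC⟩ := isCompact_Icc.exists_bound_of_continuousOn hq
  refine MemLp.of_bound ((hq.mono Ioo_subset_Icc_self).aestronglyMeasurable measurableSet_Ioo) C ?_
  filter_upwards [ae_restrict_mem measurableSet_Ioo] with x hx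
  exact hC x (Ioo_subset_Icc_self hx)

theorem eqOn_Icc_of_ae_eq_Ioo (hab : a < b) {g h : ℝ → E} (hg : ContinuousOn g (Icc a b))
    (hh : ContinuousOn h (Icc a b)) (he : g =ᵐ[volume.restrict (Ioo a b)] h) :
    EqOn g h (Icc a b) := by
  rw [restrict_Ioo_eq_restrict_Icc] at he
  exact Measure.eqOn_Icc_of_ae_eq volume hab.ne he hg hh

theorem L2.integrable (g : L2 E a b) : Integrable g (volume.restrict (Ioo a b)) :=
  (Lp.memLp g).integrable (by norm_num)

theorem L2.intervalIntegrable (hab : a ≤ b) (g : L2 E a b) : IntervalIntegrable g volume a b :=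
  (intervalIntegrable_iff_integrableOn_Ioo_of_le hab).2 g.integrable

variable [NormedSpace ℝ E]

theorem integral_Ioo_eq_intervalIntegral (hab : a ≤ b) (g : ℝ → E) :
    ∫ x in Ioo a b, g x = ∫ x in a..b, g x := by
  rw [intervalIntegral.integral_of_le hab, integral_Ioc_eq_integral_Ioo]

/-- On `[a, b]`, the function `G` is an indefinite integral of the integrable function `g`. This
is the notion of absolute continuity used for Sobolev functions of one variable. -/
structure IsPrimitive (a b : ℝ) (G g : ℝ → E) : Prop where
  integrable : IntervalIntegrable g volume a b
  eq : ∀ x ∈ Icc a b, G x = G a + ∫ t in a..x, g t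

namespace IsPrimitive

variable {F f G G' g g' : ℝ → E}

theorem sub_eq (h : IsPrimitive a b G g) {c d : ℝ} (hc : c ∈ Icc a b) (hd : d ∈ Icc a b) :
    G d - G c = ∫ t in c..d, g t := by
  have ha : a ∈ Icc a b := ⟨le_rfl, hc.1.trans hc.2⟩
  rw [h.eq c hc, h.eq d hd, add_sub_add_left_eq_sub,
    intervalIntegral.integral_interval_sub_left (intervalIntegrable_mono_Icc h.integrable ha hd)
      (intervalIntegrable_mono_Icc h.integrable ha hc)]

theorem absolutelyContinuousOnInterval (h : IsPrimitive a b G g) (hab : a ≤ b) :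
    AbsolutelyContinuousOnInterval G a b := by
  have hn := h.integrable.norm.absolutelyContinuousOnInterval_intervalIntegral
    (c := a) left_mem_uIcc
  rw [absolutelyContinuousOnInterval_iff] at hn ⊢
  intro ε hε
  obtain ⟨δ, hδ, H⟩ := hn ε hε
  refine ⟨δ, hδ, fun S hS hlt => lt_of_le_of_lt (Finset.sum_le_sum fun i hi => ?_) (H S hS hlt)⟩
  have hm := hS.1 i hi
  rw [uIcc_of_le hab] at hm
  have ha : a ∈ Icc a b := ⟨le_rfl, hab⟩
  rw [dist_comm, dist_eq_norm, h.sub_eq hm.1 hm.2, dist_comm, Real.dist_eq,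
    intervalIntegral.integral_interval_sub_left
      (intervalIntegrable_mono_Icc h.integrable.norm ha hm.2)
      (intervalIntegrable_mono_Icc h.integrable.norm ha hm.1)]
  exact intervalIntegral.norm_integral_le_abs_integral_norm

theorem continuousOn_uIcc (h : IsPrimitive a b G g) (hab : a ≤ b) : ContinuousOn G (uIcc a b) :=
  (h.absolutelyContinuousOnInterval hab).continuousOn

theorem continuousOn (h : IsPrimitive a b G g) (hab : a ≤ b) : ContinuousOn G (Icc a b) :=
  uIcc_of_le hab ▸ h.continuousOn_uIcc hab

theorem of_integral (c : E) (h : IntervalIntegrable g volume a b) :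
    IsPrimitive a b (fun x => c + ∫ t in a..x, g t) g :=
  ⟨h, fun x _ => by simp⟩

theorem congr_ae (h : IsPrimitive a b G g) (hab : a ≤ b)
    (hg : g =ᵐ[volume.restrict (Ioo a b)] g') : IsPrimitive a b G g' := by
  rw [restrict_Ioo_eq_restrict_Ioc] at hg
  refine ⟨h.integrable.congr_ae (by rwa [uIoc_of_le hab]), fun x hx => ?_⟩
  rw [h.eq x hx]
  congr 1
  refine intervalIntegral.integral_congr_ae ?_
  filter_upwards [(ae_restrict_iff' measurableSet_Ioc).1 hg] with y hy hym
  rw [uIoc_of_le hx.1] at hym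
  exact hy ⟨hym.1, hym.2.trans hx.2⟩

theorem congr (h : IsPrimitive a b G g) (hab : a ≤ b) (hG : EqOn G' G (Icc a b)) :
    IsPrimitive a b G' g :=
  ⟨h.integrable, fun x hx => by rw [hG hx, hG ⟨le_rfl, hab⟩, h.eq x hx]⟩

theorem zero : IsPrimitive a b (fun _ => (0 : E)) (fun _ => 0) :=
  ⟨by simp, fun x _ => by simp⟩

theorem add (hF : IsPrimitive a b F f) (hG : IsPrimitive a b G g) :
    IsPrimitive a b (fun x => F x + G x) (fun x => f x + g x) := by
  refine ⟨hF.integrable.add hG.integrable, fun x hx => ?_⟩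
  have ha : a ∈ Icc a b := ⟨le_rfl, hx.1.trans hx.2⟩
  rw [intervalIntegral.integral_add (intervalIntegrable_mono_Icc hF.integrable ha hx)
    (intervalIntegrable_mono_Icc hG.integrable ha hx), hF.eq x hx, hG.eq x hx]
  abel

theorem sum {ι : Type*} (s : Finset ι) {G g : ι → ℝ → E}
    (h : ∀ i ∈ s, IsPrimitive a b (G i) (g i)) :
    IsPrimitive a b (fun x => ∑ i ∈ s, G i x) (fun x => ∑ i ∈ s, g i x) := by
  classical
  induction s using Finset.induction_on with
  | empty => simpa using IsPrimitive.zero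
  | insert i s hi ih =>
    simp only [Finset.sum_insert hi]
    exact (h i (Finset.mem_insert_self _ _)).add
      (ih fun k hk => h k (Finset.mem_insert_of_mem hk))

theorem const_smul (c : ℝ) (h : IsPrimitive a b G g) :
    IsPrimitive a b (fun x => c • G x) (fun x => c • g x) := by
  refine ⟨h.integrable.smul c, fun x hx => ?_⟩
  rw [intervalIntegral.integral_smul, h.eq x hx, smul_add]

variable [CompleteSpace E]

theorem ae_hasDerivAt (h : IsPrimitive a b G g) (hab : a ≤ b) :
    ∀ᵐ x, x ∈ Icc a b → HasDerivAt G (g x) x := by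
  filter_upwards [h.integrable.ae_hasDerivAt_integral, Measure.ae_ne volume a,
    Measure.ae_ne volume b] with x hx hxa hxb hxm
  rw [uIcc_of_le hab] at hx
  refine ((hx hxm a ⟨le_rfl, hab⟩).const_add (G a)).congr_of_eventuallyEq ?_
  filter_upwards [Icc_mem_nhds (lt_of_le_of_ne hxm.1 hxa.symm) (lt_of_le_of_ne hxm.2 hxb)]
    with y hy using h.eq y hy

theorem of_absolutelyContinuousOnInterval (hab : a ≤ b)
    (hG : AbsolutelyContinuousOnInterval G a b) (hg : IntervalIntegrable g volume a b)
    (h : ∀ᵐ x, x ∈ Icc a b → HasDerivAt G (g x) x) : IsPrimitive a b G g := by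
  refine ⟨hg, fun x hx => ?_⟩
  have hI : IsPrimitive a b (fun x => 0 + ∫ t in a..x, g t) g := IsPrimitive.of_integral 0 hg
  obtain ⟨C, hC⟩ := (hG.sub (hI.absolutelyContinuousOnInterval hab)).const_of_ae_hasDerivAt_zero
    (by
      filter_upwards [h, hI.ae_hasDerivAt hab] with y hy hy2 hym
      rw [uIcc_of_le hab] at hym
      simpa using (hy hym).sub (hy2 hym))
  rw [uIcc_of_le hab] at hC
  have hx := hC x hx
  have ha := hC a ⟨le_rfl, hab⟩
  simp only [Pi.sub_apply, zero_add, intervalIntegral.integral_same, sub_zero] at hx ha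
  rw [ha, ← hx, sub_add_cancel]

theorem of_hasDerivAt (h : ∀ x, HasDerivAt G (g x) x) (hg : Continuous g) :
    IsPrimitive a b G g := by
  refine ⟨hg.intervalIntegrable _ _, fun x _ => ?_⟩
  rw [intervalIntegral.integral_eq_sub_of_hasDerivAt (fun y _ => h y) (hg.intervalIntegrable _ _),
    add_sub_cancel]

theorem clm_comp {E' : Type*} [NormedAddCommGroup E'] [NormedSpace ℝ E'] [CompleteSpace E']
    (L : E →L[ℝ] E') (h : IsPrimitive a b G g) :
    IsPrimitive a b (fun x => L (G x)) (fun x => L (g x)) := by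
  refine ⟨intervalIntegrable_iff.2 (L.integrable_comp (intervalIntegrable_iff.1 h.integrable)),
    fun x hx => ?_⟩
  have ha : a ∈ Icc a b := ⟨le_rfl, hx.1.trans hx.2⟩
  rw [L.intervalIntegral_comp_comm (intervalIntegrable_mono_Icc h.integrable ha hx),
    h.eq x hx, map_add]

section SMul

variable {𝕜 : Type*} [RCLike 𝕜] [NormedSpace 𝕜 E] [IsScalarTower ℝ 𝕜 E] {F f : ℝ → 𝕜}

theorem smul (hab : a ≤ b) (hF : IsPrimitive a b F f) (hG : IsPrimitive a b G g) :
    IsPrimitive a b (fun x => F x • G x) (fun x => F x • g x + f x • G x) := by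
  refine of_absolutelyContinuousOnInterval hab
    ((hF.absolutelyContinuousOnInterval hab).smul (hG.absolutelyContinuousOnInterval hab))
    ((hG.integrable.continuousOn_smul (hF.continuousOn_uIcc hab)).add
      (hF.integrable.smul_continuousOn (hG.continuousOn_uIcc hab))) ?_
  filter_upwards [hF.ae_hasDerivAt hab, hG.ae_hasDerivAt hab] with x hFx hGx hx
  exact (hFx hx).smul (hGx hx)

theorem integral_smul_eq (hab : a ≤ b) (hF : IsPrimitive a b F f) (hG : IsPrimitive a b G g) :
    ∫ x in a..b, F x • g x = F b • G b - F a • G a - ∫ x in a..b, f x • G x := by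
  have h := (hF.smul hab hG).eq b ⟨hab, le_rfl⟩
  rw [intervalIntegral.integral_add (hG.integrable.continuousOn_smul (hF.continuousOn_uIcc hab))
    (hF.integrable.smul_continuousOn (hG.continuousOn_uIcc hab))] at h
  rw [h]
  abel

end SMul

end IsPrimitive

/-- On `[a, b]`, each `G i` with `i < m` is an indefinite integral of `G (i + 1)`. The sequence
plays the role of the successive derivatives of `G 0`. -/
def IsJet (a b : ℝ) (m : ℕ) (G : ℕ → ℝ → E) : Prop :=
  ∀ i < m, IsPrimitive a b (G i) (G (i + 1))

end Primitive

section Leibniz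

variable {E 𝕜 : Type*} [NormedAddCommGroup E]

/-- The sequence of derivatives of a product that the Leibniz formula assigns to the sequences
`F` and `G` of derivatives of its factors. -/
def leibnizProd [SMul 𝕜 E] (F : ℕ → ℝ → 𝕜) (G : ℕ → ℝ → E) (n : ℕ) (x : ℝ) : E :=
  ∑ ij ∈ Finset.HasAntidiagonal.antidiagonal n, n.choose ij.1 • (F ij.1 x • G ij.2 x)

theorem leibnizProd_succ [SMul 𝕜 E] (F : ℕ → ℝ → 𝕜) (G : ℕ → ℝ → E) (n : ℕ) (x : ℝ) :
    leibnizProd F G (n + 1) x = ∑ ij ∈ Finset.HasAntidiagonal.antidiagonal n,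
      n.choose ij.1 • (F ij.1 x • G (ij.2 + 1) x + F (ij.1 + 1) x • G ij.2 x) := by
  rw [leibnizProd, Finset.sum_antidiagonal_choose_succ_nsmul (fun i j => F i x • G j x)]
  simp only [nsmul_add, Finset.sum_add_distrib]
  congr 1
  refine Finset.sum_congr rfl fun ij hij => ?_
  rw [Nat.choose_symm_of_eq_add (Finset.HasAntidiagonal.mem_antidiagonal.1 hij).symm]

theorem IsJet.leibnizProd [NormedSpace ℝ E] [CompleteSpace E] [RCLike 𝕜] [NormedSpace 𝕜 E]
    [IsScalarTower ℝ 𝕜 E] {a b : ℝ} {m : ℕ} {F : ℕ → ℝ → 𝕜} {G : ℕ → ℝ → E} (hab : a ≤ b)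
    (hF : IsJet a b m F) (hG : IsJet a b m G) : IsJet a b m (leibnizProd F G) := by
  intro n hn
  have h := IsPrimitive.sum (Finset.HasAntidiagonal.antidiagonal n)
    (G := fun ij x => (n.choose ij.1 : ℝ) • (F ij.1 x • G ij.2 x))
    (g := fun ij x => (n.choose ij.1 : ℝ) • (F ij.1 x • G (ij.2 + 1) x + F (ij.1 + 1) x • G ij.2 x))
    fun ij hij => by
      have := Finset.HasAntidiagonal.mem_antidiagonal.1 hij
      exact ((hF ij.1 (by lia)).smul hab (hG ij.2 (by lia))).const_smul _
  simp only [Nat.cast_smul_eq_nsmul] at h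
  rwa [funext (leibnizProd_succ F G n)]

end Leibniz

/-! ### Representatives of Sobolev functions of one variable -/

section TestFun

variable {E : Type*} [NormedAddCommGroup E] [NormedSpace ℝ E] {a b : ℝ}

namespace IsTestFun

theorem eq_zero {φ : ℝ → E} (h : IsTestFun E a b φ) {x : ℝ} (hx : x ∉ Ioo a b) : φ x = 0 :=
  image_eq_zero_of_notMem_tsupport fun hx' => hx (h.2.2 hx')

theorem deriv {φ : ℝ → E} (h : IsTestFun E a b φ) : IsTestFun E a b (deriv φ) :=
  ⟨(contDiff_infty_iff_deriv.1 h.1).2, h.2.1.deriv, (tsupport_deriv_subset (𝕜 := ℝ)).trans h.2.2⟩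

theorem iteratedDeriv {φ : ℝ → E} (h : IsTestFun E a b φ) (n : ℕ) :
    IsTestFun E a b (iteratedDeriv n φ) := by
  induction n with
  | zero => simpa using h
  | succ n ih => simpa [iteratedDeriv_succ] using ih.deriv

theorem isPrimitive [CompleteSpace E] {φ : ℝ → E} (h : IsTestFun E a b φ) :
    IsPrimitive a b φ (_root_.deriv φ) :=
  .of_hasDerivAt (fun x => (h.1.differentiable (by simp) x).hasDerivAt) h.deriv.1.continuous

theorem integrable_smul {φ : ℝ → ℝ} (h : IsTestFun ℝ a b φ) {v : ℝ → E}
    (hv : Integrable v (volume.restrict (Ioo a b))) :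
    Integrable (fun x => φ x • v x) (volume.restrict (Ioo a b)) := by
  obtain ⟨C, hC⟩ := h.1.continuous.bounded_above_of_compact_support h.2.1
  exact hv.bdd_smul C h.1.continuous.aestronglyMeasurable (Eventually.of_forall hC)

theorem exists_tsupport_subset_Icc (hab : a < b) {φ : ℝ → E} (h : IsTestFun E a b φ) :
    ∃ c d, a < c ∧ d < b ∧ tsupport φ ⊆ Icc c d := by
  rcases (tsupport φ).eq_empty_or_nonempty with he | hne
  · exact ⟨b, a, hab, hab, he ▸ empty_subset _⟩
  · obtain ⟨c, hc, hcm⟩ := h.2.1.exists_isLeast hne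
    obtain ⟨d, hd, hdm⟩ := h.2.1.exists_isGreatest hne
    exact ⟨c, d, (h.2.2 hc).1, (h.2.2 hd).2, fun x hx => ⟨hcm hx, hdm hx⟩⟩

theorem exists_deriv_eq (hab : a < b) {φ : ℝ → ℝ} (h : IsTestFun ℝ a b φ)
    (h0 : ∫ x in a..b, φ x = 0) : ∃ Φ, IsTestFun ℝ a b Φ ∧ _root_.deriv Φ = φ := by
  obtain ⟨c, d, hac, hdb, hcd⟩ := h.exists_tsupport_subset_Icc hab
  have hφ : ∀ x ∉ Icc c d, φ x = 0 := fun x hx =>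
    image_eq_zero_of_notMem_tsupport fun hx' => hx (hcd hx')
  have hint : ∀ x y, IntervalIntegrable φ volume x y := h.1.continuous.intervalIntegrable
  let Φ : ℝ → ℝ := fun x => ∫ t in a..x, φ t
  have hd : ∀ x, HasDerivAt Φ (φ x) x := fun x =>
    intervalIntegral.integral_hasDerivAt_right (hint _ _)
      (h.1.continuous.stronglyMeasurableAtFilter _ _) h.1.continuous.continuousAt
  have hd' : _root_.deriv Φ = φ := funext fun x => (hd x).deriv
  have hsupp : Function.support Φ ⊆ Icc c d := by
    refine Function.support_subset_iff'.2 fun x hx => ?_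
    rcases lt_or_ge x c with hxc | hcx
    · refine intervalIntegral.integral_zero_ae (Eventually.of_forall fun t ht => hφ t fun htm => ?_)
      exact (ht.2.trans_lt (max_lt hac hxc)).not_ge htm.1
    · have hdx : d < x := not_le.1 fun hxd => hx ⟨hcx, hxd⟩
      refine (intervalIntegral.integral_add_adjacent_intervals (hint a b) (hint b x)).symm.trans ?_
      rw [h0, zero_add]
      refine intervalIntegral.integral_zero_ae (Eventually.of_forall fun t ht => hφ t fun htm => ?_)
      exact ((lt_min hdb hdx).trans ht.1).not_ge htm.2
  exact ⟨Φ, ⟨contDiff_infty_iff_deriv.2 ⟨fun x => (hd x).differentiableAt, by rw [hd']; exact h.1⟩,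
    .of_support_subset_isCompact isCompact_Icc hsupp,
    (closure_minimal hsupp isClosed_Icc).trans (Icc_subset_Ioo hac hdb)⟩, hd'⟩

end IsTestFun

theorem exists_isTestFun_integral_eq_one (hab : a < b) :
    ∃ η : ℝ → ℝ, IsTestFun ℝ a b η ∧ ∫ x in a..b, η x = 1 := by
  let f : ContDiffBump ((a + b) / 2) := ⟨(b - a) / 8, (b - a) / 4, by linarith, by linarith⟩
  have hs : tsupport (f.normed volume) ⊆ Ioo a b := by
    rw [f.tsupport_normed_eq]
    intro x hx
    rw [Metric.mem_closedBall, Real.dist_eq, abs_le] at hx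
    have : f.rOut = (b - a) / 4 := rfl
    constructor <;> linarith [hx.1, hx.2]
  refine ⟨f.normed volume, ⟨f.contDiff_normed, f.hasCompactSupport_normed, hs⟩, ?_⟩
  rw [← integral_Ioo_eq_intervalIntegral hab.le, setIntegral_eq_integral_of_forall_compl_eq_zero]
  · exact f.integral_normed
  · exact fun x hx => image_eq_zero_of_notMem_tsupport fun hx' => hx (hs hx')

theorem IsTestFun.exists_deriv_eq_sub (hab : a < b) {φ η : ℝ → ℝ} (hφ : IsTestFun ℝ a b φ)
    (hη : IsTestFun ℝ a b η) (hη1 : ∫ x in a..b, η x = 1) :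
    ∃ Φ, IsTestFun ℝ a b Φ ∧ _root_.deriv Φ = fun x => φ x - (∫ t in a..b, φ t) * η x := by
  refine IsTestFun.exists_deriv_eq hab ⟨hφ.1.sub (contDiff_const.mul hη.1),
    hφ.2.1.sub hη.2.1.mul_left, (tsupport_sub _ _).trans
      (union_subset hφ.2.2 (tsupport_mul_subset_right.trans hη.2.2))⟩ ?_
  rw [intervalIntegral.integral_sub (hφ.1.continuous.intervalIntegrable _ _)
    ((hη.1.continuous.intervalIntegrable _ _).const_mul _),
    intervalIntegral.integral_const_mul, hη1, mul_one, sub_self]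

end TestFun

section WeakDeriv

variable {E : Type*} [NormedAddCommGroup E] [NormedSpace ℝ E] [CompleteSpace E] {a b : ℝ}

theorem ae_eq_const_of_integral_deriv_smul_eq_zero (hab : a < b) {r : ℝ → E}
    (hr : Integrable r (volume.restrict (Ioo a b)))
    (h : ∀ φ, IsTestFun ℝ a b φ → ∫ x in Ioo a b, deriv φ x • r x = 0) :
    ∃ c : E, r =ᵐ[volume.restrict (Ioo a b)] fun _ => c := by
  obtain ⟨η, hη, hη1⟩ := exists_isTestFun_integral_eq_one hab
  set c : E := ∫ x in Ioo a b, η x • r x with hc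
  have hφ0 : ∀ φ, IsTestFun ℝ a b φ → ∫ x in Ioo a b, φ x • (r x - c) = 0 := by
    intro φ hφ
    obtain ⟨Φ, hΦ, hd⟩ := hφ.exists_deriv_eq_sub hab hη hη1
    have h0 := h Φ hΦ
    simp only [hd, sub_smul, mul_smul] at h0
    have hηr : Integrable (fun x => (∫ t in a..b, φ t) • η x • r x) (volume.restrict (Ioo a b)) :=
      (hη.integrable_smul hr).smul _
    rw [integral_sub (hφ.integrable_smul hr) hηr, integral_smul, ← hc] at h0
    simp only [smul_sub]
    rw [integral_sub (hφ.integrable_smul hr) (hφ.integrable_smul (integrable_const c)),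
      integral_smul_const, integral_Ioo_eq_intervalIntegral hab.le φ, h0]
  have hae := isOpen_Ioo.ae_eq_zero_of_integral_contDiff_smul_eq_zero
    ((hr.sub (integrable_const c)).locallyIntegrable.locallyIntegrableOn _)
    fun φ hφ hφc hφs => hφ0 φ ⟨hφ, hφc, hφs⟩
  refine ⟨c, ?_⟩
  filter_upwards [hae, ae_restrict_mem measurableSet_Ioo] with x hx hxm
  exact sub_eq_zero.1 (hx hxm)

theorem IsPrimitive.integral_deriv_smul (hab : a ≤ b) {G g : ℝ → E} (hG : IsPrimitive a b G g)
    {φ : ℝ → ℝ} (hφ : IsTestFun ℝ a b φ) :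
    ∫ x in Ioo a b, deriv φ x • G x = -∫ x in Ioo a b, φ x • g x := by
  rw [integral_Ioo_eq_intervalIntegral hab, integral_Ioo_eq_intervalIntegral hab,
    hφ.isPrimitive.integral_smul_eq hab hG, hφ.eq_zero (fun h => lt_irrefl _ h.1),
    hφ.eq_zero (fun h => lt_irrefl _ h.2)]
  simp

theorem IsPrimitive.isWeakDeriv (hab : a ≤ b) {G g : ℝ → E} (hG : IsPrimitive a b G g)
    {v w : L2 E a b} (hv : v =ᵐ[volume.restrict (Ioo a b)] G)
    (hw : w =ᵐ[volume.restrict (Ioo a b)] g) : IsWeakDeriv v w := by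
  intro φ hφ
  calc ∫ x in Ioo a b, deriv φ x • v x
      = ∫ x in Ioo a b, deriv φ x • G x := integral_congr_ae (hv.mono fun x hx => by simp only [hx])
    _ = -∫ x in Ioo a b, φ x • g x := hG.integral_deriv_smul hab hφ
    _ = -∫ x in Ioo a b, φ x • w x := by
      rw [integral_congr_ae (f := fun x => φ x • w x) (g := fun x => φ x • g x)
        (hw.mono fun x hx => by simp only [hx])]

theorem IsWeakDeriv.exists_ae_eq_integral (hab : a < b) {g g' : L2 E a b}
    (h : IsWeakDeriv g g') :
    ∃ c : E, g =ᵐ[volume.restrict (Ioo a b)] fun x => c + ∫ t in a..x, g' t := by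
  have hP := IsPrimitive.of_integral (0 : E) (g'.intervalIntegrable hab.le)
  set P : ℝ → E := fun x => 0 + ∫ t in a..x, g' t with hP_def
  have hPi : Integrable P (volume.restrict (Ioo a b)) :=
    (memLp_Ioo_of_continuousOn (hP.continuousOn hab.le) 1).integrable le_rfl
  obtain ⟨c, hc⟩ := ae_eq_const_of_integral_deriv_smul_eq_zero hab (g.integrable.sub hPi) (by
    intro φ hφ
    simp only [Pi.sub_apply, smul_sub]
    rw [integral_sub (hφ.deriv.integrable_smul g.integrable) (hφ.deriv.integrable_smul hPi),
      h φ hφ, hP.integral_deriv_smul hab.le hφ, sub_self])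
  refine ⟨c, ?_⟩
  filter_upwards [hc] with x hx
  rw [Pi.sub_apply, sub_eq_iff_eq_add] at hx
  simp only [hx, hP_def, zero_add]

end WeakDeriv

section RepJet

variable {E : Type*} [NormedAddCommGroup E] [NormedSpace ℝ E] {a b : ℝ} {m : ℕ}

theorem Sobolev.isWeakDeriv (w : Sobolev E a b m) (i : ℕ) (hi : i < m) :
    IsWeakDeriv (w.der ⟨i, by lia⟩) (w.der ⟨i + 1, by lia⟩) :=
  w.2 ⟨i, hi⟩

/-- `G` consists of absolutely continuous representatives of `w` and of its weak derivatives; the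
last one, `G m`, is only square integrable. -/
structure IsRepJet (w : Sobolev E a b m) (G : ℕ → ℝ → E) : Prop where
  jet : IsJet a b m G
  ae_eq : ∀ (i : ℕ) (hi : i < m + 1), w.der ⟨i, hi⟩ =ᵐ[volume.restrict (Ioo a b)] G i

theorem IsRepJet.continuousOn {w : Sobolev E a b m} {G : ℕ → ℝ → E} (h : IsRepJet w G)
    (hab : a ≤ b) {i : ℕ} (hi : i < m) : ContinuousOn (G i) (Icc a b) :=
  (h.jet i hi).continuousOn hab

theorem IsRepJet.memLp {w : Sobolev E a b m} {G : ℕ → ℝ → E} (h : IsRepJet w G) {i : ℕ}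
    (hi : i < m + 1) : MemLp (G i) 2 (volume.restrict (Ioo a b)) :=
  (memLp_congr_ae (h.ae_eq i hi)).1 (Lp.memLp _)

variable [CompleteSpace E]

theorem Sobolev.exists_isRepJet (hab : a < b) (w : Sobolev E a b m) :
    ∃ G : ℕ → ℝ → E, IsRepJet w G := by
  have h : ∀ i : ℕ, ∃ g : ℝ → E, (∀ hi : i < m + 1,
      w.der ⟨i, hi⟩ =ᵐ[volume.restrict (Ioo a b)] g) ∧
      ∀ hi : i < m, IsPrimitive a b g (w.der ⟨i + 1, by lia⟩) := by
    intro i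
    by_cases hi : i < m
    · obtain ⟨c, hc⟩ := (w.isWeakDeriv i hi).exists_ae_eq_integral hab
      exact ⟨_, fun _ => hc, fun _ => .of_integral c (L2.intervalIntegrable hab.le _)⟩
    by_cases hi' : i < m + 1
    · exact ⟨w.der ⟨i, hi'⟩, fun _ => .rfl, fun h => absurd h hi⟩
    · exact ⟨0, fun h => absurd h hi', fun h => absurd h hi⟩
  choose G hG hG' using h
  exact ⟨G, fun i hi => (hG' i hi).congr_ae hab.le (hG (i + 1) (by lia)), hG⟩

theorem IsJet.exists_isRepJet (hab : a ≤ b) {G : ℕ → ℝ → E} (hG : IsJet a b m G)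
    (hm : MemLp (G m) 2 (volume.restrict (Ioo a b))) : ∃ w : Sobolev E a b m, IsRepJet w G := by
  have hmem : ∀ i : Fin (m + 1), MemLp (G i) 2 (volume.restrict (Ioo a b)) := by
    refine Fin.lastCases (by simpa using hm) fun i => ?_
    exact memLp_Ioo_of_continuousOn ((hG i i.2).continuousOn hab) 2
  let v : PiLp 2 fun _ : Fin (m + 1) => L2 E a b := WithLp.toLp 2 fun i => (hmem i).toLp (G i)
  have hv : ∀ i : Fin (m + 1), v i =ᵐ[volume.restrict (Ioo a b)] G i := fun i => (hmem i).coeFn_toLp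
  exact ⟨⟨v, fun i => (hG i i.2).isWeakDeriv hab (hv i.castSucc) (hv i.succ)⟩, hG,
    fun i hi => hv ⟨i, hi⟩⟩

end RepJet

section EndValues

variable {E : Type*} [NormedAddCommGroup E] {a b : ℝ} {m : ℕ}

theorem VanishesAtEnds.eq_zero {g : L2 E a b} (hv : VanishesAtEnds g) (hab : a < b) {h : ℝ → E}
    (hh : ContinuousOn h (Icc a b)) (he : g =ᵐ[volume.restrict (Ioo a b)] h) :
    h a = 0 ∧ h b = 0 := by
  obtain ⟨h', hc, he', ha, hb⟩ := hv
  have := eqOn_Icc_of_ae_eq_Ioo hab hh hc (he.symm.trans he')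
  exact ⟨(this ⟨le_rfl, hab.le⟩).trans ha, (this ⟨hab.le, le_rfl⟩).trans hb⟩

variable [NormedSpace ℝ E]

/-- The functional taking `w` to its `i`-th weak derivative in `L²`. -/
def Sobolev.derCLM (i : Fin (m + 1)) : Sobolev E a b m →L[ℝ] L2 E a b :=
  (PiLp.proj 2 _ i).comp (sobolevSubmodule E a b m).subtypeL

theorem Sobolev.derCLM_apply (i : Fin (m + 1)) (w : Sobolev E a b m) : derCLM i w = w.der i := rfl

variable [CompleteSpace E]

/-- The functional `g ↦ ∫ q g` on `L²((a, b), E)` for a continuous weight `q`. -/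
def weightedIntegral (q : C(ℝ, ℝ)) : L2 E a b →L[ℝ] E :=
  (ContinuousLinearMap.lsmul ℝ ℝ).lpPairing (volume.restrict (Ioo a b)) 2 2
    ((memLp_Ioo_of_continuousOn q.continuous.continuousOn 2).toLp q)

theorem weightedIntegral_apply (q : C(ℝ, ℝ)) {g : L2 E a b} {G : ℝ → E}
    (hg : g =ᵐ[volume.restrict (Ioo a b)] G) :
    weightedIntegral q g = ∫ x in Ioo a b, q x • G x := by
  rw [weightedIntegral, ContinuousLinearMap.lpPairing_eq_integral]
  refine integral_congr_ae ?_
  filter_upwards [hg, (memLp_Ioo_of_continuousOn (a := a) (b := b)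
    q.continuous.continuousOn 2).coeFn_toLp] with x hx hqx
  rw [hx, hqx, ContinuousLinearMap.lsmul_apply]

/-- The functional `w ↦ (b - a)⁻¹ (∫ w⁽ⁱ⁾ - ∫ (c - x) w⁽ⁱ⁺¹⁾ dx)`, a weighted mean of the values of
`w⁽ⁱ⁾` at the two ends: integrating by parts, `c = b` gives the value at `a`, and `c = a` the value
at `b`. -/
def Sobolev.endMean (c : ℝ) (i : Fin m) : Sobolev E a b m →L[ℝ] E :=
  (b - a)⁻¹ • ((weightedIntegral 1).comp (derCLM i.castSucc) -
    (weightedIntegral ⟨fun x => c - x, by fun_prop⟩).comp (derCLM i.succ))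

theorem IsRepJet.endMean_eq (hab : a < b) {w : Sobolev E a b m} {G : ℕ → ℝ → E}
    (h : IsRepJet w G) (c : ℝ) (i : Fin m) :
    w.endMean c i = (b - a)⁻¹ • ((b - c) • G i b - (a - c) • G i a) := by
  have hF : IsPrimitive a b (fun x => c - x) (fun _ => (-1 : ℝ)) :=
    .of_hasDerivAt (fun x => by simpa using (hasDerivAt_id x).const_sub c) continuous_const
  have hparts := hF.integral_smul_eq hab.le (h.jet i i.2)
  have hi : w.der i.castSucc =ᵐ[volume.restrict (Ioo a b)] G i := h.ae_eq i (by lia)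
  have hi' : w.der i.succ =ᵐ[volume.restrict (Ioo a b)] G (i + 1) := h.ae_eq (i + 1) (by lia)
  rw [Sobolev.endMean, smul_apply, sub_apply, ContinuousLinearMap.comp_apply,
    ContinuousLinearMap.comp_apply, Sobolev.derCLM_apply, Sobolev.derCLM_apply,
    weightedIntegral_apply _ hi, weightedIntegral_apply _ hi',
    integral_Ioo_eq_intervalIntegral hab.le, integral_Ioo_eq_intervalIntegral hab.le]
  simp only [ContinuousMap.one_apply, ContinuousMap.coe_mk, one_smul]
  rw [hparts]
  simp only [neg_smul, one_smul, intervalIntegral.integral_neg, ← neg_sub b c, ← neg_sub a c]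
  congr 1
  abel

/-- The value at `a` of the `i`-th derivative of a function in `H^m(a, b)`. -/
def Sobolev.leftValue (i : Fin m) : Sobolev E a b m →L[ℝ] E := endMean b i

/-- The value at `b` of the `i`-th derivative of a function in `H^m(a, b)`. -/
def Sobolev.rightValue (i : Fin m) : Sobolev E a b m →L[ℝ] E := endMean a i

theorem IsRepJet.leftValue_eq (hab : a < b) {w : Sobolev E a b m} {G : ℕ → ℝ → E}
    (h : IsRepJet w G) (i : Fin m) : w.leftValue i = G i a := by
  rw [Sobolev.leftValue, h.endMean_eq hab, sub_self, zero_smul, zero_sub, ← neg_smul, neg_sub,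
    inv_smul_smul₀ (sub_pos.2 hab).ne']

theorem IsRepJet.rightValue_eq (hab : a < b) {w : Sobolev E a b m} {G : ℕ → ℝ → E}
    (h : IsRepJet w G) (i : Fin m) : w.rightValue i = G i b := by
  rw [Sobolev.rightValue, h.endMean_eq hab, sub_self, zero_smul, sub_zero,
    inv_smul_smul₀ (sub_pos.2 hab).ne']

/-- The function and its derivatives of order less than `m` vanish at the left end `a` of the
interval (while `sobolevZero` asks this at both ends). -/
def Sobolev.VanishesAtLeft (w : Sobolev E a b m) : Prop := ∀ i, w.leftValue i = 0

theorem Sobolev.vanishesAtLeft_of_mem_sobolevZero (hab : a < b) {w : Sobolev E a b m}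
    (hw : w ∈ sobolevZero E a b m) : w.VanishesAtLeft := by
  intro i
  refine closure_minimal ?_ (isClosed_eq (leftValue i).continuous continuous_const) hw
  rintro v ⟨φ, hφ, hv⟩
  have hφv : IsRepJet v fun n => iteratedDeriv n φ :=
    ⟨fun n _ => by simpa only [iteratedDeriv_succ] using (hφ.iteratedDeriv n).isPrimitive,
      fun n hn => hv ⟨n, hn⟩⟩
  exact (hφv.leftValue_eq hab i).trans ((hφ.iteratedDeriv i).eq_zero fun h => lt_irrefl _ h.1)

end EndValues

/-! ### Sine and cosine coefficients -/

section Trig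

/-- The function `x ↦ √2 sin(jπx + rπ/2)`, the `r`-th derivative of `φ_j` divided by `(jπ)^r`. -/
def trigFun (r : ℕ) (j : ℕ+) (x : ℝ) : ℝ :=
  Real.sqrt 2 * Real.sin (j * Real.pi * x + r * (Real.pi / 2))

theorem continuous_trigFun (r : ℕ) (j : ℕ+) : Continuous (trigFun r j) := by
  unfold trigFun; fun_prop

theorem hasDerivAt_trigFun (r : ℕ) (j : ℕ+) (x : ℝ) :
    HasDerivAt (trigFun r j) (j * Real.pi * trigFun (r + 1) j x) x := by
  have hangle : HasDerivAt (fun x : ℝ => j * Real.pi * x + r * (Real.pi / 2)) (j * Real.pi) x := by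
    simpa using ((hasDerivAt_id x).const_mul (j * Real.pi)).add_const (r * (Real.pi / 2))
  refine (hangle.sin.const_mul (Real.sqrt 2)).congr_deriv ?_
  rw [trigFun, Nat.cast_succ, add_mul (r : ℝ), one_mul, ← add_assoc, Real.sin_add_pi_div_two]
  ring

theorem trigFun_add_two (r : ℕ) (j : ℕ+) (x : ℝ) : trigFun (r + 2) j x = -trigFun r j x := by
  have hangle : (j : ℝ) * Real.pi * x + ((r + 2 : ℕ) : ℝ) * (Real.pi / 2) =
      j * Real.pi * x + r * (Real.pi / 2) + Real.pi := by push_cast; ring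
  rw [trigFun, trigFun, hangle, Real.sin_add_pi, mul_neg]

theorem ofReal_trigFun_zero (j : ℕ+) (x : ℝ) : (trigFun 0 j x : ℂ) = sineFun j x := by
  simp [sineFun, trigFun]

theorem trigFun_zero_left (j : ℕ+) : trigFun 0 j 0 = 0 := by simp [trigFun]

theorem trigFun_zero_right (j : ℕ+) : trigFun 0 j 1 = 0 := by simp [trigFun]

theorem trigFun_one_left (j : ℕ+) : trigFun 1 j 0 = Real.sqrt 2 := by simp [trigFun]

theorem trigFun_one_right (j : ℕ+) : trigFun 1 j 1 = Real.sqrt 2 * (-1) ^ (j : ℕ) := by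
  simp [trigFun, Real.sin_add_pi_div_two, Real.cos_nat_mul_pi]

theorem trigFun_mul_trigFun (r : ℕ) (i j : ℕ+) (x : ℝ) :
    trigFun r i x * trigFun r j x = Real.cos (((i - j : ℤ) : ℝ) * Real.pi * x)
      - (-1) ^ r * Real.cos (((i + j : ℤ) : ℝ) * Real.pi * x) := by
  have hprod := Real.two_mul_sin_mul_sin (i * Real.pi * x + r * (Real.pi / 2))
    (j * Real.pi * x + r * (Real.pi / 2))
  rw [← Real.cos_add_nat_mul_pi, trigFun, trigFun]
  have hsqrt : Real.sqrt 2 * Real.sqrt 2 = 2 := Real.mul_self_sqrt zero_le_two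
  push_cast
  ring_nf at hprod hsqrt ⊢
  rw [hsqrt, ← hprod]

theorem integral_trigFun_mul_trigFun (r : ℕ) (i j : ℕ+) :
    ∫ x in (0 : ℝ)..1, trigFun r i x * trigFun r j x = if i = j then 1 else 0 := by
  have hdiff : (i - j : ℤ) = 0 ↔ i = j := by rw [sub_eq_zero]; exact_mod_cast Iff.rfl
  have hsum : (i + j : ℤ) ≠ 0 := by have := i.pos; lia
  simp_rw [trigFun_mul_trigFun]
  rw [intervalIntegral.integral_sub (Continuous.intervalIntegrable (by fun_prop) _ _)
      (Continuous.intervalIntegrable (by fun_prop) _ _), intervalIntegral.integral_const_mul,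
    integral_cos_int, integral_cos_int, if_neg hsum, mul_zero, sub_zero]
  simp only [hdiff]

theorem memLp_trigFun (r : ℕ) (j : ℕ+) :
    MemLp (fun x => (trigFun r j x : ℂ)) 2 (volume.restrict (Ioo (0 : ℝ) 1)) :=
  memLp_Ioo_of_continuousOn
    (Complex.continuous_ofReal.comp (continuous_trigFun r j)).continuousOn 2

/-- The function `√2 sin(jπx + rπ/2)` as an element of `L²((0,1), ℂ)`. -/
def trigVec (r : ℕ) (j : ℕ+) : L2 ℂ 0 1 := (memLp_trigFun r j).toLp _

theorem trigVec_ae_eq (r : ℕ) (j : ℕ+) :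
    trigVec r j =ᵐ[volume.restrict (Ioo (0 : ℝ) 1)] fun x => (trigFun r j x : ℂ) :=
  (memLp_trigFun r j).coeFn_toLp

theorem trigVec_zero (j : ℕ+) : trigVec 0 j = eigVec j :=
  MemLp.toLp_congr _ _ (Eventually.of_forall (ofReal_trigFun_zero j))

/-- The coefficient `∫₀¹ √2 sin(jπx + rπ/2) g(x) dx`. -/
def trigCoef (r : ℕ) (j : ℕ+) (g : ℝ → ℂ) : ℂ := ∫ x in (0 : ℝ)..1, trigFun r j x • g x

theorem inner_trigVec (r : ℕ) (j : ℕ+) {g : L2 ℂ 0 1} {G : ℝ → ℂ}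
    (hg : g =ᵐ[volume.restrict (Ioo (0 : ℝ) 1)] G) :
    inner ℂ (trigVec r j) g = trigCoef r j G := by
  rw [L2.inner_def, trigCoef, ← integral_Ioo_eq_intervalIntegral zero_le_one]
  refine integral_congr_ae ?_
  filter_upwards [trigVec_ae_eq r j, hg] with x hx hgx
  rw [hx, hgx, RCLike.inner_apply, Complex.conj_ofReal, Complex.real_smul, mul_comm]

theorem inner_eigVec_eq_trigCoef (j : ℕ+) {g : L2 ℂ 0 1} {G : ℝ → ℂ}
    (hg : g =ᵐ[volume.restrict (Ioo (0 : ℝ) 1)] G) :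
    inner ℂ (eigVec j) g = trigCoef 0 j G := by
  rw [← trigVec_zero, inner_trigVec 0 j hg]

theorem orthonormal_trigVec (r : ℕ) : Orthonormal ℂ (trigVec r) := by
  rw [orthonormal_iff_ite]
  intro i j
  rw [inner_trigVec r i (trigVec_ae_eq r j), trigCoef]
  simp_rw [Complex.real_smul, ← Complex.ofReal_mul]
  rw [intervalIntegral.integral_ofReal, integral_trigFun_mul_trigFun]
  split_ifs <;> simp

theorem IsPrimitive.trigCoef_eq (r : ℕ) (j : ℕ+) {G g : ℝ → ℂ} (h : IsPrimitive 0 1 G g) :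
    trigCoef r j g = trigFun r j 1 • G 1 - trigFun r j 0 • G 0
      - (j * Real.pi : ℝ) • trigCoef (r + 1) j G := by
  have hF : IsPrimitive 0 1 (trigFun r j) (fun x => j * Real.pi * trigFun (r + 1) j x) :=
    .of_hasDerivAt (hasDerivAt_trigFun r j)
      (continuous_const.mul (continuous_trigFun (r + 1) j))
  rw [trigCoef, hF.integral_smul_eq zero_le_one h, trigCoef, ← intervalIntegral.integral_smul]
  simp only [mul_smul]

theorem IsPrimitive.mul_trigCoef_zero (j : ℕ+) {G g : ℝ → ℂ} (h : IsPrimitive 0 1 G g) :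
    (j * Real.pi : ℂ) * trigCoef 0 j G =
      trigCoef 1 j g + Real.sqrt 2 * (G 0 - (-1) ^ (j : ℕ) * G 1) := by
  have htwo : trigCoef 2 j G = -trigCoef 0 j G := by
    simp only [trigCoef, trigFun_add_two 0, neg_smul, intervalIntegral.integral_neg]
  rw [h.trigCoef_eq 1 j, trigFun_one_left, trigFun_one_right, htwo]
  simp only [Complex.real_smul]
  push_cast
  ring

theorem IsPrimitive.trigCoef_zero_eq (j : ℕ+) {G g : ℝ → ℂ} (h : IsPrimitive 0 1 G g) :
    trigCoef 0 j g = -((j * Real.pi : ℂ) * trigCoef 1 j G) := by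
  rw [h.trigCoef_eq 0 j, trigFun_zero_left, trigFun_zero_right]
  simp

variable {m n : ℕ} {G : ℕ → ℝ → ℂ}

theorem IsJet.pow_mul_trigCoef (hG : IsJet 0 1 m G) (hn : 2 * n ≤ m)
    (h0 : ∀ i < n, G (2 * i) 0 = 0 ∧ G (2 * i) 1 = 0) (j : ℕ+) :
    (j * Real.pi : ℂ) ^ (2 * n) * trigCoef 0 j (G 0) = (-1) ^ n * trigCoef 0 j (G (2 * n)) := by
  induction n with
  | zero => simp
  | succ n ih =>
    have hodd := (hG (2 * n) (by lia)).mul_trigCoef_zero j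
    have heven := (hG (2 * n + 1) (by lia)).trigCoef_zero_eq j
    rw [(h0 n (by lia)).1, (h0 n (by lia)).2] at hodd
    have hn := ih (by lia) fun i hi => h0 i (by lia)
    rw [show 2 * (n + 1) = 2 * n + 1 + 1 by ring, heven, pow_succ, pow_succ]
    linear_combination (j * Real.pi : ℂ) ^ 2 * hn + (-1) ^ n * (j * Real.pi : ℂ) * hodd

theorem IsJet.pow_succ_mul_trigCoef (hG : IsJet 0 1 m G) (hn : 2 * n < m)
    (h0 : ∀ i < n, G (2 * i) 0 = 0 ∧ G (2 * i) 1 = 0) (j : ℕ+) :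
    (j * Real.pi : ℂ) ^ (2 * n + 1) * trigCoef 0 j (G 0) =
      (-1) ^ n * (trigCoef 1 j (G (2 * n + 1))
        + Real.sqrt 2 * (G (2 * n) 0 - (-1) ^ (j : ℕ) * G (2 * n) 1)) := by
  rw [← (hG (2 * n) hn).mul_trigCoef_zero j, pow_succ]
  linear_combination (j * Real.pi : ℂ) * hG.pow_mul_trigCoef hn.le h0 j

end Trig

/-! ### Boundary values of functions in `H^s_{(0)}` -/

section Coefficients

theorem ext_inner_eigVec {g h : L2 ℂ 0 1} (H : ∀ j, inner ℂ (eigVec j) g = inner ℂ (eigVec j) h) :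
    g = h :=
  sub_eq_zero.1 (eq_zero_of_inner_eigVec _ fun j => by rw [inner_sub_right, H j, sub_self])

theorem tendsto_zero_of_summable_norm_sq {ι E : Type*} [SeminormedAddCommGroup E] {f : ι → E}
    (h : Summable fun i => ‖f i‖ ^ 2) : Tendsto f cofinite (𝓝 0) := by
  rw [tendsto_zero_iff_norm_tendsto_zero]
  simpa using h.tendsto_cofinite_zero.sqrt

theorem eq_zero_of_tendsto_alternating {z w : ℂ}
    (h : Tendsto (fun j : ℕ+ => z - (-1) ^ (j : ℕ) * w) cofinite (𝓝 0)) : z = 0 ∧ w = 0 := by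
  have hinj : ∀ r, Function.Injective fun n : ℕ => (2 * n + r).succPNat := fun r m n hmn => by
    have := Nat.succPNat_injective hmn
    lia
  have hsub : ∀ r, Tendsto (fun n : ℕ => z - (-1) ^ (2 * n + r + 1) * w) atTop (𝓝 0) := fun r => by
    rw [← Nat.cofinite_eq_atTop]
    refine (h.comp (hinj r).tendsto_cofinite).congr fun n => ?_
    rw [Function.comp_apply, Nat.succPNat_coe, Nat.succ_eq_add_one]
  have hodd : z + w = 0 := by simpa [pow_succ, pow_mul] using hsub 0
  have heven : z - w = 0 := by simpa [pow_succ, pow_mul] using hsub 1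
  exact ⟨by linear_combination (hodd + heven) / 2, by linear_combination (hodd - heven) / 2⟩

variable {s i m n : ℕ}

theorem mem_hZeroSubmodule_iff {g : L2 ℂ 0 1} :
    g ∈ hZeroSubmodule s ↔
      Summable fun j : ℕ+ => ‖(j * Real.pi : ℂ) ^ s * inner ℂ (eigVec j) g‖ ^ 2 := by
  change Memℓp _ 2 ↔ _
  have hpi : ‖(Real.pi : ℂ) ^ s‖ ^ 2 ≠ 0 := by simp [Real.pi_ne_zero]
  rw [memℓp_gen_iff (by norm_num), ← summable_mul_left_iff hpi]
  refine summable_congr fun j => ?_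
  rw [ENNReal.toReal_ofNat, Real.rpow_ofNat, ← mul_pow, ← norm_mul, mul_pow, mul_left_comm,
    mul_assoc]

theorem hZeroSubmodule_antitone (h : i ≤ s) : hZeroSubmodule s ≤ hZeroSubmodule i := by
  intro g hg
  rw [mem_hZeroSubmodule_iff] at hg ⊢
  refine hg.of_nonneg_of_le (fun j => by positivity) fun j => ?_
  have hj : 1 ≤ ‖(j * Real.pi : ℂ)‖ := by
    have : (1 : ℝ) ≤ j := by exact_mod_cast (one_le : 1 ≤ j)
    rw [norm_mul, Complex.norm_natCast, Complex.norm_real, Real.norm_of_nonneg Real.pi_pos.le]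
    nlinarith [Real.pi_gt_three]
  rw [norm_mul, norm_mul, norm_pow, norm_pow]
  gcongr

namespace HZero

/-- The inclusion of `H^s_{(0)}` in `L²`. -/
def toL2CLM : HZero s →L[ℂ] L2 ℂ 0 1 := toL2.mkContinuous 1 fun φ => by simpa using φ.norm_toL2_le

/-- The coefficient `φ ↦ ⟨φ, φ_j⟩`. -/
def coef (j : ℕ+) : HZero s →L[ℂ] ℂ :=
  (innerSL ℂ (eigVec j)).comp toL2CLM

theorem coef_apply (j : ℕ+) (φ : HZero s) : coef j φ = inner ℂ (eigVec j) φ.toL2 := rfl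

theorem ext_coef {φ ψ : HZero s} (h : ∀ j, coef j φ = coef j ψ) : φ = ψ :=
  toL2_injective (ext_inner_eigVec h)

theorem summable_norm_sq_pow_mul_coef (φ : HZero s) (hi : i ≤ s) :
    Summable fun j : ℕ+ => ‖(j * Real.pi : ℂ) ^ i * coef j φ‖ ^ 2 :=
  mem_hZeroSubmodule_iff.1 (hZeroSubmodule_antitone hi φ.2)

end HZero

/-- In the formula for the sine coefficients given by `2n + 1` integrations by parts, all terms but
the boundary values of the `2n`-th derivative tend to zero, hence so do these. -/
theorem IsRepJet.even_eq_zero {w : Sobolev ℂ 0 1 m} {G : ℕ → ℝ → ℂ} (hG : IsRepJet w G)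
    {φ : HZero s} (hφ : w.fn = φ.toL2) (hn : 2 * n < m) (hns : 2 * n < s) :
    G (2 * n) 0 = 0 ∧ G (2 * n) 1 = 0 := by
  induction n using Nat.strong_induction_on with
  | _ n ih =>
  have hcoef : ∀ j, HZero.coef j φ = trigCoef 0 j (G 0) := fun j => by
    rw [HZero.coef_apply, ← hφ]; exact inner_eigVec_eq_trigCoef j (hG.ae_eq 0 (by lia))
  have hsine := tendsto_zero_of_summable_norm_sq (φ.summable_norm_sq_pow_mul_coef hns)
  have hcosine := tendsto_zero_of_summable_norm_sq ((orthonormal_trigVec 1).inner_products_summable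
    (w.der ⟨2 * n + 1, by lia⟩))
  have hboundary : Tendsto (fun j : ℕ+ => G (2 * n) 0 - (-1) ^ (j : ℕ) * G (2 * n) 1)
      cofinite (𝓝 0) := by
    have hlim := ((hsine.const_mul ((-1) ^ n)).sub hcosine).const_mul (Real.sqrt 2 : ℂ)⁻¹
    rw [mul_zero, sub_zero, mul_zero] at hlim
    refine hlim.congr fun j => ?_
    have hsqrt : (Real.sqrt 2 : ℂ) ≠ 0 := by norm_num
    rw [inv_mul_eq_iff_eq_mul₀ hsqrt, inner_trigVec 1 j (hG.ae_eq (2 * n + 1) (by lia)), hcoef,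
      hG.jet.pow_succ_mul_trigCoef hn (fun i hi => ih i hi (by lia) (by lia)), ← mul_assoc,
      ← mul_pow, neg_one_mul, neg_neg, one_pow, one_mul, add_sub_cancel_left]
  exact eq_zero_of_tendsto_alternating hboundary

theorem IsRepJet.fn_mem_hZeroSubmodule {w : Sobolev ℂ 0 1 m} {G : ℕ → ℝ → ℂ} (hG : IsRepJet w G)
    (hn : 2 * n ≤ m) (h0 : ∀ i < n, G (2 * i) 0 = 0 ∧ G (2 * i) 1 = 0) :
    w.fn ∈ hZeroSubmodule (2 * n) := by
  rw [mem_hZeroSubmodule_iff]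
  refine ((orthonormal_trigVec 0).inner_products_summable
    (w.der ⟨2 * n, by lia⟩)).congr fun j => ?_
  rw [inner_trigVec 0 j (hG.ae_eq _ _),
    inner_eigVec_eq_trigCoef j (show w.fn =ᵐ[_] G 0 from hG.ae_eq 0 (by lia)),
    hG.jet.pow_mul_trigCoef hn h0 j]
  simp

end Coefficients

section Inter

namespace InterSpace

variable {m s : ℕ}

theorem fn_eq (x : InterSpace m s) : x.1.1.fn = x.1.2.toL2 := x.2

/-- The inclusion of `H^m ∩ H^s_{(0)}` in `H^m`. -/
def toSobolev : InterSpace m s →L[ℝ] Sobolev ℂ 0 1 m :=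
  (ContinuousLinearMap.fst ℝ _ _).comp (interSubmodule m s).subtypeL

/-- The inclusion of `H^m ∩ H^s_{(0)}` in `L²`. -/
def toL2CLM : InterSpace m s →L[ℝ] L2 ℂ 0 1 := (Sobolev.derCLM 0).comp toSobolev

theorem toL2CLM_apply (x : InterSpace m s) : toL2CLM x = x.toL2 := rfl

/-- The coefficient `x ↦ ⟨x, φ_j⟩`. -/
def coef (j : ℕ+) : InterSpace m s →L[ℝ] ℂ :=
  ((innerSL ℂ (eigVec j)).restrictScalars ℝ).comp toL2CLM

theorem coef_apply (j : ℕ+) (x : InterSpace m s) : coef j x = inner ℂ (eigVec j) x.toL2 := rfl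

/-- The last derivative of a function in `H^m ∩ H^s_{(0)}`. -/
def lastDer : InterSpace m s →L[ℝ] L2 ℂ 0 1 := (Sobolev.derCLM (Fin.last m)).comp toSobolev

/-- The value at `0` of the last continuous derivative of a function in `H^{m+1} ∩ H^s_{(0)}`. -/
def leftValue : InterSpace (m + 1) s →L[ℝ] ℂ := (Sobolev.leftValue (Fin.last m)).comp toSobolev

/-- The value at `1` of the last continuous derivative of a function in `H^{m+1} ∩ H^s_{(0)}`. -/
def rightValue : InterSpace (m + 1) s →L[ℝ] ℂ := (Sobolev.rightValue (Fin.last m)).comp toSobolev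

/-- The even derivatives of order less than `2n` vanish at both ends, so that each of the first
`2n` integrations by parts is without boundary terms. -/
theorem pow_mul_coef {n : ℕ} (hn : 2 * n ≤ s + 1) (x : InterSpace (2 * n + 1) s) (j : ℕ+) :
    (j * Real.pi : ℂ) ^ (2 * n + 1) * coef j x =
      (-1) ^ n * (inner ℂ (trigVec 1 j) (lastDer x)
        + Real.sqrt 2 * (leftValue x - (-1) ^ (j : ℕ) * rightValue x)) := by
  obtain ⟨G, hG⟩ := (toSobolev x).exists_isRepJet zero_lt_one
  have hlast : lastDer x =ᵐ[volume.restrict (Ioo (0 : ℝ) 1)] G (2 * n + 1) := hG.ae_eq _ _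
  have hleft : leftValue x = G (2 * n) 0 := hG.leftValue_eq zero_lt_one (Fin.last _)
  have hright : rightValue x = G (2 * n) 1 := hG.rightValue_eq zero_lt_one (Fin.last _)
  rw [coef_apply, inner_eigVec_eq_trigCoef j (show x.toL2 =ᵐ[_] G 0 from hG.ae_eq 0 (by lia)),
    inner_trigVec 1 j hlast, hleft, hright]
  exact hG.jet.pow_succ_mul_trigCoef (by lia)
    (fun i hi => hG.even_eq_zero x.fn_eq (by lia) (by lia)) j

end InterSpace

end Inter

/-! ### Functions in `H^s_{(0)}` are in `H^s` -/

section WeakDeriv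

variable {E : Type*} [NormedAddCommGroup E] [NormedSpace ℝ E] [CompleteSpace E] {a b : ℝ}

theorem IsWeakDeriv.unique {g v w : L2 E a b} (hv : IsWeakDeriv g v) (hw : IsWeakDeriv g w) :
    v = w := by
  have hae := isOpen_Ioo.ae_eq_zero_of_integral_contDiff_smul_eq_zero
    (U := Ioo a b) (f := fun x => v x - w x) (μ := volume.restrict (Ioo a b))
    ((v.integrable.sub w.integrable).locallyIntegrable.locallyIntegrableOn _) (by
      intro φ hφ hφc hφs
      have hφ : IsTestFun ℝ a b φ := ⟨hφ, hφc, hφs⟩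
      simp only [smul_sub]
      rw [integral_sub (hφ.integrable_smul v.integrable) (hφ.integrable_smul w.integrable),
        ← neg_inj.1 ((hv φ hφ).symm.trans (hw φ hφ)), sub_self])
  refine Lp.ext ?_
  filter_upwards [hae, self_mem_ae_restrict measurableSet_Ioo] with x hx hmem
  exact sub_eq_zero.1 (hx hmem)

theorem IsWeakDeriv.hasSum {ι : Type*} {g g' : ι → L2 E a b} {v v' : L2 E a b}
    (h : ∀ i, IsWeakDeriv (g i) (g' i)) (hv : HasSum g v) (hv' : HasSum g' v') :
    IsWeakDeriv v v' := by
  intro φ hφ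
  have hφv := hv.mapL (weightedIntegral ⟨deriv φ, hφ.deriv.1.continuous⟩)
  have hφv' := (hv'.mapL (weightedIntegral ⟨φ, hφ.1.continuous⟩)).neg
  simp only [weightedIntegral_apply _ EventuallyEq.rfl, ContinuousMap.coe_mk, ← h _ φ hφ]
    at hφv hφv'
  exact hφv.unique hφv'

theorem Sobolev.fn_injective (m : ℕ) :
    Function.Injective (Sobolev.fn : Sobolev E a b m → L2 E a b) := by
  intro v w h
  have hder : ∀ (i : ℕ) (hi : i < m + 1), v.der ⟨i, hi⟩ = w.der ⟨i, hi⟩ := by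
    intro i
    induction i with
    | zero => exact fun _ => h
    | succ i ih =>
      intro hi
      have hv := v.isWeakDeriv i (by lia)
      rw [ih (by lia)] at hv
      exact hv.unique (w.isWeakDeriv i (by lia))
  refine Subtype.ext ?_
  ext i : 1
  exact hder i i.2

end WeakDeriv

section Regularity

theorem isWeakDeriv_smul_trigVec (r : ℕ) (j : ℕ+) (c : ℂ) :
    IsWeakDeriv (c • trigVec r j) ((c * (j * Real.pi)) • trigVec (r + 1) j) := by
  have hp : IsPrimitive 0 1 (fun x => c * (trigFun r j x : ℂ))
      (fun x => c * (j * Real.pi) * (trigFun (r + 1) j x : ℂ)) := by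
    refine .of_hasDerivAt (fun x => ?_) (continuous_const.mul
      (Complex.continuous_ofReal.comp (continuous_trigFun (r + 1) j)))
    refine ((hasDerivAt_trigFun r j x).ofReal_comp.const_mul c).congr_deriv ?_
    push_cast; ring
  have hae : ∀ (c : ℂ) r, c • trigVec r j =ᵐ[volume.restrict (Ioo (0 : ℝ) 1)]
      fun x => c * (trigFun r j x : ℂ) := fun c r => by
    filter_upwards [Lp.coeFn_smul c (trigVec r j), trigVec_ae_eq r j] with x hsmul hx
    rw [hsmul, Pi.smul_apply, hx, smul_eq_mul]
  exact hp.isWeakDeriv zero_le_one (hae c r) (hae _ (r + 1))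

theorem HZero.exists_sobolev {s : ℕ} (φ : HZero s) :
    ∃ w : Sobolev ℂ 0 1 s, w.fn = φ.toL2 := by
  have hsum : ∀ i ≤ s, Summable fun j : ℕ+ => ((j * Real.pi : ℂ) ^ i * coef j φ) • trigVec i j := by
    intro i hi
    simpa using ((orthonormal_trigVec i).orthogonalFamily.summable_iff_norm_sq_summable
      fun j : ℕ+ => (j * Real.pi : ℂ) ^ i * coef j φ).2 (φ.summable_norm_sq_pow_mul_coef hi)
  let v (i : ℕ) : L2 ℂ 0 1 := ∑' j : ℕ+, ((j * Real.pi : ℂ) ^ i * coef j φ) • trigVec i j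
  have hv : ∀ i < s, IsWeakDeriv (v i) (v (i + 1)) := fun i hi =>
    IsWeakDeriv.hasSum (fun j => by
      simpa only [pow_succ, mul_right_comm] using
        isWeakDeriv_smul_trigVec i j ((j * Real.pi : ℂ) ^ i * coef j φ))
      (hsum i hi.le).hasSum (hsum (i + 1) hi).hasSum
  refine ⟨⟨WithLp.toLp 2 fun i : Fin (s + 1) => v i, fun i => hv i i.2⟩, ?_⟩
  refine (hsum 0 (Nat.zero_le _)).hasSum.unique ?_
  simpa [trigVec_zero, coef_apply, HilbertBasis.repr_apply_apply, eigBasis_apply]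
    using eigBasis.hasSum_repr φ.toL2

theorem InterSpace.ext_coef {m s : ℕ} {x y : InterSpace m s} (h : ∀ j, coef j x = coef j y) :
    x = y := by
  have hL2 : x.toL2 = y.toL2 := ext_inner_eigVec h
  refine Subtype.ext (Prod.ext (Sobolev.fn_injective m hL2) (HZero.toL2_injective ?_))
  rw [← x.fn_eq, ← y.fn_eq]
  exact hL2

end Regularity

/-! ### The multiplication operator -/

section LeibnizProd

variable {E : Type*} [NormedAddCommGroup E] [NormedSpace ℝ E] {a b : ℝ}

theorem memLp_smul_of_continuousOn_right {f : ℝ → ℝ} {g : ℝ → E}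
    (hf : MemLp f 2 (volume.restrict (Ioo a b))) (hg : ContinuousOn g (Icc a b)) :
    MemLp (fun x => f x • g x) 2 (volume.restrict (Ioo a b)) :=
  (memLp_Ioo_of_continuousOn hg ∞).smul (r := 2) hf

theorem memLp_smul_of_continuousOn_left {f : ℝ → ℝ} {g : ℝ → E} (hf : ContinuousOn f (Icc a b))
    (hg : MemLp g 2 (volume.restrict (Ioo a b))) :
    MemLp (fun x => f x • g x) 2 (volume.restrict (Ioo a b)) :=
  hg.smul (r := 2) (memLp_Ioo_of_continuousOn hf ∞)

theorem memLp_leibnizProd {m : ℕ} (hm : 0 < m) {F : ℕ → ℝ → ℝ} {G : ℕ → ℝ → E}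
    (hF : ∀ i < m, ContinuousOn (F i) (Icc a b)) (hG : ∀ i < m, ContinuousOn (G i) (Icc a b))
    (hFm : MemLp (F m) 2 (volume.restrict (Ioo a b)))
    (hGm : MemLp (G m) 2 (volume.restrict (Ioo a b))) :
    MemLp (leibnizProd F G m) 2 (volume.restrict (Ioo a b)) := by
  refine memLp_finsetSum (f := fun (ij : ℕ × ℕ) x => m.choose ij.1 • (F ij.1 x • G ij.2 x)) _
    fun ij hij => ?_
  have hij := Finset.HasAntidiagonal.mem_antidiagonal.1 hij
  simp only [← Nat.cast_smul_eq_nsmul ℝ]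
  refine MemLp.const_smul ?_ _
  rcases lt_or_ge ij.1 m with hi | hi
  · refine memLp_smul_of_continuousOn_left (hF _ hi) ?_
    rcases lt_or_ge ij.2 m with hj | hj
    · exact memLp_Ioo_of_continuousOn (hG _ hj) 2
    · rwa [show ij.2 = m by lia]
  · refine memLp_smul_of_continuousOn_right ?_ (hG _ (by lia))
    rwa [show ij.1 = m by lia]

theorem IsRepJet.exists_leibnizProd [CompleteSpace E] (hab : a < b) {l m n : ℕ} (hn : 0 < n)
    (hnl : n ≤ l) (hnm : n ≤ m) {v : Sobolev ℝ a b l} {w : Sobolev E a b m} {F : ℕ → ℝ → ℝ}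
    {G : ℕ → ℝ → E} (hF : IsRepJet v F) (hG : IsRepJet w G) :
    ∃ z : Sobolev E a b n, IsRepJet z (leibnizProd F G) :=
  (IsJet.leibnizProd (m := n) hab.le (fun i hi => hF.jet i (by lia))
    fun i hi => hG.jet i (by lia)).exists_isRepJet hab.le
    (memLp_leibnizProd hn (fun i hi => hF.continuousOn hab.le (by lia))
      (fun i hi => hG.continuousOn hab.le (by lia)) (hF.memLp (by lia)) (hG.memLp (by lia)))

theorem leibnizProd_two_mul_eq_zero {F : ℕ → ℝ → ℝ} {G : ℕ → ℝ → E} {n : ℕ} {x : ℝ}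
    (hF : ∀ i < n, F (2 * i + 1) x = 0) (hG : ∀ i ≤ n, G (2 * i) x = 0) :
    leibnizProd F G (2 * n) x = 0 := by
  refine Finset.sum_eq_zero fun ij hij => ?_
  have hij := Finset.HasAntidiagonal.mem_antidiagonal.1 hij
  rcases Nat.even_or_odd' ij.2 with ⟨l, hl | hl⟩
  · rw [hl, hG l (by lia), smul_zero, smul_zero]
  · rw [show ij.1 = 2 * (n - l - 1) + 1 by lia, hF _ (by lia), zero_smul, smul_zero]

end LeibnizProd

section MulCLM

variable {p m : ℕ}

/-- In the Leibniz formula for an even derivative of `μφ` at an end, each term contains an odd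
derivative of `μ` or an even derivative of `φ`, so it vanishes. -/
theorem exists_interSpace_eq_mul (hm : 2 * p + 3 ≤ m) (μ : Sobolev ℝ 0 1 m)
    (hμ : ∀ n (hn : n < p), VanishesAtEnds (μ.der ⟨2 * n + 1, by lia⟩)) (φ : HZero (2 * p + 3)) :
    ∃ x : InterSpace (2 * p + 3) (2 * p + 1),
      x.toL2 =ᵐ[volume.restrict (Ioo (0 : ℝ) 1)] fun y => μ.fn y • φ.toL2 y := by
  obtain ⟨w, hw⟩ := φ.exists_sobolev
  obtain ⟨G, hG⟩ := w.exists_isRepJet zero_lt_one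
  obtain ⟨N, hN⟩ := μ.exists_isRepJet zero_lt_one
  obtain ⟨v, hv⟩ := hN.exists_leibnizProd zero_lt_one (by lia : 0 < 2 * p + 3) hm le_rfl hG
  have hodd : ∀ n < p, N (2 * n + 1) 0 = 0 ∧ N (2 * n + 1) 1 = 0 := fun n hn =>
    (hμ n hn).eq_zero zero_lt_one (hN.continuousOn zero_le_one (by lia)) (hN.ae_eq _ _)
  have heven : ∀ n ≤ p, G (2 * n) 0 = 0 ∧ G (2 * n) 1 = 0 := fun n hn =>
    hG.even_eq_zero hw (by lia) (by lia)
  have hprod : ∀ n < p + 1, leibnizProd N G (2 * n) 0 = 0 ∧ leibnizProd N G (2 * n) 1 = 0 :=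
    fun n hn => ⟨
      leibnizProd_two_mul_eq_zero (fun i hi => (hodd i (by lia)).1)
        fun i hi => (heven i (by lia)).1,
      leibnizProd_two_mul_eq_zero (fun i hi => (hodd i (by lia)).2)
        fun i hi => (heven i (by lia)).2⟩
  have hmem : v.fn ∈ hZeroSubmodule (2 * p + 1) :=
    hZeroSubmodule_antitone (by lia) (hv.fn_mem_hZeroSubmodule (n := p + 1) (by lia) hprod)
  refine ⟨⟨(v, ⟨v.fn, hmem⟩), rfl⟩, ?_⟩
  have hμ0 : μ.fn =ᵐ[volume.restrict (Ioo (0 : ℝ) 1)] N 0 := hN.ae_eq 0 (by lia)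
  have hw0 : w.fn =ᵐ[volume.restrict (Ioo (0 : ℝ) 1)] G 0 := hG.ae_eq 0 (by lia)
  filter_upwards [hv.ae_eq 0 (by lia), hμ0, hw0] with y hvy hμy hwy
  rw [← hw, hμy, hwy]
  exact hvy.trans (by simp [leibnizProd])

theorem InterSpace.exists_clm_of_coef_eq {Y : Type*} [NormedAddCommGroup Y] [NormedSpace ℝ Y]
    [CompleteSpace Y] {m s : ℕ} (f : Y → InterSpace m s) (ℓ : ℕ+ → Y →L[ℝ] ℂ)
    (h : ∀ y j, coef j (f y) = ℓ j y) : ∃ M : Y →L[ℝ] InterSpace m s, ∀ y, M y = f y := by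
  let L : Y →ₗ[ℝ] InterSpace m s :=
    { toFun := f
      map_add' := fun y z => ext_coef fun j => by rw [map_add, h, h, h, map_add]
      map_smul' := fun c y => ext_coef fun j => by rw [map_smul, h, h, map_smul, RingHom.id_apply] }
  have hclosed : ∀ (u : ℕ → Y) (y : Y) (x : InterSpace m s), Tendsto u atTop (𝓝 y) →
      Tendsto (L ∘ u) atTop (𝓝 x) → x = L y := by
    intro u y x hu hL
    refine ext_coef fun j => tendsto_nhds_unique (((coef j).continuous.tendsto x).comp hL) ?_
    rw [show coef j (L y) = ℓ j y from h y j]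
    exact (((ℓ j).continuous.tendsto y).comp hu).congr fun n => (h (u n) j).symm
  exact ⟨.ofSeqClosedGraph hclosed, fun _ => rfl⟩

theorem exists_clm_eq_mul (hm : 2 * p + 3 ≤ m) (μ : Sobolev ℝ 0 1 m)
    (hμ : ∀ n (hn : n < p), VanishesAtEnds (μ.der ⟨2 * n + 1, by lia⟩)) :
    ∃ M : HZero (2 * p + 3) →L[ℝ] InterSpace (2 * p + 3) (2 * p + 1), ∀ φ,
      (M φ).toL2 =ᵐ[volume.restrict (Ioo (0 : ℝ) 1)] fun y => μ.fn y • φ.toL2 y := by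
  choose f hf using exists_interSpace_eq_mul hm μ hμ
  have hμe : ∀ j : ℕ+, MemLp (fun y => μ.fn y • (trigFun 0 j y : ℂ)) 2
      (volume.restrict (Ioo (0 : ℝ) 1)) := fun j =>
    memLp_smul_of_continuousOn_right (Lp.memLp _)
      (Complex.continuous_ofReal.comp (continuous_trigFun 0 j)).continuousOn
  obtain ⟨M, hM⟩ := InterSpace.exists_clm_of_coef_eq f
    (fun j => ((innerSL ℂ ((hμe j).toLp _)).comp HZero.toL2CLM).restrictScalars ℝ)
    fun φ j => by
      change inner ℂ (eigVec j) (f φ).toL2 = inner ℂ ((hμe j).toLp _) φ.toL2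
      rw [← trigVec_zero, L2.inner_def, L2.inner_def]
      refine integral_congr_ae ?_
      filter_upwards [hf φ, trigVec_ae_eq 0 j, (hμe j).coeFn_toLp] with y hfy hey hμy
      rw [hfy, hey, hμy]
      simp only [RCLike.inner_apply, Complex.real_smul, map_mul, Complex.conj_ofReal]
      ring
  exact ⟨M, fun φ => by rw [hM]; exact hf φ⟩

end MulCLM

/-! ### Orthogonality in time and the smoothing estimate -/

section SquareIntegrable

variable {E : Type*} [NormedAddCommGroup E] {a b c d : ℝ} {g : ℝ → E}

theorem L2.norm_sq_eq_integral (g : L2 E a b) : ‖g‖ ^ 2 = ∫ x in Ioo a b, ‖g x‖ ^ 2 := by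
  have h : 0 ≤ ∫ x in Ioo a b, ‖g x‖ ^ 2 := integral_nonneg fun x => by positivity
  rw [Lp.norm_def, (Lp.memLp g).eLpNorm_eq_integral_rpow_norm (by norm_num) (by norm_num)]
  simp only [ENNReal.toReal_ofNat, Real.rpow_ofNat]
  rw [ENNReal.toReal_ofReal (by positivity), ← Real.rpow_natCast, ← Real.rpow_mul h]
  norm_num

theorem memLp_mono_Ioo (hg : MemLp g 2 (volume.restrict (Ioo a b))) (hac : a ≤ c) (hdb : d ≤ b) :
    MemLp g 2 (volume.restrict (Ioo c d)) :=
  hg.mono_measure (Measure.restrict_mono (Ioo_subset_Ioo hac hdb) le_rfl)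

theorem intervalIntegrable_of_memLp_two (hab : a ≤ b)
    (hg : MemLp g 2 (volume.restrict (Ioo a b))) : IntervalIntegrable g volume a b :=
  (intervalIntegrable_iff_integrableOn_Ioo_of_le hab).2 (hg.integrable (by norm_num))

theorem intervalIntegrable_norm_sq (hab : a ≤ b) (hg : MemLp g 2 (volume.restrict (Ioo a b))) :
    IntervalIntegrable (fun x => ‖g x‖ ^ 2) volume a b :=
  (intervalIntegrable_iff_integrableOn_Ioo_of_le hab).2 (hg.integrable_norm_pow (by norm_num))

theorem integral_norm_sq_nonneg (hab : a ≤ b) (g : ℝ → E) : 0 ≤ ∫ x in a..b, ‖g x‖ ^ 2 :=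
  intervalIntegral.integral_nonneg hab fun _ _ => by positivity

variable [NormedSpace ℝ E]

theorem sq_norm_integral_le [CompleteSpace E] (hab : a ≤ b)
    (hg : MemLp g 2 (volume.restrict (Ioo a b))) :
    ‖∫ x in a..b, g x‖ ^ 2 ≤ (b - a) * ∫ x in a..b, ‖g x‖ ^ 2 := by
  rcases hab.eq_or_lt with rfl | hlt
  · simp
  have hjensen := (convexOn_univ_norm.pow (fun _ _ => norm_nonneg _) 2).map_set_average_le
    (by fun_prop) isClosed_univ (by simpa using hlt) measure_Ioo_lt_top.ne (by simp)
    (hg.integrable (by norm_num)) (hg.integrable_norm_pow (by norm_num))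
  have hpos : 0 < b - a := sub_pos.2 hlt
  simp only [setAverage_eq, Real.volume_real_Ioo_of_le hab, Pi.pow_apply, norm_smul, norm_inv,
    Real.norm_of_nonneg hpos.le, mul_pow, integral_Ioo_eq_intervalIntegral hab,
    smul_eq_mul] at hjensen
  rwa [inv_pow, inv_mul_le_iff₀ (by positivity), sq (b - a), mul_assoc,
    mul_inv_cancel_left₀ hpos.ne'] at hjensen

theorem integral_norm_sq_clm_le {X : Type*} [NormedAddCommGroup X] [NormedSpace ℝ X] (hab : a ≤ b)
    (L : X →L[ℝ] E) {F : ℝ → X} (hF : MemLp F 2 (volume.restrict (Ioo a b))) :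
    ∫ τ in a..b, ‖L (F τ)‖ ^ 2 ≤ ‖L‖ ^ 2 * ∫ τ in a..b, ‖F τ‖ ^ 2 := by
  rw [← intervalIntegral.integral_const_mul]
  refine intervalIntegral.integral_mono_on hab (intervalIntegrable_norm_sq hab (L.comp_memLp' hF))
    ((intervalIntegrable_norm_sq hab hF).const_mul _) fun τ _ => ?_
  rw [← mul_pow]
  gcongr
  exact L.le_opNorm _

end SquareIntegrable

section TimeExp

/-- The function `τ ↦ e^{iλ_jτ}`. -/
def timeExp (j : ℕ+) (τ : ℝ) : ℂ := Complex.exp (Complex.I * eigVal j * τ)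

theorem continuous_timeExp (j : ℕ+) : Continuous (timeExp j) := by unfold timeExp; fun_prop

theorem timeExp_add (j : ℕ+) (s t : ℝ) : timeExp j (s + t) = timeExp j s * timeExp j t := by
  simp only [timeExp, Complex.ofReal_add, mul_add, Complex.exp_add]

theorem norm_timeExp (j : ℕ+) (τ : ℝ) : ‖timeExp j τ‖ = 1 := by
  rw [timeExp, show Complex.I * eigVal j * τ = ((eigVal j * τ : ℝ) : ℂ) * Complex.I by
    push_cast; ring, Complex.norm_exp_ofReal_mul_I]

theorem conj_timeExp (j : ℕ+) (τ : ℝ) :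
    starRingEnd ℂ (timeExp j τ) = Complex.exp (-Complex.I * eigVal j * τ) := by
  rw [timeExp, ← Complex.exp_conj]
  simp

theorem memLp_timeExp_mul {s t : ℝ} (j : ℕ+) {h : ℝ → ℂ}
    (hh : MemLp h 2 (volume.restrict (Ioo s t))) :
    MemLp (fun τ => timeExp j τ * h τ) 2 (volume.restrict (Ioo s t)) :=
  hh.mul (r := 2) (memLp_Ioo_of_continuousOn (continuous_timeExp j).continuousOn ∞)

theorem eigVal_injective : Function.Injective eigVal := fun i j h => by
  have h' := (pow_left_inj₀ (by positivity) (by positivity) two_ne_zero).1 h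
  exact PNat.coe_inj.1 (by exact_mod_cast mul_right_cancel₀ Real.pi_ne_zero h')

/-- The frequencies `λ_j = π² j²` are integer multiples of `π²`, so every multiple of `2 / π` is a
common period. -/
theorem integral_timeExp_mul_conj (N : ℕ) (i j : ℕ+) :
    ∫ τ in (0 : ℝ)..(2 * N / Real.pi), timeExp i τ * starRingEnd ℂ (timeExp j τ) =
      if i = j then ((2 * N / Real.pi : ℝ) : ℂ) else 0 := by
  split_ifs with h
  · subst h
    simp_rw [Complex.mul_conj, Complex.normSq_eq_norm_sq, norm_timeExp]
    simp
  · have hexp (τ : ℝ) : timeExp i τ * starRingEnd ℂ (timeExp j τ) =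
        Complex.exp (Complex.I * (eigVal i - eigVal j) * τ) := by
      rw [conj_timeExp, timeExp, ← Complex.exp_add]; congr 1; ring
    have hne : (eigVal i : ℂ) - eigVal j ≠ 0 := by
      rw [← Complex.ofReal_sub]
      exact Complex.ofReal_ne_zero.2 (sub_ne_zero.2 fun he => h (eigVal_injective he))
    have hperiod : Complex.I * (eigVal i - eigVal j) * ((2 * N / Real.pi : ℝ) : ℂ) =
        ((N * ((i : ℤ) ^ 2 - (j : ℤ) ^ 2) : ℤ) : ℂ) * (2 * Real.pi * Complex.I) := by
      have : (Real.pi : ℂ) ≠ 0 := Complex.ofReal_ne_zero.2 Real.pi_ne_zero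
      simp only [eigVal]
      push_cast
      field_simp
    simp_rw [hexp]
    rw [integral_exp_mul_complex (mul_ne_zero Complex.I_ne_zero hne), hperiod,
      Complex.exp_int_mul_two_pi_mul_I]
    simp

theorem memLp_conj_timeExp (j : ℕ+) (P : ℝ) :
    MemLp (fun τ => starRingEnd ℂ (timeExp j τ)) 2 (volume.restrict (Ioo 0 P)) :=
  memLp_Ioo_of_continuousOn (Complex.continuous_conj.comp (continuous_timeExp j)).continuousOn 2

/-- The normalized function `τ ↦ P^{-1/2} e^{-iλ_jτ}` as an element of `L²(0, P)`. -/
def timeVec (P : ℝ) (j : ℕ+) : L2 ℂ 0 P :=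
  ((Real.sqrt P)⁻¹ : ℂ) • (memLp_conj_timeExp j P).toLp _

theorem inner_timeVec {P : ℝ} (hP : 0 ≤ P) (j : ℕ+) {g : L2 ℂ 0 P} {h : ℝ → ℂ}
    (hg : g =ᵐ[volume.restrict (Ioo 0 P)] h) :
    inner ℂ (timeVec P j) g = (Real.sqrt P : ℂ)⁻¹ * ∫ τ in (0 : ℝ)..P, timeExp j τ * h τ := by
  rw [timeVec, inner_smul_left, map_inv₀, Complex.conj_ofReal, L2.inner_def,
    ← integral_Ioo_eq_intervalIntegral hP]
  congr 1
  refine integral_congr_ae ?_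
  filter_upwards [(memLp_conj_timeExp j P).coeFn_toLp, hg] with τ hτ hgτ
  rw [hτ, hgτ, RCLike.inner_apply, Complex.conj_conj, mul_comm]

theorem orthonormal_timeVec {N : ℕ} (hN : 0 < N) : Orthonormal ℂ (timeVec (2 * N / Real.pi)) := by
  have hP : 0 < 2 * N / Real.pi := by positivity
  have hsqrt : (Real.sqrt (2 * N / Real.pi) : ℂ) * Real.sqrt (2 * N / Real.pi)
      = (2 * N / Real.pi : ℝ) := by rw [← Complex.ofReal_mul, Real.mul_self_sqrt hP.le]
  have hsqrt0 : (Real.sqrt (2 * N / Real.pi) : ℂ) ≠ 0 :=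
    Complex.ofReal_ne_zero.2 (Real.sqrt_pos.2 hP).ne'
  rw [orthonormal_iff_ite]
  intro i j
  rw [timeVec.eq_def _ j, inner_smul_right,
    inner_timeVec hP.le i (memLp_conj_timeExp j _).coeFn_toLp, integral_timeExp_mul_conj]
  split_ifs
  · rw [← hsqrt]; field_simp
  · simp

theorem sum_sq_norm_integral_timeExp_le_of_period {N : ℕ} (hN : 0 < N) {h : ℝ → ℂ}
    (hh : MemLp h 2 (volume.restrict (Ioo 0 (2 * N / Real.pi)))) (S : Finset ℕ+) :
    ∑ j ∈ S, ‖∫ τ in (0 : ℝ)..(2 * N / Real.pi), timeExp j τ * h τ‖ ^ 2 ≤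
      2 * N / Real.pi * ∫ τ in (0 : ℝ)..(2 * N / Real.pi), ‖h τ‖ ^ 2 := by
  have hP : 0 < 2 * N / Real.pi := by positivity
  have hbessel := (orthonormal_timeVec hN).sum_inner_products_le (hh.toLp h) (s := S)
  have hnorm : ‖hh.toLp h‖ ^ 2 = ∫ τ in (0 : ℝ)..(2 * N / Real.pi), ‖h τ‖ ^ 2 := by
    rw [L2.norm_sq_eq_integral, ← integral_Ioo_eq_intervalIntegral hP.le]
    exact integral_congr_ae (hh.coeFn_toLp.mono fun τ hτ => by simp only [hτ])
  simp_rw [inner_timeVec hP.le _ hh.coeFn_toLp, norm_mul, mul_pow, norm_inv, Complex.norm_real,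
    Real.norm_of_nonneg (Real.sqrt_nonneg _), inv_pow, Real.sq_sqrt hP.le] at hbessel
  rwa [← Finset.mul_sum, inv_mul_le_iff₀ hP, hnorm] at hbessel

theorem exists_forall_sum_sq_norm_integral_timeExp_le (T : ℝ) : ∃ C : ℝ, 0 ≤ C ∧
    ∀ s t : ℝ, 0 ≤ s → s ≤ t → t ≤ T → ∀ h : ℝ → ℂ, MemLp h 2 (volume.restrict (Ioo s t)) →
      ∀ S : Finset ℕ+, ∑ j ∈ S, ‖∫ τ in s..t, timeExp j τ * h τ‖ ^ 2 ≤
        C * ∫ τ in s..t, ‖h τ‖ ^ 2 := by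
  obtain ⟨N, hN⟩ := exists_nat_gt (max 0 (T * Real.pi / 2))
  have hN0 : 0 < N := by exact_mod_cast (le_max_left _ _).trans_lt hN
  have hP : 0 ≤ 2 * N / Real.pi := by positivity
  have hTP : T ≤ 2 * N / Real.pi := by
    rw [le_div_iff₀ Real.pi_pos]
    linarith [(le_max_right 0 (T * Real.pi / 2)).trans hN.le]
  refine ⟨2 * N / Real.pi, hP, fun s t hs hst ht h hh S => ?_⟩
  have hsub : Ioo s t ⊆ Ioo 0 (2 * N / Real.pi) := Ioo_subset_Ioo hs (ht.trans hTP)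
  have hextend {E : Type} [NormedAddCommGroup E] [NormedSpace ℝ E] (f : ℝ → E) :
      ∫ τ in (0 : ℝ)..(2 * N / Real.pi), (Ioo s t).indicator f τ = ∫ τ in s..t, f τ := by
    rw [← integral_Ioo_eq_intervalIntegral hP, ← integral_Ioo_eq_intervalIntegral hst,
      integral_indicator measurableSet_Ioo, Measure.restrict_restrict_of_subset hsub]
  have hmem : MemLp ((Ioo s t).indicator h) 2 (volume.restrict (Ioo 0 (2 * N / Real.pi))) := by
    rwa [memLp_indicator_iff_restrict measurableSet_Ioo, Measure.restrict_restrict_of_subset hsub]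
  have hmul (j : ℕ+) (τ : ℝ) : timeExp j τ * (Ioo s t).indicator h τ =
      (Ioo s t).indicator (fun τ => timeExp j τ * h τ) τ := by simp [indicator]
  have hnorm (τ : ℝ) : ‖(Ioo s t).indicator h τ‖ ^ 2 =
      (Ioo s t).indicator (fun τ => ‖h τ‖ ^ 2) τ := by
    by_cases hτ : τ ∈ Ioo s t <;> simp [hτ]
  simpa only [hmul, hnorm, hextend] using sum_sq_norm_integral_timeExp_le_of_period hN0 hmem S

end TimeExp

section Smoothing

theorem sum_sq_norm_integral_timeExp_inner_le {X H : Type*} [NormedAddCommGroup X]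
    [NormedSpace ℝ X] [NormedAddCommGroup H] [InnerProductSpace ℂ H] {e : ℕ+ → H}
    (he : Orthonormal ℂ e) (D : X →L[ℝ] H) {s t : ℝ} (hst : s ≤ t) {F : ℝ → X}
    (hF : MemLp F 2 (volume.restrict (Ioo s t))) (S : Finset ℕ+) :
    ∑ j ∈ S, ‖∫ τ in s..t, timeExp j τ * inner ℂ (e j) (D (F τ))‖ ^ 2 ≤
      (t - s) * (‖D‖ ^ 2 * ∫ τ in s..t, ‖F τ‖ ^ 2) := by
  have hmem (j : ℕ+) : MemLp (fun τ => inner ℂ (e j) (D (F τ))) 2 (volume.restrict (Ioo s t)) :=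
    (((innerSL ℂ (e j)).restrictScalars ℝ).comp D).comp_memLp' hF
  have hint : ∀ j ∈ S, IntervalIntegrable (fun τ => ‖inner ℂ (e j) (D (F τ))‖ ^ 2) volume s t :=
    fun j _ => intervalIntegrable_norm_sq hst (hmem j)
  calc ∑ j ∈ S, ‖∫ τ in s..t, timeExp j τ * inner ℂ (e j) (D (F τ))‖ ^ 2
      ≤ ∑ j ∈ S, (t - s) * ∫ τ in s..t, ‖inner ℂ (e j) (D (F τ))‖ ^ 2 :=
        Finset.sum_le_sum fun j _ => by
          simpa only [norm_mul, norm_timeExp, one_mul] using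
            sq_norm_integral_le hst (memLp_timeExp_mul j (hmem j))
    _ = (t - s) * ∫ τ in s..t, ∑ j ∈ S, ‖inner ℂ (e j) (D (F τ))‖ ^ 2 := by
        rw [← Finset.mul_sum, intervalIntegral.integral_finsetSum hint]
    _ ≤ (t - s) * ∫ τ in s..t, ‖D (F τ)‖ ^ 2 :=
        mul_le_mul_of_nonneg_left (intervalIntegral.integral_mono_on hst
          (by simpa only [Finset.sum_fn] using IntervalIntegrable.sum S hint)
          (intervalIntegrable_norm_sq hst (D.comp_memLp' hF))
          fun τ _ => he.sum_inner_products_le (D (F τ))) (sub_nonneg.2 hst)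
    _ ≤ (t - s) * (‖D‖ ^ 2 * ∫ τ in s..t, ‖F τ‖ ^ 2) :=
        mul_le_mul_of_nonneg_left (integral_norm_sq_clm_le hst D hF) (sub_nonneg.2 hst)

theorem sq_norm_add_sub_le {E : Type*} [SeminormedAddCommGroup E] (x y z : E) :
    ‖x + (y - z)‖ ^ 2 ≤ 3 * (‖x‖ ^ 2 + ‖y‖ ^ 2 + ‖z‖ ^ 2) := by
  have h : ‖x + (y - z)‖ ≤ ‖x‖ + (‖y‖ + ‖z‖) :=
    (norm_add_le _ _).trans (by gcongr; exact norm_sub_le _ _)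
  nlinarith [norm_nonneg (x + (y - z)), sq_nonneg (‖x‖ - ‖y‖), sq_nonneg (‖x‖ - ‖z‖),
    sq_nonneg (‖y‖ - ‖z‖)]

open InterSpace

variable {n m r : ℕ} {s t : ℝ}

theorem memLp_timeExp_mul_clm {X : Type*} [NormedAddCommGroup X] [NormedSpace ℝ X] (j : ℕ+)
    (L : X →L[ℝ] ℂ) {F : ℝ → X} (hF : MemLp F 2 (volume.restrict (Ioo s t))) :
    MemLp (fun τ => timeExp j τ * L (F τ)) 2 (volume.restrict (Ioo s t)) :=
  memLp_timeExp_mul j (L.comp_memLp' hF)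

theorem pow_mul_integral_timeExp_coef (hn : 2 * n ≤ r + 1) (hst : s ≤ t)
    {F : ℝ → InterSpace (2 * n + 1) r} (hF : MemLp F 2 (volume.restrict (Ioo s t))) (j : ℕ+) :
    (j * Real.pi : ℂ) ^ (2 * n + 1) * ∫ τ in s..t, timeExp j τ * coef j (F τ) =
      (-1) ^ n * ((∫ τ in s..t, timeExp j τ * inner ℂ (trigVec 1 j) (lastDer (F τ))) +
        ((Real.sqrt 2 : ℂ) * (∫ τ in s..t, timeExp j τ * leftValue (F τ)) -
          (Real.sqrt 2 : ℂ) * (-1) ^ (j : ℕ) * ∫ τ in s..t, timeExp j τ * rightValue (F τ))) := by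
  have hint (L : InterSpace (2 * n + 1) r →L[ℝ] ℂ) :
      IntervalIntegrable (fun τ => timeExp j τ * L (F τ)) volume s t :=
    intervalIntegrable_of_memLp_two hst (memLp_timeExp_mul_clm j L hF)
  have hcosine : IntervalIntegrable
      (fun τ => timeExp j τ * inner ℂ (trigVec 1 j) (lastDer (F τ))) volume s t :=
    hint (((innerSL ℂ (trigVec 1 j)).restrictScalars ℝ).comp lastDer)
  have hleft := (hint leftValue).const_mul (Real.sqrt 2 : ℂ)
  have hright := (hint rightValue).const_mul ((Real.sqrt 2 : ℂ) * (-1) ^ (j : ℕ))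
  rw [← intervalIntegral.integral_const_mul, ← intervalIntegral.integral_const_mul,
    ← intervalIntegral.integral_const_mul, ← intervalIntegral.integral_sub hleft hright,
    ← intervalIntegral.integral_add hcosine (hleft.sub hright),
    ← intervalIntegral.integral_const_mul]
  congr 1 with τ
  linear_combination timeExp j τ * pow_mul_coef hn (F τ) j

theorem sq_norm_pow_mul_integral_timeExp_coef_le (hn : 2 * n ≤ r + 1) (hst : s ≤ t)
    {F : ℝ → InterSpace (2 * n + 1) r} (hF : MemLp F 2 (volume.restrict (Ioo s t))) (j : ℕ+) :
    ‖(j : ℂ) ^ (2 * n + 1) * ∫ τ in s..t, timeExp j τ * coef j (F τ)‖ ^ 2 ≤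
      3 * (‖∫ τ in s..t, timeExp j τ * inner ℂ (trigVec 1 j) (lastDer (F τ))‖ ^ 2
        + 2 * ‖∫ τ in s..t, timeExp j τ * leftValue (F τ)‖ ^ 2
        + 2 * ‖∫ τ in s..t, timeExp j τ * rightValue (F τ)‖ ^ 2) := by
  have hπ : ‖(j : ℂ) ^ (2 * n + 1) * ∫ τ in s..t, timeExp j τ * coef j (F τ)‖ ≤
      ‖(j * Real.pi : ℂ) ^ (2 * n + 1) * ∫ τ in s..t, timeExp j τ * coef j (F τ)‖ := by
    rw [norm_mul, norm_mul, norm_pow, norm_pow, norm_mul, Complex.norm_real,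
      Real.norm_of_nonneg Real.pi_pos.le]
    gcongr
    exact le_mul_of_one_le_right (norm_nonneg _) (by linarith [Real.pi_gt_three])
  refine (pow_le_pow_left₀ (norm_nonneg _) hπ 2).trans ?_
  rw [pow_mul_integral_timeExp_coef hn hst hF, norm_mul, norm_pow, norm_neg, norm_one, one_pow,
    one_mul]
  refine (sq_norm_add_sub_le _ _ _).trans_eq ?_
  simp only [norm_mul, mul_pow, norm_pow, norm_neg, norm_one, one_pow, mul_one, Complex.norm_real,
    Real.norm_of_nonneg (Real.sqrt_nonneg 2), Real.sq_sqrt zero_le_two]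

/-- The smoothing effect: for `r = 2n - 1`, the values of `F` satisfy only the boundary conditions
of `H^{2n-1}_{(0)}`, while the coefficients of the integral are those of an element of
`H^{2n+1}_{(0)}`. -/
theorem exists_forall_sum_sq_norm_pow_mul_integral_timeExp_coef_le (hn : 2 * n ≤ r + 1) {T : ℝ}
    (hT : 0 ≤ T) : ∃ C : ℝ, 0 ≤ C ∧ ∀ s t : ℝ, 0 ≤ s → s ≤ t → t ≤ T →
      ∀ F : ℝ → InterSpace (2 * n + 1) r, MemLp F 2 (volume.restrict (Ioo s t)) →
        ∀ S : Finset ℕ+,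
          ∑ j ∈ S, ‖(j : ℂ) ^ (2 * n + 1) * ∫ τ in s..t, timeExp j τ * coef j (F τ)‖ ^ 2 ≤
            C * ∫ τ in s..t, ‖F τ‖ ^ 2 := by
  obtain ⟨K, hK, hbessel⟩ := exists_forall_sum_sq_norm_integral_timeExp_le T
  let D : InterSpace (2 * n + 1) r →L[ℝ] L2 ℂ 0 1 := lastDer
  let b₀ : InterSpace (2 * n + 1) r →L[ℝ] ℂ := leftValue
  let b₁ : InterSpace (2 * n + 1) r →L[ℝ] ℂ := rightValue
  refine ⟨3 * (T * ‖D‖ ^ 2 + 2 * K * ‖b₀‖ ^ 2 + 2 * K * ‖b₁‖ ^ 2), by positivity,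
    fun s t hs hst ht F hF S => ?_⟩
  have hboundary (b : InterSpace (2 * n + 1) r →L[ℝ] ℂ) :
      ∑ j ∈ S, ‖∫ τ in s..t, timeExp j τ * b (F τ)‖ ^ 2 ≤
        K * (‖b‖ ^ 2 * ∫ τ in s..t, ‖F τ‖ ^ 2) :=
    (hbessel s t hs hst ht _ (b.comp_memLp' hF) S).trans
      (mul_le_mul_of_nonneg_left (integral_norm_sq_clm_le hst b hF) hK)
  have hinterior : ∑ j ∈ S, ‖∫ τ in s..t, timeExp j τ * inner ℂ (trigVec 1 j) (D (F τ))‖ ^ 2 ≤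
      T * (‖D‖ ^ 2 * ∫ τ in s..t, ‖F τ‖ ^ 2) :=
    (sum_sq_norm_integral_timeExp_inner_le (orthonormal_trigVec 1) D hst hF S).trans
      (mul_le_mul_of_nonneg_right (by linarith)
        (mul_nonneg (sq_nonneg _) (integral_norm_sq_nonneg hst F)))
  refine (Finset.sum_le_sum fun j _ =>
    sq_norm_pow_mul_integral_timeExp_coef_le hn hst hF j).trans ?_
  rw [← Finset.mul_sum, Finset.sum_add_distrib, Finset.sum_add_distrib, ← Finset.mul_sum,
    ← Finset.mul_sum]
  linarith [hboundary b₀, hboundary b₁]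

end Smoothing

/-! ### The free evolution and the Duhamel term -/

section Evolution

namespace HZero

variable {s : ℕ}

theorem hasSum_norm_sq (φ : HZero s) :
    HasSum (fun j : ℕ+ => ‖(j : ℂ) ^ s * coef j φ‖ ^ 2) (‖φ‖ ^ 2) := by
  have h := lp.hasSum_norm (p := 2) (by norm_num) (coeffs s φ)
  simp only [ENNReal.toReal_ofNat, Real.rpow_ofNat] at h
  exact h

theorem norm_sq_le (φ : HZero s) {K : ℝ}
    (h : ∀ S : Finset ℕ+, ∑ j ∈ S, ‖(j : ℂ) ^ s * coef j φ‖ ^ 2 ≤ K) : ‖φ‖ ^ 2 ≤ K :=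
  le_of_tendsto φ.hasSum_norm_sq (Eventually.of_forall h)

theorem exists_coef_eq (c : ℕ+ → ℂ) {K : ℝ}
    (h : ∀ S : Finset ℕ+, ∑ j ∈ S, ‖(j : ℂ) ^ s * c j‖ ^ 2 ≤ K) :
    ∃ φ : HZero s, ∀ j, coef j φ = c j := by
  have hmem : Memℓp (fun j : ℕ+ => (j : ℂ) ^ s * c j) 2 :=
    memℓp_gen' (C := K) fun S => by simpa using h S
  obtain ⟨φ, hφ⟩ := coeffs_surjective s ⟨_, hmem⟩
  exact ⟨φ, fun j => mul_left_cancel₀ (pow_ne_zero s (Nat.cast_ne_zero.2 j.ne_zero))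
    (congrArg (fun v : lp (fun _ : ℕ+ => ℂ) 2 => v j) hφ)⟩

theorem exists_coef_eq_timeExp_neg_mul (t : ℝ) (φ : HZero s) :
    ∃ ψ : HZero s, ∀ j, coef j ψ = timeExp j (-t) * coef j φ :=
  exists_coef_eq _ fun S => by
    simpa only [mul_left_comm _ (timeExp _ _), norm_mul (timeExp _ _), norm_timeExp, one_mul] using
      sum_le_hasSum S (fun j _ => by positivity) φ.hasSum_norm_sq

/-- The group `e^{-iAt}` on `H^s_{(0)}`. -/
def evolve (t : ℝ) : HZero s →ₗᵢ[ℂ] HZero s where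
  toFun φ := (exists_coef_eq_timeExp_neg_mul t φ).choose
  map_add' φ ψ := ext_coef fun j => by
    rw [map_add, (exists_coef_eq_timeExp_neg_mul t _).choose_spec,
      (exists_coef_eq_timeExp_neg_mul t φ).choose_spec,
      (exists_coef_eq_timeExp_neg_mul t ψ).choose_spec, map_add, mul_add]
  map_smul' c φ := ext_coef fun j => by
    rw [RingHom.id_apply, map_smul, (exists_coef_eq_timeExp_neg_mul t _).choose_spec,
      (exists_coef_eq_timeExp_neg_mul t φ).choose_spec, map_smul, smul_eq_mul, smul_eq_mul,
      mul_left_comm]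
  norm_map' φ := by
    have h := (exists_coef_eq_timeExp_neg_mul t φ).choose.hasSum_norm_sq
    simp only [(exists_coef_eq_timeExp_neg_mul t φ).choose_spec, mul_left_comm _ (timeExp _ _),
      norm_mul (timeExp _ _), norm_timeExp, one_mul] at h
    exact (pow_left_inj₀ (norm_nonneg _) (norm_nonneg _) two_ne_zero).1
      (h.unique φ.hasSum_norm_sq)

theorem coef_evolve (t : ℝ) (φ : HZero s) (j : ℕ+) :
    coef j (evolve t φ) = timeExp j (-t) * coef j φ :=
  (exists_coef_eq_timeExp_neg_mul t φ).choose_spec j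

theorem norm_sq_evolve_sub (t t₀ : ℝ) (φ : HZero s) : ‖evolve t φ - evolve t₀ φ‖ ^ 2 =
    ∑' j : ℕ+, ‖timeExp j (-t) - timeExp j (-t₀)‖ ^ 2 * ‖(j : ℂ) ^ s * coef j φ‖ ^ 2 := by
  rw [← (evolve t φ - evolve t₀ φ).hasSum_norm_sq.tsum_eq]
  refine tsum_congr fun j => ?_
  rw [map_sub, coef_evolve, coef_evolve, ← sub_mul, mul_left_comm, norm_mul, mul_pow]

theorem continuous_evolve_apply (φ : HZero s) : Continuous fun t => evolve t φ := by
  rw [continuous_iff_continuousAt]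
  intro t₀
  rw [ContinuousAt, tendsto_iff_norm_sub_tendsto_zero]
  have hsum : Tendsto (fun t => ∑' j : ℕ+,
      ‖timeExp j (-t) - timeExp j (-t₀)‖ ^ 2 * ‖(j : ℂ) ^ s * coef j φ‖ ^ 2) (𝓝 t₀)
      (𝓝 (∑' _ : ℕ+, (0 : ℝ))) := by
    refine tendsto_tsum_of_dominated_convergence (φ.hasSum_norm_sq.summable.mul_left (2 ^ 2))
      (fun j => ?_) (Eventually.of_forall fun t j => ?_)
    · have hcont : Continuous fun t =>
          ‖timeExp j (-t) - timeExp j (-t₀)‖ ^ 2 * ‖(j : ℂ) ^ s * coef j φ‖ ^ 2 := by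
        have := continuous_timeExp j
        fun_prop
      simpa using hcont.tendsto t₀
    · have hle : ‖timeExp j (-t) - timeExp j (-t₀)‖ ≤ 2 := by
        simpa only [norm_timeExp, one_add_one_eq_two] using
          norm_sub_le (timeExp j (-t)) (timeExp j (-t₀))
      rw [Real.norm_of_nonneg (by positivity)]
      gcongr
  simpa only [← norm_sq_evolve_sub, tsum_zero, Real.sqrt_sq (norm_nonneg _), Real.sqrt_zero]
    using hsum.sqrt

theorem continuous_evolve {θ : ℝ → HZero s} (hθ : Continuous θ) :
    Continuous fun t => evolve t (θ t) := by
  rw [continuous_iff_continuousAt]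
  intro t₀
  rw [ContinuousAt, tendsto_iff_norm_sub_tendsto_zero]
  have h := (tendsto_iff_norm_sub_tendsto_zero.1 (hθ.tendsto t₀)).add
    (tendsto_iff_norm_sub_tendsto_zero.1 ((continuous_evolve_apply (θ t₀)).tendsto t₀))
  rw [add_zero] at h
  refine squeeze_zero (fun _ => norm_nonneg _) (fun t => ?_) h
  rw [← (evolve t).norm_map (θ t - θ t₀), map_sub]
  exact norm_sub_le_norm_sub_add_norm_sub _ _ _

end HZero

end Evolution

section Duhamel

open InterSpace

variable {m r s : ℕ} {T : ℝ} {F F' : ℝ → InterSpace m r} {θ θ' : ℝ → HZero s}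

/-- The Duhamel term `θ(t) = i ∫₀ᵗ e^{-iA(t-τ)} F(τ) dτ` of a source `F`, as a continuous function
with values in `H^s_{(0)}`; the integral is encoded through its sine coefficients, since the values
of `F` need not lie in `H^s_{(0)}`. -/
structure IsDuhamel (T : ℝ) (F : ℝ → InterSpace m r) (θ : ℝ → HZero s) : Prop where
  continuous : Continuous θ
  coef_eq : ∀ t ∈ Icc 0 T, ∀ j, HZero.coef j (θ t) =
    Complex.I * ∫ τ in (0 : ℝ)..t, timeExp j (-(t - τ)) * coef j (F τ)

theorem integral_timeExp_neg_sub_mul (j : ℕ+) (S : ℝ → ℂ) (t : ℝ) :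
    ∫ τ in (0 : ℝ)..t, timeExp j (-(t - τ)) * S τ =
      timeExp j (-t) * ∫ τ in (0 : ℝ)..t, timeExp j τ * S τ := by
  rw [← intervalIntegral.integral_const_mul]
  congr 1 with τ
  rw [neg_sub, sub_eq_neg_add, timeExp_add, mul_assoc]

theorem intervalIntegrable_timeExp_mul_coef (hT : 0 ≤ T)
    (hF : MemLp F 2 (volume.restrict (Ioo 0 T))) (j : ℕ+) :
    IntervalIntegrable (fun τ => timeExp j τ * coef j (F τ)) volume 0 T :=
  intervalIntegrable_of_memLp_two hT (memLp_timeExp_mul_clm j (coef j) hF)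

theorem IsDuhamel.eqOn (h : IsDuhamel T F θ) (h' : IsDuhamel T F' θ')
    (hF : F =ᵐ[volume.restrict (Ioo 0 T)] F') : EqOn θ θ' (Icc 0 T) := by
  intro t ht
  refine HZero.ext_coef fun j => ?_
  rw [h.coef_eq t ht, h'.coef_eq t ht, ← integral_Ioo_eq_intervalIntegral ht.1,
    ← integral_Ioo_eq_intervalIntegral ht.1]
  congr 1
  refine integral_congr_ae ?_
  filter_upwards [ae_restrict_of_ae_restrict_of_subset (Ioo_subset_Ioo le_rfl ht.2) hF] with τ hτ
  rw [hτ]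

theorem IsDuhamel.sub (hF : MemLp F 2 (volume.restrict (Ioo 0 T)))
    (hF' : MemLp F' 2 (volume.restrict (Ioo 0 T))) (h : IsDuhamel T F θ)
    (h' : IsDuhamel T F' θ') : IsDuhamel T (fun τ => F τ - F' τ) (fun t => θ t - θ' t) := by
  refine ⟨h.continuous.sub h'.continuous, fun t ht j => ?_⟩
  rw [map_sub, h.coef_eq t ht, h'.coef_eq t ht, integral_timeExp_neg_sub_mul,
    integral_timeExp_neg_sub_mul, integral_timeExp_neg_sub_mul, ← mul_sub, ← mul_sub,
    ← intervalIntegral.integral_sub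
      (intervalIntegrable_timeExp_mul_coef ht.1 (memLp_mono_Ioo hF le_rfl ht.2) j)
      (intervalIntegrable_timeExp_mul_coef ht.1 (memLp_mono_Ioo hF' le_rfl ht.2) j)]
  simp only [map_sub, mul_sub]

theorem continuous_of_sq_norm_sub_le {X α : Type*} [TopologicalSpace α] [LinearOrder α]
    [SeminormedAddCommGroup X] {d : α → X} {ρ : α → ℝ} (hρ : Continuous ρ) {C : ℝ} (hC : 0 ≤ C)
    (h : ∀ s t, s ≤ t → ‖d t - d s‖ ^ 2 ≤ C * (ρ t - ρ s)) : Continuous d := by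
  have habs (s t : α) : ‖d t - d s‖ ≤ Real.sqrt (C * |ρ t - ρ s|) := by
    refine Real.le_sqrt_of_sq_le ?_
    rcases le_total s t with hst | hts
    · exact (h s t hst).trans (mul_le_mul_of_nonneg_left (le_abs_self _) hC)
    · rw [norm_sub_rev, abs_sub_comm]
      exact (h t s hts).trans (mul_le_mul_of_nonneg_left (le_abs_self _) hC)
  rw [continuous_iff_continuousAt]
  intro t₀
  rw [ContinuousAt, tendsto_iff_norm_sub_tendsto_zero]
  have hlim : Tendsto (fun t => Real.sqrt (C * |ρ t - ρ t₀|)) (𝓝 t₀) (𝓝 0) := by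
    have hcont : Continuous fun t => Real.sqrt (C * |ρ t - ρ t₀|) := by fun_prop
    simpa using hcont.tendsto t₀
  exact squeeze_zero (fun _ => norm_nonneg _) (fun t => habs t₀ t) hlim

theorem exists_forall_exists_coef_eq_integral_timeExp {n : ℕ} (hn : 2 * n ≤ r + 1) (hT : 0 ≤ T) :
    ∃ C : ℝ, 0 ≤ C ∧ ∀ F : ℝ → InterSpace (2 * n + 1) r, MemLp F 2 (volume.restrict (Ioo 0 T)) →
      ∃ d : Icc 0 T → HZero (2 * n + 1),
        (∀ t j, HZero.coef j (d t) = ∫ τ in (0 : ℝ)..t, timeExp j τ * coef j (F τ)) ∧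
        ∀ s t, s ≤ t → ‖d t - d s‖ ^ 2 ≤ C * ∫ τ in (s : ℝ)..t, ‖F τ‖ ^ 2 := by
  obtain ⟨C, hC, hsmooth⟩ :=
    exists_forall_sum_sq_norm_pow_mul_integral_timeExp_coef_le hn hT
  refine ⟨C, hC, fun F hF => ?_⟩
  have hcoef (t : Icc 0 T) : ∃ φ : HZero (2 * n + 1), ∀ j, HZero.coef j φ =
      ∫ τ in (0 : ℝ)..t, timeExp j τ * coef j (F τ) :=
    HZero.exists_coef_eq _
      (hsmooth 0 t le_rfl t.2.1 t.2.2 F (memLp_mono_Ioo hF le_rfl t.2.2))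
  choose d hd using hcoef
  refine ⟨d, hd, fun s t hst => HZero.norm_sq_le _ fun S => ?_⟩
  have hsub (j : ℕ+) : HZero.coef j (d t - d s) =
      ∫ τ in (s : ℝ)..t, timeExp j τ * coef j (F τ) := by
    have hint := intervalIntegrable_timeExp_mul_coef hT hF j
    rw [map_sub, hd, hd, intervalIntegral.integral_interval_sub_left
      (intervalIntegrable_mono_Icc hint ⟨le_rfl, hT⟩ t.2)
      (intervalIntegrable_mono_Icc hint ⟨le_rfl, hT⟩ s.2)]
  simp only [hsub]
  exact hsmooth s t s.2.1 hst t.2.2 F (memLp_mono_Ioo hF s.2.1 t.2.2) S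

theorem exists_isDuhamel {n : ℕ} (hn : 2 * n ≤ r + 1) (hT : 0 ≤ T) : ∃ C : ℝ, 0 ≤ C ∧
    ∀ F : ℝ → InterSpace (2 * n + 1) r, MemLp F 2 (volume.restrict (Ioo 0 T)) →
      ∃ θ : ℝ → HZero (2 * n + 1), IsDuhamel T F θ ∧
        ∀ t ∈ Icc 0 T, ‖θ t‖ ^ 2 ≤ C * ∫ τ in (0 : ℝ)..t, ‖F τ‖ ^ 2 := by
  obtain ⟨C, hC, hex⟩ := exists_forall_exists_coef_eq_integral_timeExp hn hT
  refine ⟨C, hC, fun F hF => ?_⟩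
  obtain ⟨d, hd, hle⟩ := hex F hF
  have hρ : IsPrimitive 0 T (fun t => 0 + ∫ τ in (0 : ℝ)..t, ‖F τ‖ ^ 2) (fun τ => ‖F τ‖ ^ 2) :=
    .of_integral 0 (intervalIntegrable_norm_sq hT hF)
  have hdcont : Continuous d := continuous_of_sq_norm_sub_le
    (continuousOn_iff_continuous_domRestrict.1 (hρ.continuousOn hT)) hC fun s t hst =>
      (hle s t hst).trans_eq (congrArg (C * ·) (hρ.sub_eq s.2 t.2).symm)
  refine ⟨fun t => Complex.I • HZero.evolve t (d (projIcc 0 T hT t)), ⟨?_, ?_⟩, ?_⟩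
  · exact (HZero.continuous_evolve (hdcont.comp continuous_projIcc)).const_smul Complex.I
  · intro t ht j
    rw [map_smul, HZero.coef_evolve, projIcc_of_mem hT ht, hd, smul_eq_mul,
      integral_timeExp_neg_sub_mul]
  · intro t ht
    have hd0 : d ⟨0, le_rfl, hT⟩ = 0 := HZero.ext_coef fun j => by simp [hd]
    simpa only [norm_smul, Complex.norm_I, one_mul, LinearIsometry.norm_map, projIcc_of_mem hT ht,
      hd0, sub_zero] using hle ⟨0, le_rfl, hT⟩ ⟨t, ht⟩ ht.1

end Duhamel

/-! ### Volterra equations -/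

section Volterra

variable {T : ℝ} {m : ℝ → ℝ}

/-- The exponential weight `exp (∫₀ᵗ m)`. Volterra maps governed by `m` contract the corresponding
weighted sup norm, whatever the size of `m`. -/
def expWeight (m : ℝ → ℝ) (t : ℝ) : ℝ := Real.exp (∫ σ in (0 : ℝ)..t, m σ)

theorem expWeight_pos (m : ℝ → ℝ) (t : ℝ) : 0 < expWeight m t := Real.exp_pos _

theorem one_le_expWeight (hm : ∀ t, 0 ≤ m t) {t : ℝ} (ht : 0 ≤ t) : 1 ≤ expWeight m t :=
  Real.one_le_exp (intervalIntegral.integral_nonneg ht fun σ _ => hm σ)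

theorem isPrimitive_integral (hm : IntervalIntegrable m volume 0 T) :
    IsPrimitive 0 T (fun t => ∫ σ in (0 : ℝ)..t, m σ) m := by
  simpa only [zero_add] using IsPrimitive.of_integral 0 hm

theorem continuousOn_expWeight (hm : IntervalIntegrable m volume 0 T) (hT : 0 ≤ T) :
    ContinuousOn (expWeight m) (Icc 0 T) :=
  ((isPrimitive_integral hm).continuousOn hT).rexp

theorem monotoneOn_expWeight (hm : IntervalIntegrable m volume 0 T) (hm0 : ∀ t, 0 ≤ m t) :
    MonotoneOn (expWeight m) (Icc 0 T) := fun _ hx _ hy hxy => Real.exp_le_exp.2 <|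
  sub_nonneg.1 <| (intervalIntegral.integral_nonneg hxy fun σ _ => hm0 σ).trans_eq
    ((isPrimitive_integral hm).sub_eq hx hy).symm

theorem integral_mul_expWeight_sq_le (hm : IntervalIntegrable m volume 0 T) (hm0 : ∀ t, 0 ≤ m t)
    (hT : 0 ≤ T) : ∫ τ in (0 : ℝ)..T, m τ * expWeight m τ ^ 2 ≤ expWeight m T ^ 2 / 2 := by
  have hmono : MonotoneOn (fun τ => expWeight m τ ^ 2) (uIcc 0 T) := by
    rw [uIcc_of_le hT]
    exact fun x hx y hy hxy =>
      pow_le_pow_left₀ (expWeight_pos m x).le (monotoneOn_expWeight hm hm0 hx hy hxy) 2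
  have hderiv : ∫ τ in (0 : ℝ)..T, deriv (fun τ => expWeight m τ ^ 2) τ =
      2 * ∫ τ in (0 : ℝ)..T, m τ * expWeight m τ ^ 2 := by
    rw [← intervalIntegral.integral_const_mul]
    refine intervalIntegral.integral_congr_ae ?_
    filter_upwards [(isPrimitive_integral hm).ae_hasDerivAt hT] with τ hτ hmem
    rw [uIoc_of_le hT] at hmem
    refine ((hτ (Ioc_subset_Icc_self hmem)).exp.pow 2).deriv.trans ?_
    simp only [expWeight]
    ring
  have hincr := hmono.intervalIntegral_deriv_mem_uIcc
  rw [uIcc_of_le (sub_nonneg.2 (hmono left_mem_uIcc right_mem_uIcc hT)), hderiv] at hincr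
  linarith [hincr.2, sq_nonneg (expWeight m 0)]

variable {Y : Type*} [NormedAddCommGroup Y] {Φ : (ℝ → Y) → ℝ → Y} {g h : ℝ → Y}

/-- A map `Φ` on continuous functions whose increments at time `t` only see the past, through the
integrable weight `m`: `‖Φ g t - Φ h t‖² ≤ ∫₀ᵗ m ρ²` for every increasing bound `ρ` of
`‖g - h‖`. -/
structure IsVolterra (T : ℝ) (m : ℝ → ℝ) (Φ : (ℝ → Y) → ℝ → Y) : Prop where
  integrable : IntervalIntegrable m volume 0 T
  nonneg : ∀ t, 0 ≤ m t
  continuous : ∀ g, Continuous g → Continuous (Φ g)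
  norm_sub_sq_le : ∀ g h, Continuous g → Continuous h → ∀ ρ : ℝ → ℝ,
    ContinuousOn ρ (Icc 0 T) → MonotoneOn ρ (Icc 0 T) → (∀ t ∈ Icc 0 T, ‖g t - h t‖ ≤ ρ t) →
    ∀ t ∈ Icc 0 T, ‖Φ g t - Φ h t‖ ^ 2 ≤ ∫ τ in (0 : ℝ)..t, m τ * ρ τ ^ 2

namespace IsVolterra

theorem norm_sub_le (hV : IsVolterra T m Φ) (hT : 0 ≤ T) (hg : Continuous g) (hh : Continuous h)
    {D : ℝ} (hD : 0 ≤ D) (hgh : ∀ t ∈ Icc 0 T, ‖g t - h t‖ ≤ D * expWeight m t) {t : ℝ}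
    (ht : t ∈ Icc 0 T) : ‖Φ g t - Φ h t‖ ≤ 3 / 4 * (D * expWeight m t) := by
  have hpos := expWeight_pos m t
  have hmt := intervalIntegrable_mono_Icc hV.integrable ⟨le_rfl, hT⟩ ht
  refine (sq_le_sq₀ (norm_nonneg _) (by positivity)).1 ?_
  calc ‖Φ g t - Φ h t‖ ^ 2
      ≤ ∫ τ in (0 : ℝ)..t, m τ * (D * expWeight m τ) ^ 2 :=
        hV.norm_sub_sq_le g h hg hh _
          (continuousOn_const.mul (continuousOn_expWeight hV.integrable hT))
          (fun x hx y hy hxy => mul_le_mul_of_nonneg_left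
            (monotoneOn_expWeight hV.integrable hV.nonneg hx hy hxy) hD) hgh t ht
    _ = D ^ 2 * ∫ τ in (0 : ℝ)..t, m τ * expWeight m τ ^ 2 := by
        rw [← intervalIntegral.integral_const_mul]
        congr 1 with τ
        ring
    _ ≤ D ^ 2 * (expWeight m t ^ 2 / 2) :=
        mul_le_mul_of_nonneg_left (integral_mul_expWeight_sq_le hmt hV.nonneg ht.1) (sq_nonneg D)
    _ ≤ (3 / 4 * (D * expWeight m t)) ^ 2 := by nlinarith [sq_nonneg (D * expWeight m t)]

theorem exists_norm_eq_mul_expWeight (hm : IntervalIntegrable m volume 0 T) (hT : 0 ≤ T)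
    (hg : Continuous g) : ∃ t₀ ∈ Icc 0 T, ∃ D, 0 ≤ D ∧ ‖g t₀‖ = D * expWeight m t₀ ∧
      ∀ t ∈ Icc 0 T, ‖g t‖ ≤ D * expWeight m t := by
  have hcont : ContinuousOn (fun t => ‖g t‖ / expWeight m t) (Icc 0 T) :=
    hg.norm.continuousOn.div (continuousOn_expWeight hm hT) fun t _ => (expWeight_pos m t).ne'
  obtain ⟨t₀, ht₀, hmax⟩ := isCompact_Icc.exists_isMaxOn ⟨0, le_rfl, hT⟩ hcont
  exact ⟨t₀, ht₀, ‖g t₀‖ / expWeight m t₀, div_nonneg (norm_nonneg _) (expWeight_pos m t₀).le,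
    (div_mul_cancel₀ _ (expWeight_pos m t₀).ne').symm,
    fun t ht => (div_le_iff₀ (expWeight_pos m t)).1 (hmax ht)⟩

theorem norm_le (hV : IsVolterra T m Φ) (hT : 0 ≤ T) (hg : Continuous g)
    (hfix : ∀ t ∈ Icc 0 T, g t = Φ g t) {B : ℝ} (hB : ∀ t ∈ Icc 0 T, ‖Φ 0 t‖ ≤ B) {t : ℝ}
    (ht : t ∈ Icc 0 T) : ‖g t‖ ≤ 4 * B * expWeight m T := by
  obtain ⟨t₀, ht₀, D, hD, heq, hle⟩ := exists_norm_eq_mul_expWeight hV.integrable hT hg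
  have hcontr := hV.norm_sub_le (h := 0) hT hg continuous_const hD
    (by simpa only [Pi.zero_apply, sub_zero] using hle) ht₀
  have htri : D * expWeight m t₀ ≤ ‖Φ g t₀ - Φ 0 t₀‖ + ‖Φ 0 t₀‖ := by
    rw [← heq, hfix t₀ ht₀]
    exact norm_le_norm_sub_add _ _
  have hDB : D ≤ 4 * B := by
    nlinarith [hB t₀ ht₀, one_le_expWeight hV.nonneg ht₀.1]
  exact (hle t ht).trans (mul_le_mul hDB
    (monotoneOn_expWeight hV.integrable hV.nonneg ht ⟨hT, le_rfl⟩ ht.2) (expWeight_pos m t).le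
    (hD.trans hDB))

theorem eqOn (hV : IsVolterra T m Φ) (hT : 0 ≤ T) (hg : Continuous g) (hh : Continuous h)
    (hgfix : ∀ t ∈ Icc 0 T, g t = Φ g t) (hhfix : ∀ t ∈ Icc 0 T, h t = Φ h t) :
    EqOn g h (Icc 0 T) := by
  intro t ht
  obtain ⟨t₀, ht₀, D, hD, heq, hle⟩ :=
    exists_norm_eq_mul_expWeight hV.integrable hT (hg.sub hh)
  have hcontr := hV.norm_sub_le hT hg hh hD hle ht₀
  rw [← hgfix t₀ ht₀, ← hhfix t₀ ht₀, ← Pi.sub_apply, heq] at hcontr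
  have hD0 : D = 0 := by nlinarith [expWeight_pos m t₀]
  have hzero := hle t ht
  rw [hD0, zero_mul] at hzero
  exact sub_eq_zero.1 (norm_le_zero_iff.1 hzero)

variable [NormedSpace ℝ Y]

theorem exists_contractingWith (hV : IsVolterra T m Φ) (hT : 0 ≤ T) :
    ∃ Ψ : C(Icc 0 T, Y) → C(Icc 0 T, Y), ContractingWith (3 / 4) Ψ ∧ ∀ h, ∃ h' : ℝ → Y,
      Continuous h' ∧ (∀ t : Icc 0 T, h' t = expWeight m t • h t) ∧
      ∀ t : Icc 0 T, Φ h' t = expWeight m t • Ψ h t := by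
  have hw : Continuous fun t : Icc 0 T => expWeight m t :=
    continuousOn_iff_continuous_domRestrict.1 (continuousOn_expWeight hV.integrable hT)
  let ext (h : C(Icc 0 T, Y)) : ℝ → Y := IccExtend hT fun t => expWeight m t • h t
  have hext (h) : Continuous (ext h) := (hw.smul h.continuous).Icc_extend'
  have hextv (h) (t : Icc 0 T) : ext h t = expWeight m t • h t := IccExtend_val hT _ t
  let Ψ (h : C(Icc 0 T, Y)) : C(Icc 0 T, Y) := ⟨fun t => (expWeight m t)⁻¹ • Φ (ext h) t,
    (hw.inv₀ fun t => (expWeight_pos m t).ne').smul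
      ((hV.continuous _ (hext h)).comp continuous_subtype_val)⟩
  refine ⟨Ψ, ⟨by rw [← NNReal.coe_lt_coe]; norm_num, LipschitzWith.of_dist_le_mul fun g h => ?_⟩,
    fun h => ⟨ext h, hext h, hextv h,
      fun t => (smul_inv_smul₀ (expWeight_pos m t).ne' _).symm⟩⟩
  rw [ContinuousMap.dist_le (by positivity)]
  intro t
  have hdist (s : ℝ) (hs : s ∈ Icc 0 T) : ‖ext g s - ext h s‖ ≤ dist g h * expWeight m s := by
    rw [hextv g ⟨s, hs⟩, hextv h ⟨s, hs⟩, ← smul_sub, norm_smul,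
      Real.norm_of_nonneg (expWeight_pos m s).le, mul_comm, ← dist_eq_norm]
    exact mul_le_mul_of_nonneg_right (ContinuousMap.dist_apply_le_dist _) (expWeight_pos m s).le
  change dist ((expWeight m t)⁻¹ • Φ (ext g) t) ((expWeight m t)⁻¹ • Φ (ext h) t) ≤ _
  rw [dist_eq_norm, ← smul_sub, norm_smul, norm_inv, Real.norm_of_nonneg (expWeight_pos m t).le,
    inv_mul_le_iff₀ (expWeight_pos m t)]
  refine (hV.norm_sub_le hT (hext g) (hext h) dist_nonneg hdist t.2).trans_eq ?_
  push_cast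
  ring

theorem exists_fixed [CompleteSpace Y] (hV : IsVolterra T m Φ) (hT : 0 ≤ T) :
    ∃ g, Continuous g ∧ ∀ t ∈ Icc 0 T, g t = Φ g t := by
  obtain ⟨Ψ, hΨ, hext⟩ := hV.exists_contractingWith hT
  obtain ⟨g, hg, hgv, hΦ⟩ := hext (hΨ.fixedPoint Ψ)
  refine ⟨g, hg, fun t ht => ?_⟩
  rw [hgv ⟨t, ht⟩, hΦ ⟨t, ht⟩, hΨ.fixedPoint_isFixedPt]

end IsVolterra

end Volterra

/-! ### The equation for the highest time derivative -/

section IteratedPrimitive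

variable {Y : Type*} [NormedAddCommGroup Y] [NormedSpace ℝ Y] {T : ℝ}

/-- The `q`-fold primitive of `g`, whose `i`-fold primitive takes the value `c i` at `0` for
`1 ≤ i ≤ q`. -/
def iterPrim (c : ℕ → Y) (g : ℝ → Y) : ℕ → ℝ → Y
  | 0 => g
  | q + 1 => fun t => c (q + 1) + ∫ τ in (0 : ℝ)..t, iterPrim c g q τ

theorem norm_iterPrim_zero_le (hT : 0 ≤ T) {c : ℕ → Y} {A : ℝ} (hc : ∀ q, ‖c q‖ ≤ A) (q : ℕ)
    {t : ℝ} (ht : t ∈ Icc 0 T) : ‖iterPrim c 0 q t‖ ≤ (1 + T) ^ q * A := by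
  have hA : 0 ≤ A := (norm_nonneg _).trans (hc 0)
  induction q generalizing t with
  | zero => simpa [iterPrim] using hA
  | succ q ih =>
    have hbound (τ : ℝ) (hτ : τ ∈ uIoc 0 t) : ‖iterPrim c 0 q τ‖ ≤ (1 + T) ^ q * A := by
      rw [uIoc_of_le ht.1] at hτ
      exact ih ⟨hτ.1.le, hτ.2.trans ht.2⟩
    calc ‖iterPrim c 0 (q + 1) t‖ ≤ A + (1 + T) ^ q * A * |t - 0| :=
          norm_add_le_of_le (hc (q + 1))
            (intervalIntegral.norm_integral_le_of_norm_le_const hbound)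
      _ ≤ (1 + T) ^ q * A + (1 + T) ^ q * A * T := by
          rw [sub_zero, abs_of_nonneg ht.1]
          gcongr
          · exact le_mul_of_one_le_left hA (one_le_pow₀ (by linarith))
          · exact ht.2
      _ = (1 + T) ^ (q + 1) * A := by ring

variable (c : ℕ → Y) {g h : ℝ → Y}

theorem continuous_iterPrim (hg : Continuous g) (q : ℕ) : Continuous (iterPrim c g q) := by
  induction q with
  | zero => exact hg
  | succ q ih =>
    exact continuous_const.add
      (intervalIntegral.continuous_primitive (fun a b => ih.intervalIntegrable a b) 0)

theorem norm_iterPrim_sub_le (hT : 0 ≤ T) (hg : Continuous g) (hh : Continuous h) {ρ : ℝ → ℝ}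
    (hρ : MonotoneOn ρ (Icc 0 T)) (hgh : ∀ t ∈ Icc 0 T, ‖g t - h t‖ ≤ ρ t) (q : ℕ) {t : ℝ}
    (ht : t ∈ Icc 0 T) : ‖iterPrim c g q t - iterPrim c h q t‖ ≤ (1 + T) ^ q * ρ t := by
  induction q generalizing t with
  | zero => simpa only [iterPrim, pow_zero, one_mul] using hgh t ht
  | succ q ih =>
    have hρ0 : 0 ≤ ρ t := (norm_nonneg _).trans (hgh t ht)
    have hbound (τ : ℝ) (hτ : τ ∈ uIoc 0 t) :
        ‖iterPrim c g q τ - iterPrim c h q τ‖ ≤ (1 + T) ^ q * ρ t := by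
      rw [uIoc_of_le ht.1] at hτ
      have hτT : τ ∈ Icc 0 T := ⟨hτ.1.le, hτ.2.trans ht.2⟩
      exact (ih hτT).trans (mul_le_mul_of_nonneg_left (hρ hτT ht hτ.2) (by positivity))
    simp only [iterPrim]
    rw [add_sub_add_left_eq_sub, ← intervalIntegral.integral_sub
      ((continuous_iterPrim c hg q).intervalIntegrable _ _)
      ((continuous_iterPrim c hh q).intervalIntegrable _ _)]
    refine (intervalIntegral.norm_integral_le_of_norm_le_const hbound).trans ?_
    rw [sub_zero, abs_of_nonneg ht.1, pow_succ, mul_right_comm]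
    gcongr
    linarith [ht.2]

theorem norm_iterPrim_le (hT : 0 ≤ T) {c : ℕ → Y} {A G : ℝ} (hc : ∀ q, ‖c q‖ ≤ A)
    (hg : Continuous g) (hG : ∀ t ∈ Icc 0 T, ‖g t‖ ≤ G) (q : ℕ) {t : ℝ} (ht : t ∈ Icc 0 T) :
    ‖iterPrim c g q t‖ ≤ (1 + T) ^ q * (A + G) := by
  have hsub := norm_iterPrim_sub_le c (h := 0) hT hg continuous_const
    (ρ := fun _ => G) (fun _ _ _ _ _ => le_rfl)
    (by simpa only [Pi.zero_apply, sub_zero] using hG) q ht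
  have hzero := norm_iterPrim_zero_le hT hc q ht
  linarith [norm_le_norm_sub_add (iterPrim c g q t) (iterPrim c 0 q t)]

variable [CompleteSpace Y]

theorem hasDerivAt_iterPrim (hg : Continuous g) (q : ℕ) (t : ℝ) :
    HasDerivAt (iterPrim c g (q + 1)) (iterPrim c g q t) t := by
  have hq := continuous_iterPrim c hg q
  exact (intervalIntegral.integral_hasDerivAt_right (hq.intervalIntegrable _ _)
    (hq.stronglyMeasurableAtFilter _ _) hq.continuousAt).const_add _

theorem deriv_iterPrim (hg : Continuous g) (q : ℕ) :
    deriv (iterPrim c g (q + 1)) = iterPrim c g q :=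
  funext fun t => (hasDerivAt_iterPrim c hg q t).deriv

theorem contDiff_iterPrim (hg : Continuous g) (q : ℕ) : ContDiff ℝ q (iterPrim c g q) := by
  induction q with
  | zero => exact contDiff_zero.2 hg
  | succ q ih =>
    rw [Nat.cast_succ, contDiff_succ_iff_deriv, deriv_iterPrim c hg]
    exact ⟨fun t => (hasDerivAt_iterPrim c hg q t).differentiableAt,
      fun h => absurd h (WithTop.coe_ne_top (a := (q : ℕ∞))), ih⟩

theorem iteratedDeriv_iterPrim (hg : Continuous g) (n q : ℕ) :
    iteratedDeriv n (iterPrim c g (q + n)) = iterPrim c g q := by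
  induction n with
  | zero => rw [iteratedDeriv_zero, add_zero]
  | succ n ih => rw [iteratedDeriv_succ', ← add_assoc, deriv_iterPrim c hg, ih]

theorem iteratedDerivWithin_iterPrim (hT : 0 < T) (hg : Continuous g) {n k : ℕ} (hn : n ≤ k)
    {t : ℝ} (ht : t ∈ Icc 0 T) :
    iteratedDerivWithin n (iterPrim c g k) (Icc 0 T) t = iterPrim c g (k - n) t := by
  rw [iteratedDerivWithin_eq_iteratedDeriv (uniqueDiffOn_Icc hT)
    ((contDiff_iterPrim c hg k).of_le (by exact_mod_cast hn)).contDiffAt ht]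
  conv_lhs => rw [← Nat.sub_add_cancel hn]
  rw [iteratedDeriv_iterPrim c hg]

theorem isPrimitive_iterPrim (hg : Continuous g) (q : ℕ) :
    IsPrimitive 0 T (iterPrim c g (q + 1)) (iterPrim c g q) :=
  .of_hasDerivAt (hasDerivAt_iterPrim c hg q) (continuous_iterPrim c hg q)

theorem isJet_iterPrim (hg : Continuous g) (k : ℕ) :
    IsJet 0 T k fun n => iterPrim c g (k - n) := by
  intro n hn
  dsimp only
  rw [show k - n = k - (n + 1) + 1 by lia]
  exact isPrimitive_iterPrim c hg _

theorem clm_iterPrim {Z : Type*} [NormedAddCommGroup Z] [NormedSpace ℝ Z] [CompleteSpace Z]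
    (L : Y →L[ℝ] Z) (hg : Continuous g) (q : ℕ) (t : ℝ) :
    L (iterPrim c g q t) = iterPrim (fun i => L (c i)) (fun τ => L (g τ)) q t := by
  induction q generalizing t with
  | zero => rfl
  | succ q ih =>
    simp only [iterPrim, map_add, ← ih]
    rw [L.intervalIntegral_comp_comm ((continuous_iterPrim c hg q).intervalIntegrable _ _)]

end IteratedPrimitive

section Poincare

variable {E : Type*} [NormedAddCommGroup E] [NormedSpace ℝ E] [CompleteSpace E] {T : ℝ}

theorem IsPrimitive.integral_norm_sq_le (hT : 0 ≤ T) {U U' : ℝ → E} (h : IsPrimitive 0 T U U')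
    (h0 : U 0 = 0) (hU' : MemLp U' 2 (volume.restrict (Ioo 0 T))) :
    ∫ τ in (0 : ℝ)..T, ‖U τ‖ ^ 2 ≤ T ^ 2 * ∫ τ in (0 : ℝ)..T, ‖U' τ‖ ^ 2 := by
  have hint : IntervalIntegrable (fun τ => ‖U τ‖ ^ 2) volume 0 T :=
    ((h.continuousOn_uIcc hT).norm.pow 2).intervalIntegrable
  have hpoint (τ : ℝ) (hτ : τ ∈ Icc 0 T) : ‖U τ‖ ^ 2 ≤ T * ∫ σ in (0 : ℝ)..T, ‖U' σ‖ ^ 2 := by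
    rw [h.eq τ hτ, h0, zero_add]
    refine (sq_norm_integral_le hτ.1 (memLp_mono_Ioo hU' le_rfl hτ.2)).trans ?_
    rw [sub_zero]
    exact mul_le_mul hτ.2 (intervalIntegral.integral_mono_interval le_rfl hτ.1 hτ.2
      (Eventually.of_forall fun _ => sq_nonneg _) (intervalIntegrable_norm_sq hT hU'))
      (integral_norm_sq_nonneg hτ.1 _) hT
  refine (intervalIntegral.integral_mono_on hT hint intervalIntegrable_const hpoint).trans_eq ?_
  rw [intervalIntegral.integral_const, smul_eq_mul]
  ring

theorem IsJet.integral_norm_sq_le (hT : 0 ≤ T) {κ : ℕ} {U : ℕ → ℝ → E} (h : IsJet 0 T κ U)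
    (h0 : ∀ l < κ, U l 0 = 0) (hU : ∀ l ≤ κ, MemLp (U l) 2 (volume.restrict (Ioo 0 T)))
    {i q : ℕ} (hiq : i + q ≤ κ) :
    ∫ τ in (0 : ℝ)..T, ‖U i τ‖ ^ 2 ≤ (T ^ 2) ^ q * ∫ τ in (0 : ℝ)..T, ‖U (i + q) τ‖ ^ 2 := by
  induction q with
  | zero => simp
  | succ q ih =>
    refine (ih (by lia)).trans ?_
    rw [pow_succ _ q, mul_assoc]
    exact mul_le_mul_of_nonneg_left ((h (i + q) (by lia)).integral_norm_sq_le hT (h0 _ (by lia))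
      (hU _ hiq)) (by positivity)

end Poincare

section Source

variable {T : ℝ} {X Y : Type*} [NormedAddCommGroup X] [NormedSpace ℝ X]
  [NormedAddCommGroup Y] [NormedSpace ℝ Y] {U : ℕ → ℝ → ℝ} {W : ℕ → ℝ → X} {c : ℕ → Y} {κ : ℕ}
  {g h : ℝ → Y}

/-- The `n`-th time derivative of the source `u M ψ + f`, where `U` and `W` are the derivatives
of `u` and `f`, and `ψ` is the `κ`-fold primitive of `g`. -/
def sourceDeriv (U : ℕ → ℝ → ℝ) (M : Y →L[ℝ] X) (W : ℕ → ℝ → X) (c : ℕ → Y) (κ : ℕ) (g : ℝ → Y)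
    (n : ℕ) (τ : ℝ) : X :=
  leibnizProd U (fun l τ => M (iterPrim c g (κ - l) τ)) n τ + W n τ

/-- The weight that controls the dependence of the `κ`-th source derivative on `g`. -/
def sourceWeight (T : ℝ) (U : ℕ → ℝ → ℝ) (κ : ℕ) (τ : ℝ) : ℝ :=
  ∑ ij ∈ Finset.HasAntidiagonal.antidiagonal κ, κ.choose ij.1 * (1 + T) ^ ij.1 * ‖U ij.1 τ‖

theorem sourceDeriv_zero (M : Y →L[ℝ] X) (τ : ℝ) :
    sourceDeriv U M W c κ g 0 τ = U 0 τ • M (iterPrim c g κ τ) + W 0 τ := by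
  simp [sourceDeriv, leibnizProd]

theorem sourceDeriv_eq_zero (M : Y →L[ℝ] X) {n : ℕ} {τ : ℝ} (hU : ∀ l ≤ n, U l τ = 0)
    (hW : W n τ = 0) : sourceDeriv U M W c κ g n τ = 0 := by
  rw [sourceDeriv, hW, add_zero]
  refine Finset.sum_eq_zero fun ij hij => ?_
  rw [hU ij.1 (Finset.HasAntidiagonal.antidiagonal.fst_le hij), zero_smul, smul_zero]

theorem memLp_sourceWeight (hU : ∀ l ≤ κ, MemLp (U l) 2 (volume.restrict (Ioo 0 T))) :
    MemLp (sourceWeight T U κ) 2 (volume.restrict (Ioo 0 T)) :=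
  memLp_finsetSum _ fun ij hij =>
    (hU ij.1 (Finset.HasAntidiagonal.antidiagonal.fst_le hij)).norm.const_mul _

theorem intervalIntegrable_sourceWeight_sq (hT : 0 ≤ T)
    (hU : ∀ l ≤ κ, MemLp (U l) 2 (volume.restrict (Ioo 0 T))) :
    IntervalIntegrable (fun τ => sourceWeight T U κ τ ^ 2) volume 0 T := by
  simpa only [Real.norm_eq_abs, sq_abs] using
    intervalIntegrable_norm_sq hT (memLp_sourceWeight hU)

theorem norm_leibnizProd_le (M : Y →L[ℝ] X) {J : ℕ → ℝ → Y} {r τ : ℝ}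
    (hJ : ∀ l, ‖J l τ‖ ≤ (1 + T) ^ l * r) :
    ‖leibnizProd U (fun n τ => M (J (κ - n) τ)) κ τ‖ ≤ ‖M‖ * r * sourceWeight T U κ τ := by
  rw [leibnizProd, sourceWeight, Finset.mul_sum]
  refine norm_sum_le_of_le _ fun ij hij => ?_
  rw [← Finset.HasAntidiagonal.mem_antidiagonal.1 hij, Nat.add_sub_cancel_right,
    ← Nat.cast_smul_eq_nsmul ℝ, norm_smul, norm_smul, Real.norm_natCast]
  calc ((ij.1 + ij.2).choose ij.1 : ℝ) * (‖U ij.1 τ‖ * ‖M (J ij.1 τ)‖)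
      ≤ (ij.1 + ij.2).choose ij.1 * (‖U ij.1 τ‖ * (‖M‖ * ((1 + T) ^ ij.1 * r))) := by
        gcongr
        exact M.le_opNorm_of_le (hJ ij.1)
    _ = _ := by ring

theorem norm_sourceDeriv_zero_le (hT : 0 ≤ T) (M : Y →L[ℝ] X) {A : ℝ} (hc : ∀ q, ‖c q‖ ≤ A)
    {τ : ℝ} (hτ : τ ∈ Icc 0 T) :
    ‖sourceDeriv U M W c κ 0 κ τ‖ ≤ ‖M‖ * A * sourceWeight T U κ τ + ‖W κ τ‖ :=
  norm_add_le_of_le (norm_leibnizProd_le M fun l => norm_iterPrim_zero_le hT hc l hτ) le_rfl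

theorem norm_sourceDeriv_sub_le (hT : 0 ≤ T) (M : Y →L[ℝ] X) (hg : Continuous g)
    (hh : Continuous h) {ρ : ℝ → ℝ} (hρ : MonotoneOn ρ (Icc 0 T))
    (hgh : ∀ t ∈ Icc 0 T, ‖g t - h t‖ ≤ ρ t) {τ : ℝ} (hτ : τ ∈ Icc 0 T) :
    ‖sourceDeriv U M W c κ g κ τ - sourceDeriv U M W c κ h κ τ‖ ≤
      ‖M‖ * ρ τ * sourceWeight T U κ τ := by
  have hlin : sourceDeriv U M W c κ g κ τ - sourceDeriv U M W c κ h κ τ =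
      leibnizProd U (fun n τ => M (iterPrim c g (κ - n) τ - iterPrim c h (κ - n) τ)) κ τ := by
    simp only [sourceDeriv, leibnizProd, add_sub_add_right_eq_sub, ← Finset.sum_sub_distrib,
      map_sub, smul_sub]
  rw [hlin]
  exact norm_leibnizProd_le (J := fun l τ => iterPrim c g l τ - iterPrim c h l τ) M
    fun l => norm_iterPrim_sub_le c hT hg hh hρ hgh l hτ

theorem memLp_sourceDeriv (M : Y →L[ℝ] X)
    (hU : ∀ l ≤ κ, MemLp (U l) 2 (volume.restrict (Ioo 0 T)))
    (hW : MemLp (W κ) 2 (volume.restrict (Ioo 0 T))) (hg : Continuous g) :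
    MemLp (sourceDeriv U M W c κ g κ) 2 (volume.restrict (Ioo 0 T)) := by
  refine MemLp.add (memLp_finsetSum _ fun ij hij => ?_) hW
  simp only [← Nat.cast_smul_eq_nsmul ℝ]
  exact (memLp_smul_of_continuousOn_right (hU ij.1 (Finset.HasAntidiagonal.antidiagonal.fst_le hij))
    (M.continuous.comp (continuous_iterPrim c hg _)).continuousOn).const_smul _

theorem isJet_sourceDeriv [CompleteSpace X] [CompleteSpace Y] (hT : 0 ≤ T) (M : Y →L[ℝ] X)
    (hU : IsJet 0 T κ U) (hW : IsJet 0 T κ W) (hg : Continuous g) :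
    IsJet 0 T κ (sourceDeriv U M W c κ g) := fun n hn =>
  (hU.leibnizProd hT (fun i hi => (isJet_iterPrim c hg κ i hi).clm_comp M) n hn).add (hW n hn)

theorem sourceWeight_sq_le (T : ℝ) (U : ℕ → ℝ → ℝ) (κ : ℕ) (τ : ℝ) :
    sourceWeight T U κ τ ^ 2 ≤ (κ + 1) * ∑ ij ∈ Finset.HasAntidiagonal.antidiagonal κ,
      (κ.choose ij.1 * (1 + T) ^ ij.1 : ℝ) ^ 2 * ‖U ij.1 τ‖ ^ 2 := by
  refine sq_sum_le_card_mul_sum_sq.trans_eq ?_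
  simp only [Finset.Nat.card_antidiagonal, Nat.cast_succ, mul_pow]

theorem exists_integral_sourceWeight_sq_le (hT : 0 ≤ T) (κ : ℕ) : ∃ K : ℝ, 0 ≤ K ∧
    ∀ U : ℕ → ℝ → ℝ, IsJet 0 T κ U → (∀ l < κ, U l 0 = 0) →
      (∀ l ≤ κ, MemLp (U l) 2 (volume.restrict (Ioo 0 T))) →
      ∫ τ in (0 : ℝ)..T, sourceWeight T U κ τ ^ 2 ≤ K * ∫ τ in (0 : ℝ)..T, ‖U κ τ‖ ^ 2 := by
  refine ⟨(κ + 1) * ∑ ij ∈ Finset.HasAntidiagonal.antidiagonal κ,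
    (κ.choose ij.1 * (1 + T) ^ ij.1) ^ 2 * (T ^ 2) ^ ij.2, by positivity,
    fun U hJ h0 hU => ?_⟩
  have hint : ∀ ij ∈ Finset.HasAntidiagonal.antidiagonal κ, IntervalIntegrable
      (fun τ => (κ.choose ij.1 * (1 + T) ^ ij.1 : ℝ) ^ 2 * ‖U ij.1 τ‖ ^ 2) volume 0 T :=
    fun ij hij => (intervalIntegrable_norm_sq hT
      (hU ij.1 (Finset.HasAntidiagonal.antidiagonal.fst_le hij))).const_mul _
  have hsum : IntervalIntegrable (fun τ => ∑ ij ∈ Finset.HasAntidiagonal.antidiagonal κ,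
      (κ.choose ij.1 * (1 + T) ^ ij.1 : ℝ) ^ 2 * ‖U ij.1 τ‖ ^ 2) volume 0 T := by
    simpa only [Finset.sum_fn] using IntervalIntegrable.sum _ hint
  refine (intervalIntegral.integral_mono_on hT (intervalIntegrable_sourceWeight_sq hT hU)
    (hsum.const_mul _) fun τ _ => sourceWeight_sq_le T U κ τ).trans ?_
  rw [intervalIntegral.integral_const_mul, intervalIntegral.integral_finsetSum hint, mul_assoc,
    Finset.sum_mul]
  refine mul_le_mul_of_nonneg_left (Finset.sum_le_sum fun ij hij => ?_) (by positivity)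
  have hκ := Finset.HasAntidiagonal.mem_antidiagonal.1 hij
  rw [intervalIntegral.integral_const_mul, mul_assoc]
  refine mul_le_mul_of_nonneg_left ?_ (by positivity)
  simpa only [hκ] using hJ.integral_norm_sq_le hT h0 hU hκ.le

end Source

section FixedPoint

variable {m r s κ : ℕ} {T C : ℝ} {Θ : (ℝ → InterSpace m r) → ℝ → HZero s} {U : ℕ → ℝ → ℝ}
  {W : ℕ → ℝ → InterSpace m r} {c : ℕ → HZero s} {g h : ℝ → HZero s}

/-- `Θ` maps square integrable sources to their Duhamel terms over `[0,T]`, with constant `C` in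
the smoothing estimate. -/
structure IsDuhamelMap (T C : ℝ) (Θ : (ℝ → InterSpace m r) → ℝ → HZero s) : Prop where
  nonneg : 0 ≤ C
  isDuhamel : ∀ F, MemLp F 2 (volume.restrict (Ioo 0 T)) → IsDuhamel T F (Θ F)
  norm_sq_le : ∀ F, MemLp F 2 (volume.restrict (Ioo 0 T)) → ∀ t ∈ Icc 0 T,
    ‖Θ F t‖ ^ 2 ≤ C * ∫ τ in (0 : ℝ)..t, ‖F τ‖ ^ 2

theorem exists_isDuhamelMap {n : ℕ} (hn : 2 * n ≤ r + 1) (hT : 0 ≤ T) :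
    ∃ C, ∃ Θ : (ℝ → InterSpace (2 * n + 1) r) → ℝ → HZero (2 * n + 1), IsDuhamelMap T C Θ := by
  obtain ⟨C, hC, hex⟩ := exists_isDuhamel hn hT
  choose! Θ hΘ hle using hex
  exact ⟨C, Θ, hC, hΘ, hle⟩

/-- The map whose fixed points are the `κ`-th time derivatives of the solutions; the initial values
of the lower derivatives are prescribed by `c`. -/
def duhamelMap (Θ : (ℝ → InterSpace m r) → ℝ → HZero s) (U : ℕ → ℝ → ℝ)
    (M : HZero s →L[ℝ] InterSpace m r) (W : ℕ → ℝ → InterSpace m r) (c : ℕ → HZero s) (κ : ℕ)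
    (g : ℝ → HZero s) (t : ℝ) : HZero s :=
  HZero.evolve t (c 0) + Θ (sourceDeriv U M W c κ g κ) t

namespace IsDuhamelMap

theorem norm_duhamelMap_sub_sq_le (hΘ : IsDuhamelMap T C Θ)
    (hU : ∀ l ≤ κ, MemLp (U l) 2 (volume.restrict (Ioo 0 T)))
    (hW : MemLp (W κ) 2 (volume.restrict (Ioo 0 T))) (M : HZero s →L[ℝ] InterSpace m r)
    (hg : Continuous g) (hh : Continuous h) {t : ℝ} (ht : t ∈ Icc 0 T) :
    ‖duhamelMap Θ U M W c κ g t - duhamelMap Θ U M W c κ h t‖ ^ 2 ≤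
      C * ∫ τ in (0 : ℝ)..t, ‖sourceDeriv U M W c κ g κ τ - sourceDeriv U M W c κ h κ τ‖ ^ 2 := by
  have hFg := memLp_sourceDeriv (c := c) M hU hW hg
  have hFh := memLp_sourceDeriv (c := c) M hU hW hh
  have hlin : Θ (sourceDeriv U M W c κ g κ) t - Θ (sourceDeriv U M W c κ h κ) t =
      Θ (sourceDeriv U M W c κ g κ - sourceDeriv U M W c κ h κ) t :=
    ((hΘ.isDuhamel _ hFg).sub hFg hFh (hΘ.isDuhamel _ hFh)).eqOn
      (hΘ.isDuhamel _ (hFg.sub hFh)) EventuallyEq.rfl ht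
  rw [duhamelMap, duhamelMap, add_sub_add_left_eq_sub, hlin]
  exact hΘ.norm_sq_le _ (hFg.sub hFh) t ht

theorem isVolterra (hΘ : IsDuhamelMap T C Θ) (hT : 0 ≤ T)
    (hU : ∀ l ≤ κ, MemLp (U l) 2 (volume.restrict (Ioo 0 T)))
    (hW : MemLp (W κ) 2 (volume.restrict (Ioo 0 T))) (M : HZero s →L[ℝ] InterSpace m r)
    (c : ℕ → HZero s) : IsVolterra T (fun τ => C * ‖M‖ ^ 2 * sourceWeight T U κ τ ^ 2)
      (duhamelMap Θ U M W c κ) := by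
  have hm := (intervalIntegrable_sourceWeight_sq hT hU).const_mul (C * ‖M‖ ^ 2)
  have hC := hΘ.nonneg
  refine ⟨hm, fun t => by positivity, fun g hg => (HZero.continuous_evolve_apply (c 0)).add
    (hΘ.isDuhamel _ (memLp_sourceDeriv M hU hW hg)).continuous,
    fun g h hg hh ρ hρc hρ hgh t ht => ?_⟩
  have hsub : Icc 0 t ⊆ Icc 0 T := Icc_subset_Icc_right ht.2
  have hF := (memLp_sourceDeriv (c := c) M hU hW hg).sub (memLp_sourceDeriv (c := c) M hU hW hh)
  refine (hΘ.norm_duhamelMap_sub_sq_le hU hW M hg hh ht).trans ?_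
  rw [← intervalIntegral.integral_const_mul]
  refine intervalIntegral.integral_mono_on ht.1
    ((intervalIntegrable_norm_sq ht.1 (memLp_mono_Ioo hF le_rfl ht.2)).const_mul C)
    ((intervalIntegrable_mono_Icc hm ⟨le_rfl, hT⟩ ht).mul_continuousOn ?_) fun τ hτ => ?_
  · rw [uIcc_of_le ht.1]
    exact (hρc.mono hsub).pow 2
  · calc C * ‖sourceDeriv U M W c κ g κ τ - sourceDeriv U M W c κ h κ τ‖ ^ 2
        ≤ C * (‖M‖ * ρ τ * sourceWeight T U κ τ) ^ 2 := by
          gcongr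
          exact norm_sourceDeriv_sub_le hT M hg hh hρ hgh (hsub hτ)
      _ = C * ‖M‖ ^ 2 * sourceWeight T U κ τ ^ 2 * ρ τ ^ 2 := by ring

theorem integral_norm_sourceDeriv_zero_sq_le (hT : 0 ≤ T)
    (hU : ∀ l ≤ κ, MemLp (U l) 2 (volume.restrict (Ioo 0 T)))
    (hW : MemLp (W κ) 2 (volume.restrict (Ioo 0 T))) (M : HZero s →L[ℝ] InterSpace m r)
    {A : ℝ} (hc : ∀ q, ‖c q‖ ≤ A) :
    ∫ τ in (0 : ℝ)..T, ‖sourceDeriv U M W c κ 0 κ τ‖ ^ 2 ≤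
      2 * (‖M‖ * A) ^ 2 * (∫ τ in (0 : ℝ)..T, sourceWeight T U κ τ ^ 2) +
        2 * ∫ τ in (0 : ℝ)..T, ‖W κ τ‖ ^ 2 := by
  have hw := (intervalIntegrable_sourceWeight_sq hT hU).const_mul (2 * (‖M‖ * A) ^ 2)
  have hWi := (intervalIntegrable_norm_sq hT hW).const_mul 2
  rw [← intervalIntegral.integral_const_mul, ← intervalIntegral.integral_const_mul,
    ← intervalIntegral.integral_add hw hWi]
  refine intervalIntegral.integral_mono_on hT (intervalIntegrable_norm_sq hT
    (memLp_sourceDeriv M hU hW continuous_zero)) (hw.add hWi) fun τ hτ => ?_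
  have hsq := pow_le_pow_left₀ (norm_nonneg _)
    (norm_sourceDeriv_zero_le (U := U) (W := W) (κ := κ) hT M hc hτ) 2
  nlinarith [sq_nonneg (‖M‖ * A * sourceWeight T U κ τ - ‖W κ τ‖)]

theorem norm_duhamelMap_zero_le (hΘ : IsDuhamelMap T C Θ) (hT : 0 ≤ T)
    (hU : ∀ l ≤ κ, MemLp (U l) 2 (volume.restrict (Ioo 0 T)))
    (hW : MemLp (W κ) 2 (volume.restrict (Ioo 0 T))) (M : HZero s →L[ℝ] InterSpace m r)
    {A B Q : ℝ} (hc : ∀ q, ‖c q‖ ≤ A) (hQ : ∫ τ in (0 : ℝ)..T, sourceWeight T U κ τ ^ 2 ≤ Q)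
    (hB : 0 ≤ B) (hWB : ∫ τ in (0 : ℝ)..T, ‖W κ τ‖ ^ 2 ≤ B ^ 2) {t : ℝ} (ht : t ∈ Icc 0 T) :
    ‖duhamelMap Θ U M W c κ 0 t‖ ≤ (1 + √(2 * C * (‖M‖ ^ 2 * Q + 1))) * (A + B) := by
  have hA : 0 ≤ A := (norm_nonneg _).trans (hc 0)
  have hQ0 : 0 ≤ Q := (intervalIntegral.integral_nonneg hT fun _ _ => sq_nonneg _).trans hQ
  have hF := memLp_sourceDeriv (c := c) M hU hW continuous_zero
  have hint : ∫ τ in (0 : ℝ)..t, ‖sourceDeriv U M W c κ 0 κ τ‖ ^ 2 ≤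
      2 * (‖M‖ ^ 2 * Q + 1) * (A + B) ^ 2 := by
    calc ∫ τ in (0 : ℝ)..t, ‖sourceDeriv U M W c κ 0 κ τ‖ ^ 2
        ≤ ∫ τ in (0 : ℝ)..T, ‖sourceDeriv U M W c κ 0 κ τ‖ ^ 2 :=
          intervalIntegral.integral_mono_interval le_rfl ht.1 ht.2
            (Eventually.of_forall fun _ => sq_nonneg _) (intervalIntegrable_norm_sq hT hF)
      _ ≤ 2 * (‖M‖ * A) ^ 2 * Q + 2 * B ^ 2 :=
          (integral_norm_sourceDeriv_zero_sq_le hT hU hW M hc).trans (by gcongr)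
      _ ≤ 2 * (‖M‖ * (A + B)) ^ 2 * Q + 2 * (A + B) ^ 2 := by gcongr <;> linarith
      _ = 2 * (‖M‖ ^ 2 * Q + 1) * (A + B) ^ 2 := by ring
  have hΘle : ‖Θ (sourceDeriv U M W c κ 0 κ) t‖ ≤ √(2 * C * (‖M‖ ^ 2 * Q + 1)) * (A + B) := by
    have hC := hΘ.nonneg
    refine (sq_le_sq₀ (norm_nonneg _) (by positivity)).1 ((hΘ.norm_sq_le _ hF t ht).trans ?_)
    rw [mul_pow, Real.sq_sqrt (by positivity)]
    exact (mul_le_mul_of_nonneg_left hint hC).trans_eq (by ring)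
  calc ‖duhamelMap Θ U M W c κ 0 t‖ ≤ A + √(2 * C * (‖M‖ ^ 2 * Q + 1)) * (A + B) :=
        norm_add_le_of_le (((HZero.evolve t).norm_map (c 0)).trans_le (hc 0)) hΘle
    _ ≤ (1 + √(2 * C * (‖M‖ ^ 2 * Q + 1))) * (A + B) := by linarith

/-- The factor by which the first `κ` derivatives of a solution exceed the size of the data, when
`N` is the norm of the multiplication operator and `Q` bounds the square integral of
`sourceWeight`. -/
def solutionBound (T C N Q : ℝ) (κ : ℕ) : ℝ :=
  (1 + T) ^ κ * (1 + 4 * (1 + √(2 * C * (N ^ 2 * Q + 1))) * Real.exp (C * N ^ 2 * Q))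

theorem norm_iterPrim_fixed_le (hΘ : IsDuhamelMap T C Θ) (hT : 0 ≤ T)
    (hU : ∀ l ≤ κ, MemLp (U l) 2 (volume.restrict (Ioo 0 T)))
    (hW : MemLp (W κ) 2 (volume.restrict (Ioo 0 T))) (M : HZero s →L[ℝ] InterSpace m r)
    {A B Q : ℝ} (hc : ∀ q, ‖c q‖ ≤ A) (hQ : ∫ τ in (0 : ℝ)..T, sourceWeight T U κ τ ^ 2 ≤ Q)
    (hB : 0 ≤ B) (hWB : ∫ τ in (0 : ℝ)..T, ‖W κ τ‖ ^ 2 ≤ B ^ 2) (hg : Continuous g)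
    (hfix : ∀ t ∈ Icc 0 T, g t = duhamelMap Θ U M W c κ g t) {q : ℕ} (hq : q ≤ κ) {t : ℝ}
    (ht : t ∈ Icc 0 T) : ‖iterPrim c g q t‖ ≤ solutionBound T C ‖M‖ Q κ * (A + B) := by
  have hC := hΘ.nonneg
  have hA : 0 ≤ A := (norm_nonneg _).trans (hc 0)
  set K := 1 + √(2 * C * (‖M‖ ^ 2 * Q + 1))
  have hweight : expWeight (fun τ => C * ‖M‖ ^ 2 * sourceWeight T U κ τ ^ 2) T ≤
      Real.exp (C * ‖M‖ ^ 2 * Q) := by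
    rw [expWeight, intervalIntegral.integral_const_mul]
    gcongr
  have hgle (t : ℝ) (ht : t ∈ Icc 0 T) :
      ‖g t‖ ≤ 4 * (K * (A + B)) * Real.exp (C * ‖M‖ ^ 2 * Q) :=
    ((hΘ.isVolterra hT hU hW M c).norm_le hT hg hfix
      (fun t ht => hΘ.norm_duhamelMap_zero_le hT hU hW M hc hQ hB hWB ht) ht).trans (by gcongr)
  calc ‖iterPrim c g q t‖
      ≤ (1 + T) ^ q * (A + 4 * (K * (A + B)) * Real.exp (C * ‖M‖ ^ 2 * Q)) :=
        norm_iterPrim_le hT hc hg hgle q ht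
    _ ≤ (1 + T) ^ κ * (A + B + 4 * (K * (A + B)) * Real.exp (C * ‖M‖ ^ 2 * Q)) := by
        gcongr
        · linarith
        · linarith
    _ = solutionBound T C ‖M‖ Q κ * (A + B) := by rw [solutionBound]; ring

end IsDuhamelMap

end FixedPoint

/-! ### Mild solutions and their sine coefficients -/

section Mode

variable {T : ℝ} {j : ℕ+} {S S' : ℝ → ℂ}

theorem hasDerivAt_timeExp (j : ℕ+) (t : ℝ) :
    HasDerivAt (timeExp j) (Complex.I * eigVal j * timeExp j t) t := by
  have h : HasDerivAt (fun t : ℝ => Complex.I * eigVal j * (t : ℂ)) (Complex.I * eigVal j) t := by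
    simpa using (Complex.ofRealCLM.hasDerivAt (x := t)).const_mul (Complex.I * eigVal j)
  exact h.cexp.congr_deriv (mul_comm _ _)

theorem hasDerivAt_timeExp_neg (j : ℕ+) (t : ℝ) :
    HasDerivAt (fun t => timeExp j (-t)) (-Complex.I * eigVal j * timeExp j (-t)) t :=
  ((hasDerivAt_timeExp j (-t)).scomp t (hasDerivAt_neg t)).congr_deriv (by simp)

theorem isPrimitive_timeExp (T : ℝ) (j : ℕ+) :
    IsPrimitive 0 T (timeExp j) fun t => Complex.I * eigVal j * timeExp j t :=
  .of_hasDerivAt (hasDerivAt_timeExp j) (continuous_const.mul (continuous_timeExp j))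

theorem isPrimitive_timeExp_neg (T : ℝ) (j : ℕ+) :
    IsPrimitive 0 T (fun t => timeExp j (-t)) fun t => -Complex.I * eigVal j * timeExp j (-t) :=
  .of_hasDerivAt (hasDerivAt_timeExp_neg j)
    (continuous_const.mul ((continuous_timeExp j).comp continuous_neg))

theorem IsPrimitive.integral_timeExp_mul (h : IsPrimitive 0 T S S') (h0 : S 0 = 0) {t : ℝ}
    (ht : t ∈ Icc 0 T) : ∫ τ in (0 : ℝ)..t, timeExp j τ * S' τ =
      timeExp j t * S t - Complex.I * eigVal j * ∫ τ in (0 : ℝ)..t, timeExp j τ * S τ := by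
  have hS : IsPrimitive 0 t S S' :=
    ⟨intervalIntegrable_mono_Icc h.integrable ⟨le_rfl, ht.1.trans ht.2⟩ ht,
      fun x hx => h.eq x ⟨hx.1, hx.2.trans ht.2⟩⟩
  have hparts := (isPrimitive_timeExp t j).integral_smul_eq ht.1 hS
  simpa only [smul_eq_mul, h0, mul_zero, sub_zero, mul_assoc,
    intervalIntegral.integral_const_mul] using hparts

/-- The solution of `i y' = λ_j y - S`, `y(0) = z`: the `j`-th sine coefficient of a function
given by a Duhamel formula. -/
def modeDuhamel (j : ℕ+) (z : ℂ) (S : ℝ → ℂ) (t : ℝ) : ℂ :=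
  timeExp j (-t) * z + Complex.I * ∫ τ in (0 : ℝ)..t, timeExp j (-(t - τ)) * S τ

theorem modeDuhamel_zero (j : ℕ+) (z : ℂ) (S : ℝ → ℂ) : modeDuhamel j z S 0 = z := by
  simp [modeDuhamel, timeExp]

theorem modeDuhamel_eq_mul (j : ℕ+) (z : ℂ) (S : ℝ → ℂ) (t : ℝ) : modeDuhamel j z S t =
    timeExp j (-t) * (z + ∫ τ in (0 : ℝ)..t, Complex.I * (timeExp j τ * S τ)) := by
  rw [modeDuhamel, integral_timeExp_neg_sub_mul, intervalIntegral.integral_const_mul]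
  ring

theorem IsPrimitive.modeDuhamel (hT : 0 ≤ T) (h : IsPrimitive 0 T S S') (h0 : S 0 = 0) (j : ℕ+)
    (z : ℂ) : IsPrimitive 0 T (modeDuhamel j z S)
      (modeDuhamel j (-Complex.I * eigVal j * z) S') := by
  have hint : IntervalIntegrable (fun τ => timeExp j τ * S τ) volume 0 T := by
    refine ContinuousOn.intervalIntegrable ?_
    rw [uIcc_of_le hT]
    exact (continuous_timeExp j).continuousOn.mul (h.continuousOn hT)
  have hprod := (isPrimitive_timeExp_neg T j).smul hT (.of_integral z (hint.const_mul Complex.I))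
  refine (hprod.congr_ae hT ?_).congr hT fun t _ => modeDuhamel_eq_mul j z S t
  filter_upwards [self_mem_ae_restrict measurableSet_Ioo] with t ht
  simp only [modeDuhamel_eq_mul, intervalIntegral.integral_const_mul, smul_eq_mul,
    h.integral_timeExp_mul h0 (Ioo_subset_Icc_self ht)]
  ring

theorem iterPrim_eqOn_modeDuhamel (hT : 0 ≤ T) {κ : ℕ} {S : ℕ → ℝ → ℂ} (hS : IsJet 0 T κ S)
    (hS0 : ∀ n < κ, S n 0 = 0) {c : ℕ → ℂ} (hc : ∀ q < κ, c q = -Complex.I * eigVal j * c (q + 1))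
    {y : ℝ → ℂ} (hy : Continuous y) (hyS : EqOn y (modeDuhamel j (c 0) (S κ)) (Icc 0 T)) {q : ℕ}
    (hq : q ≤ κ) : EqOn (iterPrim c y q) (modeDuhamel j (c q) (S (κ - q))) (Icc 0 T) := by
  induction q with
  | zero => exact hyS
  | succ q ih =>
    intro t ht
    have hlt : κ - (q + 1) < κ := by lia
    have hprim := (hS _ hlt).modeDuhamel hT (hS0 _ hlt) j (c (q + 1))
    rw [show κ - (q + 1) + 1 = κ - q by lia, ← hc q hq] at hprim
    rw [(isPrimitive_iterPrim c hy q).eq t ht, hprim.eq t ht, modeDuhamel_zero]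
    congr 1
    · simp [iterPrim]
    · refine intervalIntegral.integral_congr fun τ hτ => ih (by lia) ?_
      rw [uIcc_of_le ht.1] at hτ
      exact ⟨hτ.1, hτ.2.trans ht.2⟩

end Mode

section InitialData

variable {r s k n : ℕ}

theorem norm_pow_mul_neg_I_eigVal_pow_mul_le (h : s + 2 * n ≤ r) (j : ℕ+) (z : ℂ) :
    ‖(j : ℂ) ^ s * ((-Complex.I * eigVal j) ^ n * z)‖ ≤ Real.pi ^ (2 * n) * ‖(j : ℂ) ^ r * z‖ := by
  have hj : (1 : ℝ) ≤ j := mod_cast (one_le : (1 : ℕ+) ≤ j)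
  have hval : ‖(-Complex.I * eigVal j : ℂ)‖ = (j : ℝ) ^ 2 * Real.pi ^ 2 := by
    rw [norm_mul, norm_neg, Complex.norm_I, one_mul, Complex.norm_real, eigVal,
      Real.norm_of_nonneg (by positivity), mul_pow]
  simp only [norm_mul, norm_pow, hval, Complex.norm_natCast]
  calc (j : ℝ) ^ s * (((j : ℝ) ^ 2 * Real.pi ^ 2) ^ n * ‖z‖)
      = Real.pi ^ (2 * n) * ((j : ℝ) ^ (s + 2 * n) * ‖z‖) := by ring
    _ ≤ Real.pi ^ (2 * n) * ((j : ℝ) ^ r * ‖z‖) := by gcongr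

theorem HZero.exists_coef_eq_pow_mul (h : s + 2 * n ≤ r) (ψ : HZero r) : ∃ φ : HZero s,
    (∀ j, coef j φ = (-Complex.I * eigVal j) ^ n * coef j ψ) ∧
      ‖φ‖ ≤ Real.pi ^ (2 * n) * ‖ψ‖ := by
  have hsum (S : Finset ℕ+) : ∑ j ∈ S, ‖(j : ℂ) ^ s * ((-Complex.I * eigVal j) ^ n * coef j ψ)‖ ^ 2
      ≤ (Real.pi ^ (2 * n) * ‖ψ‖) ^ 2 := by
    calc ∑ j ∈ S, ‖(j : ℂ) ^ s * ((-Complex.I * eigVal j) ^ n * coef j ψ)‖ ^ 2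
        ≤ ∑ j ∈ S, (Real.pi ^ (2 * n) * ‖(j : ℂ) ^ r * coef j ψ‖) ^ 2 :=
          Finset.sum_le_sum fun j _ => pow_le_pow_left₀ (norm_nonneg _)
            (norm_pow_mul_neg_I_eigVal_pow_mul_le h j _) 2
      _ ≤ (Real.pi ^ (2 * n) * ‖ψ‖) ^ 2 := by
          simp only [mul_pow, ← Finset.mul_sum]
          gcongr
          exact sum_le_hasSum S (fun j _ => by positivity) ψ.hasSum_norm_sq
  obtain ⟨φ, hφ⟩ := exists_coef_eq _ hsum
  refine ⟨φ, hφ, (sq_le_sq₀ (norm_nonneg _) (by positivity)).1 (φ.norm_sq_le fun S => ?_)⟩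
  simpa only [hφ] using hsum S

/-- The initial values `c q = (-iA)^(k-q) ψ₀` of the `(k-q)`-th time derivative of a solution. -/
structure IsInitialJet (k : ℕ) (c : ℕ → HZero s) (ψ₀ : HZero r) : Prop where
  coef_last : ∀ j, HZero.coef j (c k) = HZero.coef j ψ₀
  coef_eq : ∀ q < k, ∀ j, HZero.coef j (c q) = -Complex.I * eigVal j * HZero.coef j (c (q + 1))

theorem exists_isInitialJet (h : s + 2 * k ≤ r) (ψ₀ : HZero r) :
    ∃ c : ℕ → HZero s, IsInitialJet k c ψ₀ ∧ ∀ q, ‖c q‖ ≤ Real.pi ^ (2 * k) * ‖ψ₀‖ := by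
  choose! a ha hle using fun n (hn : n ≤ k) =>
    HZero.exists_coef_eq_pow_mul (s := s) (n := n) (show s + 2 * n ≤ r by lia) ψ₀
  refine ⟨fun q => a (k - q), ⟨fun j => ?_, fun q hq j => ?_⟩, fun q => ?_⟩
  · rw [ha _ (k.sub_le k), Nat.sub_self, pow_zero, one_mul]
  · rw [ha _ (k.sub_le q), ha _ (k.sub_le (q + 1)), ← mul_assoc, ← pow_succ']
    congr 2
    lia
  · refine (hle _ (k.sub_le q)).trans ?_
    gcongr
    · linarith [Real.pi_gt_three]
    · exact k.sub_le q

end InitialData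

section Group

theorem inner_schrodingerGroup (t : ℝ) (φ : L2 ℂ 0 1) (j : ℕ+) :
    inner ℂ (eigVec j) (schrodingerGroup t φ) = timeExp j (-t) * inner ℂ (eigVec j) φ := by
  have h := (hasSum_schrodingerGroup t φ).mapL (innerSL ℂ (eigVec j))
  refine h.unique ((hasSum_ite_eq j (timeExp j (-t) * inner ℂ (eigVec j) φ)).congr_fun fun i => ?_)
  rw [innerSL_apply_apply, inner_smul_right, orthonormal_iff_ite.1 orthonormal_eigVec j i]
  rcases eq_or_ne i j with rfl | hij
  · simp [timeExp]
  · rw [if_neg hij.symm, if_neg hij, mul_zero]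

theorem hasSum_sq_norm_inner_eigVec (φ : L2 ℂ 0 1) :
    HasSum (fun j : ℕ+ => ‖inner ℂ (eigVec j) φ‖ ^ 2) (‖φ‖ ^ 2) := by
  have h := lp.hasSum_norm (p := 2) (by norm_num) (eigBasis.repr φ)
  simpa only [ENNReal.toReal_ofNat, Real.rpow_ofNat, LinearIsometryEquiv.norm_map,
    HilbertBasis.repr_apply_apply, eigBasis_apply] using h

theorem norm_schrodingerGroup (t : ℝ) (φ : L2 ℂ 0 1) : ‖schrodingerGroup t φ‖ = ‖φ‖ := by
  have h := hasSum_sq_norm_inner_eigVec (schrodingerGroup t φ)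
  simp only [inner_schrodingerGroup, norm_mul, norm_timeExp, one_mul] at h
  exact (pow_left_inj₀ (norm_nonneg _) (norm_nonneg _) two_ne_zero).1
    (h.unique (hasSum_sq_norm_inner_eigVec φ))

theorem integrable_schrodingerGroup {ν : Measure ℝ} (t : ℝ) {F : ℝ → L2 ℂ 0 1}
    (hF : Integrable F ν) : Integrable (fun τ => schrodingerGroup (t - τ) (F τ)) ν := by
  refine hF.mono ?_ (Eventually.of_forall fun τ => (norm_schrodingerGroup _ _).le)
  refine aestronglyMeasurable_of_tendsto_ae (u := atTop) (fun S => ?_)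
    (Eventually.of_forall fun τ => hasSum_schrodingerGroup (t - τ) (F τ))
  refine Finset.aestronglyMeasurable_fun_sum _ fun j _ =>
    (AEStronglyMeasurable.mul ?_ ?_).smul_const _
  · exact Continuous.aestronglyMeasurable (by fun_prop)
  · exact (innerSL ℂ (eigVec j)).continuous.comp_aestronglyMeasurable hF.aestronglyMeasurable

theorem inner_add_I_smul_integral_schrodingerGroup (j : ℕ+) {t : ℝ} {φ : L2 ℂ 0 1}
    {F : ℝ → L2 ℂ 0 1} (hF : IntervalIntegrable F volume 0 t) :
    inner ℂ (eigVec j) (schrodingerGroup t φ +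
        Complex.I • ∫ τ in (0 : ℝ)..t, schrodingerGroup (t - τ) (F τ)) =
      modeDuhamel j (inner ℂ (eigVec j) φ) (fun τ => inner ℂ (eigVec j) (F τ)) t := by
  have hcomm := ((innerSL ℂ (eigVec j)).restrictScalars ℝ).intervalIntegral_comp_comm
    (intervalIntegrable_iff.2 (integrable_schrodingerGroup t (intervalIntegrable_iff.1 hF)))
  simp only [ContinuousLinearMap.coe_restrictScalars', innerSL_apply_apply,
    inner_schrodingerGroup] at hcomm
  rw [inner_add_right, inner_smul_right, inner_schrodingerGroup, ← hcomm, modeDuhamel]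

end Group

namespace IsDuhamelMap

variable {m r s d κ : ℕ} {T C : ℝ} {Θ : (ℝ → InterSpace m r) → ℝ → HZero s} {U : ℕ → ℝ → ℝ}
  {W : ℕ → ℝ → InterSpace m r} {c : ℕ → HZero s} {g : ℝ → HZero s}

theorem coef_duhamelMap (hΘ : IsDuhamelMap T C Θ)
    (hU : ∀ l ≤ κ, MemLp (U l) 2 (volume.restrict (Ioo 0 T)))
    (hW : MemLp (W κ) 2 (volume.restrict (Ioo 0 T))) (M : HZero s →L[ℝ] InterSpace m r)
    (hg : Continuous g) {t : ℝ} (ht : t ∈ Icc 0 T) (j : ℕ+) :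
    HZero.coef j (duhamelMap Θ U M W c κ g t) = modeDuhamel j (HZero.coef j (c 0))
      (fun τ => InterSpace.coef j (sourceDeriv U M W c κ g κ τ)) t := by
  rw [duhamelMap, map_add, HZero.coef_evolve,
    (hΘ.isDuhamel _ (memLp_sourceDeriv M hU hW hg)).coef_eq t ht, modeDuhamel]

theorem coef_iterPrim_fixed (hΘ : IsDuhamelMap T C Θ) (hT : 0 ≤ T)
    (hU : ∀ l ≤ κ, MemLp (U l) 2 (volume.restrict (Ioo 0 T)))
    (hW : MemLp (W κ) 2 (volume.restrict (Ioo 0 T))) (hUJ : IsJet 0 T κ U)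
    (hU0 : ∀ l < κ, U l 0 = 0) (hWJ : IsJet 0 T κ W) (hW0 : ∀ l < κ, W l 0 = 0)
    (M : HZero s →L[ℝ] InterSpace m r) {ψ₀ : HZero d} (hc : IsInitialJet κ c ψ₀)
    (hg : Continuous g) (hfix : ∀ t ∈ Icc 0 T, g t = duhamelMap Θ U M W c κ g t) {t : ℝ}
    (ht : t ∈ Icc 0 T) (j : ℕ+) :
    HZero.coef j (iterPrim c g κ t) = modeDuhamel j (HZero.coef j ψ₀)
      (fun τ => InterSpace.coef j (U 0 τ • M (iterPrim c g κ τ) + W 0 τ)) t := by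
  have hS : IsJet 0 T κ fun n τ => InterSpace.coef j (sourceDeriv U M W c κ g n τ) :=
    fun n hn => (isJet_sourceDeriv hT M hUJ hWJ hg n hn).clm_comp (InterSpace.coef j)
  have hS0 : ∀ n < κ, InterSpace.coef j (sourceDeriv U M W c κ g n 0) = 0 := fun n hn => by
    rw [sourceDeriv_eq_zero M (fun l hl => hU0 l (hl.trans_lt hn)) (hW0 n hn), map_zero]
  have hcg : Continuous fun τ => HZero.coef j (g τ) := (HZero.coef j).continuous.comp hg
  have heq := iterPrim_eqOn_modeDuhamel hT hS hS0 (fun q hq => hc.coef_eq q hq j) hcg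
    (fun t ht => (congrArg (HZero.coef j) (hfix t ht)).trans
      (hΘ.coef_duhamelMap hU hW M hg ht j)) le_rfl ht
  simp only [Nat.sub_self, sourceDeriv_zero, hc.coef_last j] at heq
  exact (clm_iterPrim c ((HZero.coef j).restrictScalars ℝ) hg κ t).trans heq

end IsDuhamelMap

section Mild

variable {T : ℝ} {p k m r : ℕ} {μ : Sobolev ℝ 0 1 m} {u : Sobolev ℝ 0 T k}
  {f : Sobolev (InterSpace (2 * p + 3) (2 * p + 1)) 0 T k} {C : ℝ}
  {Θ : (ℝ → InterSpace (2 * p + 3) (2 * p + 1)) → ℝ → HZero (2 * p + 3)}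
  {U : ℕ → ℝ → ℝ} {W : ℕ → ℝ → InterSpace (2 * p + 3) (2 * p + 1)}
  {M : HZero (2 * p + 3) →L[ℝ] InterSpace (2 * p + 3) (2 * p + 1)} {ψ₀ : HZero r}
  {c : ℕ → HZero (2 * p + 3)} {ψ ψ' g : ℝ → HZero (2 * p + 3)}

theorem ae_toL2_smul_mul_add (hU : IsRepJet u U) (hW : IsRepJet f W)
    (hM : ∀ φ, (M φ).toL2 =ᵐ[volume.restrict (Ioo (0 : ℝ) 1)] fun y => μ.fn y • φ.toL2 y) :
    ∀ᵐ τ ∂(volume.restrict (Ioo 0 T)), ∀ φ : HZero (2 * p + 3),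
      (U 0 τ • M φ + W 0 τ).toL2 =ᵐ[volume.restrict (Ioo (0 : ℝ) 1)] fun x =>
        (u.fn τ : ℂ) * (μ.fn x : ℂ) * φ.toL2 x + (f.fn τ).toL2 x := by
  filter_upwards [hU.ae_eq 0 k.succ_pos, hW.ae_eq 0 k.succ_pos] with τ hUτ hWτ φ
  have hu : u.fn τ = U 0 τ := hUτ
  have hf : f.fn τ = W 0 τ := hWτ
  have hadd : (U 0 τ • M φ + W 0 τ).toL2 = U 0 τ • (M φ).toL2 + (W 0 τ).toL2 := by
    simp only [← InterSpace.toL2CLM_apply, map_add, map_smul]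
  rw [hadd, hu, hf]
  filter_upwards [Lp.coeFn_add (U 0 τ • (M φ).toL2) (W 0 τ).toL2,
    Lp.coeFn_smul (U 0 τ) (M φ).toL2, hM φ] with x hax hsx hMx
  rw [hax, Pi.add_apply, hsx, Pi.smul_apply, hMx, Complex.real_smul, Complex.real_smul, mul_assoc]

theorem IsMildSolution.continuous_projIcc (hT : 0 ≤ T) (h : IsMildSolution T p k μ u f ψ₀ ψ) :
    Continuous fun t => ψ (projIcc 0 T hT t) :=
  (continuousOn_iff_continuous_domRestrict.1 h.contDiffOn.continuousOn).comp
    _root_.continuous_projIcc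

theorem IsMildSolution.eq_duhamelMap (hT : 0 ≤ T) (hΘ : IsDuhamelMap T C Θ)
    (hU : IsRepJet u U) (hW : IsRepJet f W)
    (hM : ∀ φ, (M φ).toL2 =ᵐ[volume.restrict (Ioo (0 : ℝ) 1)] fun y => μ.fn y • φ.toL2 y)
    (hc : ∀ j, HZero.coef j (c 0) = HZero.coef j ψ₀) (h : IsMildSolution T p k μ u f ψ₀ ψ)
    {t : ℝ} (ht : t ∈ Icc 0 T) : ψ (projIcc 0 T hT t) =
      duhamelMap Θ U M W c 0 (fun t => ψ (projIcc 0 T hT t)) t := by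
  obtain ⟨F, hFi, hFe, hD⟩ := h.duhamel
  refine HZero.ext_coef fun j => ?_
  rw [hΘ.coef_duhamelMap (fun l hl => hU.memLp (by lia)) (hW.memLp k.succ_pos) M
    (h.continuous_projIcc hT) ht, hc, projIcc_of_mem hT ht, HZero.coef_apply, hD t ht,
    inner_add_I_smul_integral_schrodingerGroup j (intervalIntegrable_mono_Icc hFi ⟨le_rfl, hT⟩ ht)]
  simp only [modeDuhamel, ← integral_Ioo_eq_intervalIntegral ht.1]
  congr 2
  refine integral_congr_ae ?_
  have hsub : Ioo 0 t ⊆ Ioo 0 T := Ioo_subset_Ioo le_rfl ht.2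
  filter_upwards [ae_restrict_of_ae_restrict_of_subset hsub hFe,
    ae_restrict_of_ae_restrict_of_subset hsub (ae_toL2_smul_mul_add hU hW hM),
    self_mem_ae_restrict measurableSet_Ioo] with τ hFτ hsource hτ
  rw [sourceDeriv_zero, iterPrim, projIcc_of_mem hT (Ioo_subset_Icc_self (hsub hτ)),
    InterSpace.coef_apply, Lp.ext (hFτ.trans (hsource _).symm)]

theorem isMildSolution_iterPrim (hT : 0 ≤ T) (hΘ : IsDuhamelMap T C Θ) (hU : IsRepJet u U)
    (hU0 : ∀ l < k, U l 0 = 0) (hW : IsRepJet f W) (hW0 : ∀ l < k, W l 0 = 0)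
    (hM : ∀ φ, (M φ).toL2 =ᵐ[volume.restrict (Ioo (0 : ℝ) 1)] fun y => μ.fn y • φ.toL2 y)
    (hc : IsInitialJet k c ψ₀) (hg : Continuous g)
    (hfix : ∀ t ∈ Icc 0 T, g t = duhamelMap Θ U M W c k g t) :
    IsMildSolution T p k μ u f ψ₀ (iterPrim c g k) := by
  have hF : MemLp (fun τ => U 0 τ • M (iterPrim c g k τ) + W 0 τ) 2 (volume.restrict (Ioo 0 T)) :=
    (memLp_smul_of_continuousOn_right (hU.memLp k.succ_pos)
      (M.continuous.comp (continuous_iterPrim c hg k)).continuousOn).add (hW.memLp k.succ_pos)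
  have hFi : IntervalIntegrable
      (fun τ => (U 0 τ • M (iterPrim c g k τ) + W 0 τ).toL2) volume 0 T :=
    intervalIntegrable_of_memLp_two hT (InterSpace.toL2CLM.comp_memLp' hF)
  refine ⟨(contDiff_iterPrim c hg k).contDiffOn, _, hFi, ?_,
    fun t ht => ext_inner_eigVec fun j => ?_⟩
  · filter_upwards [ae_toL2_smul_mul_add hU hW hM] with τ hτ using hτ _
  · rw [inner_add_I_smul_integral_schrodingerGroup j
      (intervalIntegrable_mono_Icc hFi ⟨le_rfl, hT⟩ ht)]
    exact hΘ.coef_iterPrim_fixed hT (fun l hl => hU.memLp (Nat.lt_succ_of_le hl))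
      (hW.memLp k.lt_succ_self) hU.jet hU0 hW.jet hW0 M hc hg hfix ht j

theorem IsMildSolution.eqOn (hT : 0 < T) (hm : 2 * p + 3 ≤ m)
    (hμ : ∀ n (hn : n < p), VanishesAtEnds (μ.der ⟨2 * n + 1, by lia⟩)) (hr : 2 * p + 3 ≤ r)
    (h : IsMildSolution T p k μ u f ψ₀ ψ) (h' : IsMildSolution T p k μ u f ψ₀ ψ') :
    EqOn ψ ψ' (Icc 0 T) := by
  obtain ⟨M, hM⟩ := exists_clm_eq_mul hm μ hμ
  obtain ⟨C, Θ, hΘ⟩ := exists_isDuhamelMap (n := p + 1) (r := 2 * p + 1) (by lia) hT.le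
  obtain ⟨U, hU⟩ := u.exists_isRepJet hT
  obtain ⟨W, hW⟩ := f.exists_isRepJet hT
  obtain ⟨c, hc, -⟩ := exists_isInitialJet (s := 2 * p + 3) (k := 0) hr ψ₀
  have hUm : ∀ l ≤ 0, MemLp (U l) 2 (volume.restrict (Ioo 0 T)) := fun l hl => hU.memLp (by lia)
  have hV := hΘ.isVolterra hT.le hUm (hW.memLp k.succ_pos) M c
  intro t ht
  simpa only [projIcc_of_mem hT.le ht] using hV.eqOn hT.le (h.continuous_projIcc hT.le)
    (h'.continuous_projIcc hT.le)
    (fun t ht => h.eq_duhamelMap hT.le hΘ hU hW hM hc.coef_last ht)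
    (fun t ht => h'.eq_duhamelMap hT.le hΘ hU hW hM hc.coef_last ht) ht

end Mild

section Existence

theorem Sobolev.norm_der_le {E : Type*} [NormedAddCommGroup E] [NormedSpace ℝ E] {a b : ℝ} {n : ℕ}
    (w : Sobolev E a b n) (i : Fin (n + 1)) : ‖w.der i‖ ≤ ‖w‖ :=
  PiLp.norm_apply_le w.1 i

theorem IsRepJet.integral_norm_sq {E : Type*} [NormedAddCommGroup E] [NormedSpace ℝ E] {a b : ℝ}
    (hab : a ≤ b) {n : ℕ} {w : Sobolev E a b n} {G : ℕ → ℝ → E} (h : IsRepJet w G) :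
    ∫ x in a..b, ‖G n x‖ ^ 2 = ‖w.der (Fin.last n)‖ ^ 2 := by
  rw [L2.norm_sq_eq_integral, ← integral_Ioo_eq_intervalIntegral hab]
  refine integral_congr_ae ?_
  filter_upwards [h.ae_eq n n.lt_succ_self] with x hx
  rw [← hx]
  rfl

theorem ckNorm_iterPrim_le {Y : Type*} [NormedAddCommGroup Y] [NormedSpace ℝ Y] [CompleteSpace Y]
    {T : ℝ} (hT : 0 < T) {k : ℕ} {c : ℕ → Y} {g : ℝ → Y} (hg : Continuous g) {B : ℝ}
    (h : ∀ q ≤ k, ∀ t ∈ Icc 0 T, ‖iterPrim c g q t‖ ≤ B) :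
    ckNorm T k (iterPrim c g k) ≤ ENNReal.ofReal B := by
  refine iSup₂_le fun n hn => iSup₂_le fun t ht => ?_
  rw [iteratedDerivWithin_iterPrim c hT hg hn ht, ← ofReal_norm]
  exact ENNReal.ofReal_le_ofReal (h _ (k.sub_le n) t ht)

theorem ckNorm_congr {Y : Type*} [NormedAddCommGroup Y] [NormedSpace ℝ Y] {T : ℝ} (k : ℕ)
    {ψ φ : ℝ → Y} (h : EqOn ψ φ (Icc 0 T)) : ckNorm T k ψ = ckNorm T k φ := by
  refine iSup_congr fun n => iSup_congr fun _ => iSup_congr fun t => iSup_congr fun ht => ?_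
  rw [iteratedDerivWithin_congr h ht]

theorem IsDuhamelMap.solutionBound_pos {T C Q : ℝ} (hT : 0 ≤ T) (N : ℝ) (κ : ℕ) :
    0 < solutionBound T C N Q κ := by
  unfold solutionBound
  positivity

variable {T : ℝ} {p k m r : ℕ} {μ : Sobolev ℝ 0 1 m}

theorem exists_isMildSolution (hT : 0 < T) (hm : 2 * p + 3 ≤ m)
    (hμ : ∀ n (hn : n < p), VanishesAtEnds (μ.der ⟨2 * n + 1, by lia⟩))
    (hr : 2 * p + 3 + 2 * k ≤ r) : ∃ L : ℝ → ℝ, (∀ R, 0 < L R) ∧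
      ∀ u : Sobolev ℝ 0 T k, u.VanishesAtLeft → ∀ ψ₀ : HZero r,
        ∀ f : Sobolev (InterSpace (2 * p + 3) (2 * p + 1)) 0 T k, f.VanishesAtLeft →
          ∃ ψ : ℝ → HZero (2 * p + 3), IsMildSolution T p k μ u f ψ₀ ψ ∧
            ∀ R, sobolevZeroNorm u < R →
              ckNorm T k ψ ≤ ENNReal.ofReal (L R * (‖ψ₀‖ + ‖f‖)) := by
  obtain ⟨M, hM⟩ := exists_clm_eq_mul hm μ hμ
  obtain ⟨C, Θ, hΘ⟩ := exists_isDuhamelMap (n := p + 1) (r := 2 * p + 1) (by lia) hT.le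
  obtain ⟨K, hK, hKU⟩ := exists_integral_sourceWeight_sq_le hT.le k
  have hpi : 1 ≤ Real.pi ^ (2 * k) := one_le_pow₀ (by linarith [Real.pi_gt_three])
  refine ⟨fun R => IsDuhamelMap.solutionBound T C ‖M‖ (K * R ^ 2) k * Real.pi ^ (2 * k), fun R =>
    mul_pos (IsDuhamelMap.solutionBound_pos hT.le _ _) (by positivity), fun u hu ψ₀ f hf => ?_⟩
  obtain ⟨U, hU⟩ := u.exists_isRepJet hT
  obtain ⟨W, hW⟩ := f.exists_isRepJet hT
  have hU0 (l : ℕ) (hl : l < k) : U l 0 = 0 := (hU.leftValue_eq hT ⟨l, hl⟩).symm.trans (hu _)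
  have hW0 (l : ℕ) (hl : l < k) : W l 0 = 0 := (hW.leftValue_eq hT ⟨l, hl⟩).symm.trans (hf _)
  have hUm (l : ℕ) (hl : l ≤ k) := hU.memLp (Nat.lt_succ_of_le hl)
  have hWm := hW.memLp k.lt_succ_self
  obtain ⟨c, hc, hcle⟩ := exists_isInitialJet hr ψ₀
  obtain ⟨g, hg, hfix⟩ := (hΘ.isVolterra hT.le hUm hWm M c).exists_fixed hT.le
  refine ⟨iterPrim c g k, isMildSolution_iterPrim hT.le hΘ hU hU0 hW hW0 hM hc hg hfix,
    fun R hR => ckNorm_iterPrim_le hT hg fun q hq t ht => ?_⟩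
  have hQ : ∫ τ in (0 : ℝ)..T, sourceWeight T U k τ ^ 2 ≤ K * R ^ 2 := by
    refine (hKU U hU.jet hU0 hUm).trans (mul_le_mul_of_nonneg_left ?_ hK)
    exact (hU.integral_norm_sq hT.le).trans_le (pow_le_pow_left₀ (norm_nonneg _) hR.le 2)
  have hWf : ∫ τ in (0 : ℝ)..T, ‖W k τ‖ ^ 2 ≤ ‖f‖ ^ 2 :=
    (hW.integral_norm_sq hT.le).trans_le (pow_le_pow_left₀ (norm_nonneg _) (f.norm_der_le _) 2)
  refine (hΘ.norm_iterPrim_fixed_le hT.le hUm hWm M hcle hQ (norm_nonneg f) hWf hg hfix hq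
    ht).trans ?_
  rw [mul_assoc]
  refine mul_le_mul_of_nonneg_left ?_ (IsDuhamelMap.solutionBound_pos hT.le _ _).le
  rw [mul_add]
  gcongr
  exact le_mul_of_one_le_left (norm_nonneg f) hpi

end Existence

end BilinearSchrodinger
end

theorem theorem2p1_general (T : ℝ) (hT : 0 < T) (p k m : ℕ) (hm : 2 * p + 3 ≤ m)
    (μ : Sobolev ℝ 0 1 m)
    (hμ : ∀ n (hn : n < p), VanishesAtEnds (μ.der ⟨2 * n + 1, by lia⟩)) :
    (∀ u : Sobolev ℝ 0 T k, u.VanishesAtLeft → ∀ ψ₀ : HZero (2 * (p + k) + 3),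
      ∀ f : Sobolev (InterSpace (2 * p + 3) (2 * p + 1)) 0 T k, f.VanishesAtLeft →
        ∃ ψ : ℝ → HZero (2 * p + 3), IsMildSolution T p k μ u f ψ₀ ψ ∧
          ∀ ψ' : ℝ → HZero (2 * p + 3), IsMildSolution T p k μ u f ψ₀ ψ' →
            Set.EqOn ψ' ψ (Set.Icc 0 T)) ∧
    ∀ R : ℝ, ∃ C : ℝ, 0 < C ∧
      ∀ u : Sobolev ℝ 0 T k, u.VanishesAtLeft → sobolevZeroNorm u < R →
      ∀ ψ₀ : HZero (2 * (p + k) + 3),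
      ∀ f : Sobolev (InterSpace (2 * p + 3) (2 * p + 1)) 0 T k, f.VanishesAtLeft →
        ∀ ψ : ℝ → HZero (2 * p + 3), IsMildSolution T p k μ u f ψ₀ ψ →
          ckNorm T k ψ ≤ ENNReal.ofReal (C * (‖ψ₀‖ + ‖f‖)) := by
  have hr : 2 * p + 3 ≤ 2 * (p + k) + 3 := by lia
  obtain ⟨L, hL, hex⟩ := exists_isMildSolution (k := k) (r := 2 * (p + k) + 3) hT hm hμ (by lia)
  refine ⟨fun u hu ψ₀ f hf => ?_, fun R => ⟨L R, hL R, fun u hu huR ψ₀ f hf ψ hψ => ?_⟩⟩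
  · obtain ⟨ψ, hψ, -⟩ := hex u hu ψ₀ f hf
    exact ⟨ψ, hψ, fun ψ' hψ' => hψ'.eqOn hT hm hμ hr hψ⟩
  · obtain ⟨φ, hφ, hbound⟩ := hex u hu ψ₀ f hf
    exact (ckNorm_congr k (hψ.eqOn hT hm hμ hr hφ)).trans_le (hbound R huR)

theorem theorem2p1 (T : ℝ) (hT : 0 < T) (p k : ℕ)
    (μ : Sobolev ℝ 0 1 (2 * (p + k) + 3))
    (hμ : ∀ n (hn : n < p), VanishesAtEnds (μ.der ⟨2 * n + 1, by omega⟩)) :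
    (∀ u ∈ sobolevZero ℝ 0 T k, ∀ ψ₀ : HZero (2 * (p + k) + 3),
      ∀ f ∈ sobolevZero (InterSpace (2 * p + 3) (2 * p + 1)) 0 T k,
        ∃ ψ : ℝ → HZero (2 * p + 3), IsMildSolution T p k μ u f ψ₀ ψ ∧
          ∀ ψ' : ℝ → HZero (2 * p + 3), IsMildSolution T p k μ u f ψ₀ ψ' →
            Set.EqOn ψ' ψ (Set.Icc 0 T)) ∧
    ∀ R : ℝ, 0 < R → ∃ C : ℝ, 0 < C ∧ ∀ u ∈ sobolevZero ℝ 0 T k, sobolevZeroNorm u < R →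
      ∀ ψ₀ : HZero (2 * (p + k) + 3),
      ∀ f ∈ sobolevZero (InterSpace (2 * p + 3) (2 * p + 1)) 0 T k,
        ∀ ψ : ℝ → HZero (2 * p + 3), IsMildSolution T p k μ u f ψ₀ ψ →
          ckNorm T k ψ ≤ ENNReal.ofReal (C * (‖ψ₀‖ + ‖f‖)) := by
  have ⟨hex, hbound⟩ := theorem2p1_general T hT p k _ (by lia) μ hμ
  exact ⟨fun u hu ψ₀ f hf => hex u (Sobolev.vanishesAtLeft_of_mem_sobolevZero hT hu) ψ₀ f
      (Sobolev.vanishesAtLeft_of_mem_sobolevZero hT hf),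
    fun R _ => (hbound R).imp fun C hC => ⟨hC.1, fun u hu huR ψ₀ f hf =>
      hC.2 u (Sobolev.vanishesAtLeft_of_mem_sobolevZero hT hu) huR ψ₀ f
        (Sobolev.vanishesAtLeft_of_mem_sobolevZero hT hf)⟩⟩
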